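/- \textbf{Setting.} There are $n\ge 2$ identical firms with marginal cost $0$ and one consumer with unit demand and outside option $0$. The match values $x_i\in\{0,1\}$ are i.i.d. with $\mathbb P(x_i=1)=\mu\in(0,1)$; the cost of visiting a firm is $c\in[0,\mu)$. Each firm $i$ simultaneously chooses, possibly by a mixed strategy, a price $p_i\ge 0$ and a signal, i.e. a probability distribution $F_i$ over posterior expected match values with support in $[0,1]$ and mean $\mu$. Prices are posted, signals are hidden. The consumer observes the prices, forms conjectures $\tilde F_i$ (again distributions with support in $[0,1]$ and mean $\mu$) about the signals, and searches sequentially with costless recall: a visit to firm $i$ costs $c$ and reveals a posterior drawn from $F_i$; she may buy only from a firm she has visited. If she buys from firm $i$ after $k$ visits, her expected payoff is $x_i-p_i-kc$, where $x_i$ now denotes the posterior observed at firm $i$, and firm $i$ earns $p_i$. A symmetric equilibrium is a weak perfect Bayesian equilibrium in which all firms use the same mixed strategy over pairs (price, signal), the conjecture about firm $i$ depends only on firm $i$'s own price (``no signaling what you don't know''), conjectures are correct for almost every equilibrium price, and the consumer's (possibly randomized) search policy is optimal at every information set. The information $F$ is \emph{useless} if its support lies in $[\mu-c,1]$. A reservation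 value of a firm with signal $F$ and price $p$ is a solution $U$ of $c=\int_{U+p}^1(x-p-U)\,dF(x)$, and the effective value of the firm is $\min\{x-p,U\}$, where $x\sim F$. \textbf{Proposition 1.} (a) A symmetric equilibrium exists. More precisely, every mixed strategy that charges the price $0$ and provides useless information with probability one is the firms' strategy in some symmetric equilibrium, in which, moreover, the conjectures are given by the same function of the price for all firms and the consumer stops whenever stopping is optimal. (b) Suppose $c>0$. Then in every symmetric equilibrium, with probability one, every firm charges the price $0$ and provides useless information; its reservation value is uniquely determined and its effective value is identically $\mu-c$. With probability one the consumer visits some firm, and upon the first visit, to firm $j$ say, with posterior $x_j$, buying from $j$ immediately is optimal; she does so with probability one if $x_j>\mu-c$, and for every realized posterior if she breaks ties in favour of stopping. -/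

import Mathlib

open MeasureTheory
open scoped NNReal ENNReal

noncomputable section

namespace HiddenInfo

/-- A signal of a firm: a Bayes-plausible distribution over posterior expected match values, i.e. a
probability measure supported in `[0, 1]` with mean `μ`.  As a subtype of `Measure ℝ` it carries the
usual σ-algebra, generated by the evaluations `F ↦ F E`. -/
abbrev Signal (μ : ℝ) : Type :=
  {F : Measure ℝ // IsProbabilityMeasure F ∧ F.support ⊆ Set.Icc 0 1 ∧ ∫ x, x ∂F = μ}

/-- Useless information: the support of the distribution over posteriors lies in `[μ - c, 1]`. -/
def Useless (μ c : ℝ) (F : Measure ℝ) : Prop := F.support ⊆ Set.Icc (μ - c) 1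

/-- `U` is a reservation value of a firm with signal `F` and price `q`:
`c = ∫_{U+q}^{1} (x - q - U) dF(x)`. -/
def IsReservationValue (c : ℝ) (F : Measure ℝ) (q U : ℝ) : Prop :=
  c = ∫ x in Set.Icc (U + q) 1, (x - q - U) ∂F

/-- The joint law of (price, realized posterior) when a firm draws its price and its signal from the
mixed strategy `σ`, and the posterior is then drawn from the signal. -/
def outcomeLaw {μ : ℝ} (σ : Measure (ℝ≥0 × Signal μ)) : Measure (ℝ≥0 × ℝ) :=
  σ.bind fun a => (Measure.dirac a.1).prod a.2.1

/-- A (behavioural) sequential search policy of the consumer, facing fixed prices of `n` firms.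
An information set is given by the list `v` of the firms visited so far (most recent first) and by
their realized posteriors `x j`, `j ∈ v`.  At each information set the consumer visits an unvisited
firm, buys from a firm she has visited (costless recall), or takes the outside option (`quit`), with
the given probabilities. -/
structure SearchPolicy (n : ℕ) where
  visit : List (Fin n) → (Fin n → ℝ) → Fin n → ℝ
  buy : List (Fin n) → (Fin n → ℝ) → Fin n → ℝ
  quit : List (Fin n) → (Fin n → ℝ) → ℝ
  visit_nonneg : ∀ v x j, 0 ≤ visit v x j
  buy_nonneg : ∀ v x j, 0 ≤ buy v x j
  quit_nonneg : ∀ v x, 0 ≤ quit v x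
  total : ∀ v x, ∑ j, visit v x j + ∑ j, buy v x j + quit v x = 1
  visit_unvisited : ∀ v x j, j ∈ v → visit v x j = 0
  buy_visited : ∀ v x j, j ∉ v → buy v x j = 0
  /-- Only the posteriors of visited firms are known. -/
  adapted : ∀ v x x', (∀ j ∈ v, x j = x' j) →
    visit v x = visit v x' ∧ buy v x = buy v x' ∧ quit v x = quit v x'
  measurable_visit : ∀ v j, Measurable fun x => visit v x j
  measurable_buy : ∀ v j, Measurable fun x => buy v x j
  measurable_quit : ∀ v, Measurable fun x => quit v x

/-- The consumer's expected payoff, from the information set `(v, x)` on, of following the policy `π`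
when the prices are `p`, her conjecture about firm `j`'s distribution over posteriors is `B j`, and
every visit costs `c`; costs already sunk are left out.  Buying from `i` pays `x i - p i`, the
outside option pays `0`. -/
def searchPayoff {n : ℕ} (c : ℝ) (p : Fin n → ℝ≥0) (B : Fin n → Measure ℝ) (π : SearchPolicy n)
    (v : List (Fin n)) (x : Fin n → ℝ) : ℝ :=
  if v.length < n then
    ∑ i, π.buy v x i * (x i - p i) +
      ∑ j, π.visit v x j *
        (∫ z, searchPayoff c p B π (j :: v) (Function.update x j z) ∂(B j) - c)
  else ∑ i, π.buy v x i * (x i - p i)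
termination_by n - v.length
decreasing_by simp only [List.length_cons]; omega

/-- The probability, from the information set `(v, x)` on, that the consumer who follows `π` ends up
buying from firm `i` when the realized posteriors of all firms are `x`. -/
def buyProb {n : ℕ} (π : SearchPolicy n) (x : Fin n → ℝ) (i : Fin n) (v : List (Fin n)) : ℝ :=
  if v.length < n then
    π.buy v x i + ∑ j, π.visit v x j * buyProb π x i (j :: v)
  else π.buy v x i
termination_by n - v.length
decreasing_by simp only [List.length_cons]; omega

/-- `π` is optimal for the consumer at every information set, among all search policies. -/
def SequentiallyRational {n : ℕ} (c : ℝ) (p : Fin n → ℝ≥0) (B : Fin n → Measure ℝ)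
    (π : SearchPolicy n) : Prop :=
  ∀ v : List (Fin n), v.Nodup → ∀ x : Fin n → ℝ, (∀ i, x i ∈ Set.Icc (0 : ℝ) 1) →
    ∀ τ : SearchPolicy n, searchPayoff c p B τ v x ≤ searchPayoff c p B π v x

/-- The best payoff of stopping the search at the information set `(v, x)`: the maximum of the
outside option `0` and of the sampled rewards. -/
def stopPayoff {n : ℕ} (p : Fin n → ℝ≥0) (v : List (Fin n)) (x : Fin n → ℝ) : ℝ :=
  v.toFinset.fold max 0 fun j => x j - p j

/-- The tie-breaking rule that the consumer stops searching whenever stopping is optimal. -/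
def StopsWhenIndifferent {n : ℕ} (c : ℝ) (p : Fin n → ℝ≥0) (B : Fin n → Measure ℝ)
    (π : SearchPolicy n) : Prop :=
  ∀ v : List (Fin n), v.Nodup → ∀ x : Fin n → ℝ, (∀ i, x i ∈ Set.Icc (0 : ℝ) 1) →
    (∀ τ : SearchPolicy n, searchPayoff c p B τ v x ≤ stopPayoff p v x) → ∀ j, π.visit v x j = 0

/-- An assessment of the game with posted prices and hidden information in which all `n` firms play
the same mixed strategy `firm` over prices and signals.  The consumer's policy depends on the whole
vector of posted prices; her conjecture about the signal of firm `i` depends on firm `i`'s own price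
only ("no signaling what you don't know"). -/
structure Assessment (n : ℕ) (μ : ℝ) where
  firm : Measure (ℝ≥0 × Signal μ)
  isProb : IsProbabilityMeasure firm
  belief : Fin n → ℝ≥0 → Signal μ
  measurable_belief : ∀ i, Measurable (belief i)
  policy : (Fin n → ℝ≥0) → SearchPolicy n
  measurable_visit : ∀ v j, Measurable fun ω : (Fin n → ℝ≥0) × (Fin n → ℝ) =>
    (policy ω.1).visit v ω.2 j
  measurable_buy : ∀ v j, Measurable fun ω : (Fin n → ℝ≥0) × (Fin n → ℝ) =>
    (policy ω.1).buy v ω.2 j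
  measurable_quit : ∀ v, Measurable fun ω : (Fin n → ℝ≥0) × (Fin n → ℝ) =>
    (policy ω.1).quit v ω.2

/-- The conjectures, as distributions over posteriors, at the price vector `p`. -/
def Assessment.conjecture {n : ℕ} {μ : ℝ} (A : Assessment n μ) (p : Fin n → ℝ≥0) :
    Fin n → Measure ℝ :=
  fun i => (A.belief i (p i)).1

/-- Expected profit of firm `i` (the marginal cost is `0`) when the consumer follows `policy` and the
pairs (price, posterior) of the firms are independent with laws `L j`. -/
def profit {n : ℕ} (policy : (Fin n → ℝ≥0) → SearchPolicy n) (L : Fin n → Measure (ℝ≥0 × ℝ))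
    (i : Fin n) : ℝ≥0∞ :=
  ∫⁻ ω, ((ω i).1 : ℝ≥0∞) *
    ENNReal.ofReal (buyProb (policy fun j => (ω j).1) (fun j => (ω j).2) i []) ∂(Measure.pi L)

/-- Symmetric weak perfect Bayesian equilibrium with hidden information and search cost `c`. -/
structure Assessment.IsEquilibrium {n : ℕ} {μ : ℝ} (c : ℝ) (A : Assessment n μ) : Prop where
  /-- No firm gains by deviating to another mixed strategy `τ`. -/
  firm_optimal : ∀ (i : Fin n) (τ : Measure (ℝ≥0 × Signal μ)), IsProbabilityMeasure τ →
    profit A.policy (Function.update (fun _ => outcomeLaw A.firm) i (outcomeLaw τ)) i ≤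
      profit A.policy (fun _ => outcomeLaw A.firm) i
  /-- After every vector of posted prices the consumer searches optimally, given her conjectures. -/
  consumer_optimal : ∀ p, SequentiallyRational c p (A.conjecture p) (A.policy p)
  /-- Bayes' rule: the conjecture given the price is the conditional law of the posterior given the
  price, i.e. replacing the signal by the conjecture leaves the law of (price, posterior) as it is. -/
  consistent : ∀ i, outcomeLaw (A.firm.map fun a => (a.1, A.belief i a.1)) = outcomeLaw A.firm

end HiddenInfo

end

/-! Optimal search follows Weitzman's indices. With reservation values `U j`, the value of search is
the expected maximum of the outside option, the sampled rewards and the effective values of the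
unvisited firms (`searchPayoff_le_indexValue`, `searchPayoff_indexPolicy`). For `c > 0`, a visit is
optimal only at a firm with maximal `U j`, and stopping only if no remaining `U j` exceeds the best
reward (`le_of_visit_pos`, `le_stopPayoff_of_stop`).

Existence: if all conjectures equal one useless law, the reservation values are `μ - c - p j`.
Against rivals with price `0` and rewards of at least `μ - c`, a positive price never sells, so
every deviation earns zero.

Zero profit (`eqProfit_eq_zero`): suppose some firm earns a profit, so that prices are positive. Let
`r = U + p` be the threshold of a conjectured signal. A posterior above `r` sells as soon as the
firm is visited, and the decision to visit does not depend on it; hence demand is maximal above `r`.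
If the posteriors of the signal did not all have maximal demand, the firm could pull the posteriors
above `r` towards `r` and spend the freed mean on mass at `1`. So all posteriors at a given price
sell equally often (`ae_demand_eq`). A sale then carries no news about the match, and the consumer
gets on average at most the value of one visit to a cheapest firm. She can secure that much, so only
cheapest firms sell (`sales_efficient`). Positive profit at almost every price now forces an atom at
the highest price `t`. At `t` search is worth one visit only, so signals are useless there. A firm
at `t` sells only if all charge `t`, in which case the firms share one sale, while an undercutting
firm would win that sale outright: a contradiction.

Uniqueness (`ae_law_eq_zero`): with zero profit, even posterior `1` does not sell at a small price
`q > 0`. Hence almost surely some rival offers a reward, and some rival a reservation value, of at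
least `μ - c - q`. Letting `q` tend to `0`, independence and the common law give `x - p ≥ μ - c`
almost surely, so that `x ≥ μ - c` and the thresholds equal `μ - c`. The bound on reservation values
then reads `μ - c - p ≥ μ - c`, that is `p = 0`. -/

noncomputable section

namespace HiddenInfo

open ProbabilityTheory Set

/-! ### Product measures with one coordinate redrawn. -/

section PiMeasure

theorem measurable_update_prod {ι : Type*} [DecidableEq ι] {α : ι → Type*}
    [∀ i, MeasurableSpace (α i)] (i : ι) :
    Measurable fun a : α i × (∀ j, α j) => Function.update a.2 i a.1 := by
  refine measurable_pi_lambda _ fun j => ?_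
  by_cases h : j = i
  · subst h; simpa using measurable_fst
  · simpa [Function.update_of_ne h] using! (measurable_pi_apply j).comp measurable_snd

variable {ι : Type*} [Fintype ι] {α : ι → Type*} [∀ i, MeasurableSpace (α i)]

theorem ae_pi_of_ae (L : ∀ j, Measure (α j)) [∀ j, IsProbabilityMeasure (L j)]
    {P : ∀ j, α j → Prop} (h : ∀ j, ∀ᵐ a ∂L j, P j a) : ∀ᵐ ω ∂Measure.pi L, ∀ j, P j (ω j) := by
  rw [ae_all_iff]
  exact fun j => (measurePreserving_eval L j).quasiMeasurePreserving.ae (h j)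

theorem ae_of_ae_pi (L : ∀ j, Measure (α j)) [∀ j, IsProbabilityMeasure (L j)] (k : ι)
    {P : α k → Prop} (hP : MeasurableSet {a | P a}) (h : ∀ᵐ ω ∂Measure.pi L, P (ω k)) :
    ∀ᵐ a ∂L k, P a := by
  rw [← (measurePreserving_eval L k).map_eq]
  exact (ae_map_iff (measurePreserving_eval L k).measurable.aemeasurable hP).2 h

theorem lintegral_pi_prod (L : ∀ j, Measure (α j)) [∀ j, IsProbabilityMeasure (L j)]
    {f : ∀ j, α j → ℝ≥0∞} (hf : ∀ j, Measurable (f j)) :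
    ∫⁻ ω, ∏ j, f j (ω j) ∂Measure.pi L = ∏ j, ∫⁻ a, f j a ∂L j := by
  have hind : iIndepFun (fun j (ω : ∀ j, α j) => f j (ω j)) (Measure.pi L) :=
    iIndepFun_pi (X := f) fun j => (hf j).aemeasurable
  have h := lintegral_prod_eq_prod_lintegral_of_indepFun (μ := Measure.pi L) Finset.univ
    (fun j (ω : ∀ j, α j) => f j (ω j)) hind fun j => (hf j).comp (measurable_pi_apply j)
  rw [h]
  refine Finset.prod_congr rfl fun j _ => ?_
  rw [← (measurePreserving_eval L j).map_eq, lintegral_map (hf j) (measurable_pi_apply j)]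

variable [DecidableEq ι]

/-- Redrawing one coordinate independently and overwriting the old one separates a firm's own draw
from those of its rivals, without splitting the index type. Deviations of one firm and visits to one
firm are both handled in this way. -/
theorem pi_update_eq_map (L : ∀ j, Measure (α j)) [∀ j, IsProbabilityMeasure (L j)] (i : ι)
    (L' : Measure (α i)) [IsProbabilityMeasure L'] :
    Measure.pi (Function.update L i L') =
      (L'.prod (Measure.pi L)).map fun a => Function.update a.2 i a.1 := by
  have inst : ∀ j, IsProbabilityMeasure (Function.update L i L' j) := by
    intro j
    by_cases h : j = i
    · subst h; simpa
    · simpa [Function.update_of_ne h] using inferInstanceAs (IsProbabilityMeasure (L j))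
  refine Measure.pi_eq fun s hs => ?_
  rw [Measure.map_apply (measurable_update_prod i) (MeasurableSet.univ_pi hs)]
  have : (fun a : α i × (∀ j, α j) => Function.update a.2 i a.1) ⁻¹' (univ.pi s) =
      s i ×ˢ univ.pi (Function.update s i univ) := by
    ext a
    simp only [mem_preimage, mem_univ_pi, mem_prod]
    constructor
    · intro h
      refine ⟨by simpa using h i, fun j => ?_⟩
      by_cases hj : j = i
      · subst hj; simp
      · simpa [Function.update_of_ne hj] using h j
    · rintro ⟨h1, h2⟩ j
      by_cases hj : j = i
      · subst hj; simpa
      · simpa [Function.update_of_ne hj] using h2 j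
  rw [this, Measure.prod_prod, Measure.pi_pi, ← Finset.mul_prod_erase _ _ (Finset.mem_univ i),
    ← Finset.mul_prod_erase _ _ (Finset.mem_univ i)]
  simp only [Function.update_self, measure_univ, one_mul]
  congr 1
  refine Finset.prod_congr rfl fun j hj => ?_
  simp [Function.update_of_ne (Finset.ne_of_mem_erase hj)]

theorem pi_eq_map_update (L : ∀ j, Measure (α j)) [∀ j, IsProbabilityMeasure (L j)] (i : ι) :
    ((L i).prod (Measure.pi L)).map (fun a => Function.update a.2 i a.1) = Measure.pi L := by
  rw [← pi_update_eq_map, Function.update_eq_self]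

theorem ae_update_of_ae (L : ∀ j, Measure (α j)) [∀ j, IsProbabilityMeasure (L j)] (i : ι)
    {P : (∀ j, α j) → Prop} (h : ∀ᵐ ω ∂Measure.pi L, P ω) :
    ∀ᵐ a ∂L i, ∀ᵐ ω ∂Measure.pi L, P (Function.update ω i a) := by
  rw [← pi_eq_map_update L i] at h
  exact Measure.ae_ae_of_ae_prod (ae_of_ae_map (measurable_update_prod i).aemeasurable h)

theorem lintegral_pi_update (L : ∀ j, Measure (α j)) [∀ j, IsProbabilityMeasure (L j)] (i : ι)
    (L' : Measure (α i)) [IsProbabilityMeasure L'] {f : (∀ j, α j) → ℝ≥0∞} (hf : Measurable f) :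
    ∫⁻ ω, f ω ∂Measure.pi (Function.update L i L') =
      ∫⁻ a, ∫⁻ ω, f (Function.update ω i a) ∂Measure.pi L ∂L' := by
  rw [pi_update_eq_map, lintegral_map hf (measurable_update_prod i),
    lintegral_prod (fun a => f (Function.update a.2 i a.1))
      (hf.comp (measurable_update_prod i)).aemeasurable]

theorem integral_pi_eq_update (L : ∀ j, Measure (α j)) [∀ j, IsProbabilityMeasure (L j)] (i : ι)
    {f : (∀ j, α j) → ℝ} (hf : Measurable f) :
    ∫ ω, f ω ∂Measure.pi L =
      ∫ a, f (Function.update a.2 i a.1) ∂((L i).prod (Measure.pi L)) := by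
  conv_lhs => rw [← pi_eq_map_update L i]
  rw [integral_map (measurable_update_prod i).aemeasurable hf.aestronglyMeasurable]

end PiMeasure

/-! ### Disintegration of independent pairs into first and second components. -/

section PiKernel

variable {n : ℕ} {α β : Type*} [MeasurableSpace α] [MeasurableSpace β]

theorem measurable_pi_kernel {κ : Fin n → α → Measure β} (hκ : ∀ i, Measurable (κ i))
    [∀ i a, IsProbabilityMeasure (κ i a)] :
    Measurable fun p : Fin n → α => Measure.pi fun i => κ i (p i) := by
  refine Measurable.measure_of_isPiSystem_of_isProbabilityMeasure generateFrom_pi.symm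
    isPiSystem_pi ?_
  rintro _ ⟨s, hs, rfl⟩
  simp only [Measure.pi_pi]
  refine Finset.measurable_prod _ fun i _ => ?_
  exact (Measure.measurable_coe (hs i (mem_univ i))).comp ((hκ i).comp (measurable_pi_apply i))

theorem measurable_zip : Measurable fun a : (Fin n → α) × (Fin n → β) => fun i => (a.1 i, a.2 i) :=
  measurable_pi_lambda _ fun i =>
    ((measurable_pi_apply i).comp measurable_fst).prodMk
      ((measurable_pi_apply i).comp measurable_snd)

/-- The independent draws of second components given the first ones, as a kernel. -/
def piKernel {κ : Fin n → α → Measure β} (hκ : ∀ i, Measurable (κ i))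
    [∀ i a, IsProbabilityMeasure (κ i a)] : Kernel (Fin n → α) (Fin n → β) :=
  ⟨_, measurable_pi_kernel hκ⟩

instance isMarkovKernel_piKernel {κ : Fin n → α → Measure β} (hκ : ∀ i, Measurable (κ i))
    [∀ i a, IsProbabilityMeasure (κ i a)] : IsMarkovKernel (piKernel hκ) :=
  ⟨fun p => inferInstanceAs (IsProbabilityMeasure (Measure.pi fun i => κ i (p i)))⟩

/-- Drawing pairs independently amounts to drawing the first components, and then the second ones
conditionally on them. -/
theorem pi_eq_map_compProd (G : Measure α) [IsProbabilityMeasure G]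
    {κ : Fin n → α → Measure β} (hκ : ∀ i, Measurable (κ i)) [∀ i a, IsProbabilityMeasure (κ i a)]
    (L : Fin n → Measure (α × β)) [∀ i, IsProbabilityMeasure (L i)]
    (hL : ∀ i, ∀ f : α × β → ℝ≥0∞, Measurable f →
      ∫⁻ a, f a ∂L i = ∫⁻ q, ∫⁻ x, f (q, x) ∂κ i q ∂G) :
    Measure.pi L = ((Measure.pi fun _ : Fin n => G) ⊗ₘ piKernel hκ).map
      fun a => fun i => (a.1 i, a.2 i) := by
  refine Measure.pi_eq fun s hs => ?_
  rw [Measure.map_apply measurable_zip (MeasurableSet.univ_pi hs),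
    Measure.compProd_apply (measurable_zip (MeasurableSet.univ_pi hs))]
  have : ∀ p, piKernel hκ p (Prod.mk p ⁻¹' ((fun a : (Fin n → α) × (Fin n → β) => fun i => (a.1 i, a.2 i))
      ⁻¹' univ.pi s)) = ∏ i, κ i (p i) (Prod.mk (p i) ⁻¹' s i) := by
    intro p
    have e : Prod.mk p ⁻¹' ((fun a : (Fin n → α) × (Fin n → β) => fun i => (a.1 i, a.2 i))
      ⁻¹' univ.pi s) = univ.pi fun i => Prod.mk (p i) ⁻¹' s i := by
      ext y; simp
    rw [e]
    exact Measure.pi_pi _ _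
  simp only [this]
  have hm : ∀ i, Measurable fun q => κ i q (Prod.mk q ⁻¹' s i) := by
    intro i
    let k : Kernel α β := ⟨κ i, hκ i⟩
    have : IsMarkovKernel k := ⟨fun a => inferInstanceAs (IsProbabilityMeasure (κ i a))⟩
    exact Kernel.measurable_kernel_prodMk_left (κ := k) (hs i)
  rw [lintegral_pi_prod (fun _ : Fin n => G) hm]
  refine Finset.prod_congr rfl fun i _ => ?_
  have h1 := hL i ((s i).indicator 1) (measurable_one.indicator (hs i))
  rw [lintegral_indicator_one (hs i)] at h1
  rw [h1]
  refine lintegral_congr fun q => ?_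
  have : (fun x => (s i).indicator (1 : α × β → ℝ≥0∞) (q, x)) =
      (Prod.mk q ⁻¹' s i).indicator 1 := by
    ext x; rfl
  rw [this, lintegral_indicator_one (measurable_prodMk_left (hs i))]

end PiKernel

/-! ### Expected excess of a signal and its threshold. -/

section Signals

instance Signal.isProbabilityMeasure {μ : ℝ} (F : Signal μ) : IsProbabilityMeasure F.1 := F.2.1

theorem Signal.ae_mem {μ : ℝ} (F : Signal μ) : ∀ᵐ x ∂F.1, x ∈ Icc (0 : ℝ) 1 := by
  filter_upwards [Measure.support_mem_ae (μ := F.1)] with x hx using F.2.2.1 hx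

/-- The signal given by a law that is concentrated on `[0, 1]` and has mean `μ`. -/
def Signal.mk' {μ : ℝ} (F : Measure ℝ) [hF : IsProbabilityMeasure F]
    (h : ∀ᵐ x ∂F, x ∈ Icc (0 : ℝ) 1) (hm : ∫ x, x ∂F = μ) : Signal μ :=
  ⟨F, hF, Measure.support_subset_of_isClosed isClosed_Icc h, hm⟩

theorem useless_iff {μ c : ℝ} (F : Signal μ) : Useless μ c F.1 ↔ ∀ᵐ x ∂F.1, μ - c ≤ x := by
  constructor
  · intro h
    filter_upwards [Measure.support_mem_ae (μ := F.1)] with x hx using (h hx).1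
  · intro h
    refine Measure.support_subset_of_isClosed isClosed_Icc ?_
    filter_upwards [h, F.ae_mem] with x hx hx' using ⟨hx, hx'.2⟩

theorem integrable_of_bound_unit {F : Measure ℝ} [IsProbabilityMeasure F]
    (hF : ∀ᵐ x ∂F, x ∈ Icc (0 : ℝ) 1) {f : ℝ → ℝ} (hf : Measurable f) {C : ℝ}
    (hC : ∀ x ∈ Icc (0 : ℝ) 1, |f x| ≤ C) : Integrable f F :=
  Integrable.of_bound hf.aestronglyMeasurable C (by filter_upwards [hF] with x hx using hC x hx)

theorem integrable_id_unit {F : Measure ℝ} [IsProbabilityMeasure F]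
    (hF : ∀ᵐ x ∂F, x ∈ Icc (0 : ℝ) 1) : Integrable (fun x => x) F :=
  integrable_of_bound_unit hF measurable_id (C := 1) fun x hx => by
    rw [abs_of_nonneg hx.1]; exact hx.2

theorem Signal.lintegral_ofReal {μ : ℝ} (F : Signal μ) :
    ∫⁻ x, ENNReal.ofReal x ∂F.1 = ENNReal.ofReal μ := by
  rw [← ofReal_integral_eq_lintegral_ofReal (integrable_id_unit F.ae_mem)
    (by filter_upwards [F.ae_mem] with x hx using hx.1), F.2.2.2]

/-- The expected excess of the posterior over the threshold `t`. -/
def excess (F : Measure ℝ) (t : ℝ) : ℝ := ∫ x, max (x - t) 0 ∂F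

variable {F : Measure ℝ} [IsProbabilityMeasure F] {c t r : ℝ}

theorem integrable_excess (hF : ∀ᵐ x ∂F, x ∈ Icc (0 : ℝ) 1) (t : ℝ) :
    Integrable (fun x => max (x - t) 0) F := by
  have := ((integrable_id_unit hF).sub (integrable_const t)).pos_part
  exact this

theorem mean_sub_le_excess (hF : ∀ᵐ x ∂F, x ∈ Icc (0 : ℝ) 1) (t : ℝ) :
    ∫ x, x ∂F - t ≤ excess F t := by
  have : ∫ x, x ∂F - t = ∫ x, (x - t) ∂F := by
    rw [integral_sub (integrable_id_unit hF) (integrable_const t)]; simp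
  rw [this]
  exact integral_mono ((integrable_id_unit hF).sub (integrable_const t)) (integrable_excess hF t)
    fun x => le_max_left _ _

theorem excess_of_ae_le (hF : ∀ᵐ x ∂F, x ∈ Icc (0 : ℝ) 1) (h : ∀ᵐ x ∂F, t ≤ x) :
    excess F t = ∫ x, x ∂F - t := by
  have : ∫ x, x ∂F - t = ∫ x, (x - t) ∂F := by
    rw [integral_sub (integrable_id_unit hF) (integrable_const t)]; simp
  rw [this]
  refine integral_congr_ae ?_
  filter_upwards [h] with x hx
  exact max_eq_left (by linarith)

theorem continuous_excess (hF : ∀ᵐ x ∂F, x ∈ Icc (0 : ℝ) 1) : Continuous (excess F) := by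
  have : LipschitzWith 1 (excess F) := by
    refine LipschitzWith.of_dist_le_mul fun s t => ?_
    simp only [NNReal.coe_one, one_mul, Real.dist_eq, excess]
    rw [← integral_sub (integrable_excess hF s) (integrable_excess hF t)]
    refine (abs_integral_le_integral_abs).trans ?_
    calc ∫ x, |max (x - s) 0 - max (x - t) 0| ∂F ≤ ∫ _, |s - t| ∂F := by
          refine integral_mono ((integrable_excess hF s).sub (integrable_excess hF t)).abs
            (integrable_const _) fun x => ?_
          refine (abs_max_sub_max_le_abs _ _ _).trans (le_of_eq ?_)
          rw [abs_sub_comm]; congr 1; ring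
      _ = |s - t| := by simp
  exact this.continuous

theorem excess_one {G : Measure ℝ} (hG : ∀ᵐ x ∂G, x ∈ Icc (0 : ℝ) 1) : excess G 1 = 0 := by
  refine integral_eq_zero_of_ae ?_
  filter_upwards [hG] with x hx
  exact max_eq_right (by linarith [hx.2])

/-- The excess is continuous, at least `c` at the mean minus `c`, and `0` at `1`; the intermediate
value theorem applies in between. -/
theorem exists_excess_eq (hF : ∀ᵐ x ∂F, x ∈ Icc (0 : ℝ) 1) (hc : 0 ≤ c) :
    ∃ r, excess F r = c ∧ ∫ x, x ∂F - c ≤ r := by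
  have h1 : ∫ x, x ∂F ≤ 1 := by
    calc ∫ x, x ∂F ≤ ∫ _, (1 : ℝ) ∂F := integral_mono_ae (integrable_id_unit hF)
          (integrable_const _) (by filter_upwards [hF] with x hx using hx.2)
      _ = 1 := by simp
  have := intermediate_value_Icc' (a := ∫ x, x ∂F - c) (b := 1) (by linarith)
    (continuous_excess hF).continuousOn
  obtain ⟨r, hr, hr'⟩ := this (show c ∈ Icc _ _ from ⟨by rw [excess_one hF]; exact hc, by
    have := mean_sub_le_excess hF (∫ x, x ∂F - c); linarith⟩)
  exact ⟨r, hr', hr.1⟩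

theorem not_ae_le_of_excess {G : Measure ℝ} (hc : 0 < c) (hr : excess G r = c) :
    ¬ ∀ᵐ x ∂G, x ≤ r := by
  intro h
  have : excess G r = 0 := by
    refine integral_eq_zero_of_ae ?_
    filter_upwards [h] with x hx
    exact max_eq_right (by linarith)
  linarith

/-- Equality would mean that lowering the threshold adds nothing, so no mass would lie above `r`,
against a positive excess at `r`. This strictness makes reservation values unique for `c > 0`. -/
theorem excess_lt_of_lt (hF : ∀ᵐ x ∂F, x ∈ Icc (0 : ℝ) 1) (hc : 0 < c) (hr : excess F r = c)
    (ht : t < r) : c < excess F t := by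
  have hle : ∀ x, max (x - r) 0 ≤ max (x - t) 0 := fun x => max_le_max (by linarith) le_rfl
  have h1 : c ≤ excess F t := by
    rw [← hr]; exact integral_mono (integrable_excess hF r) (integrable_excess hF t) hle
  refine lt_of_le_of_ne h1 fun h => not_ae_le_of_excess hc hr ?_
  have h0 : ∫ x, (max (x - t) 0 - max (x - r) 0) ∂F = 0 := by
    rw [integral_sub (integrable_excess hF t) (integrable_excess hF r)]
    unfold excess at h hr
    linarith
  replace h0 := (integral_eq_zero_iff_of_nonneg
    (f := fun x => max (x - t) 0 - max (x - r) 0) (fun x => sub_nonneg.2 (hle x))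
    ((integrable_excess hF t).sub (integrable_excess hF r))).1 h0
  filter_upwards [h0] with x hx
  by_contra hxr
  push Not at hxr
  have : max (x - t) 0 - max (x - r) 0 = 0 := hx
  rw [max_eq_left (by linarith), max_eq_left (by linarith)] at this
  linarith

theorem excess_inj (hF : ∀ᵐ x ∂F, x ∈ Icc (0 : ℝ) 1) (hc : 0 < c) (hr : excess F r = c)
    (ht : excess F t = c) : t = r := by
  rcases lt_trichotomy t r with h | h | h
  · exact absurd ht (excess_lt_of_lt hF hc hr h).ne'
  · exact h
  · exact absurd hr (excess_lt_of_lt hF hc ht h).ne'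

theorem mean_sub_le_of_excess (hF : ∀ᵐ x ∂F, x ∈ Icc (0 : ℝ) 1) (hr : excess F r = c) :
    ∫ x, x ∂F - c ≤ r := by
  have := mean_sub_le_excess hF r
  linarith

theorem lt_one_of_excess {G : Measure ℝ} (hG : ∀ᵐ x ∂G, x ∈ Icc (0 : ℝ) 1)
    (hc : 0 < c) (hr : excess G r = c) :
    r < 1 := by
  by_contra h
  push Not at h
  exact not_ae_le_of_excess hc hr (by filter_upwards [hG] with x hx using hx.2.trans h)

theorem isReservationValue_iff {G : Measure ℝ} (hG : ∀ᵐ x ∂G, x ∈ Icc (0 : ℝ) 1) (q U : ℝ) :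
    IsReservationValue c G q U ↔ excess G (U + q) = c := by
  have : ∫ x in Icc (U + q) 1, (x - q - U) ∂G = excess G (U + q) := by
    rw [← integral_indicator measurableSet_Icc]
    refine integral_congr_ae ?_
    filter_upwards [hG] with x hx
    by_cases h : U + q ≤ x
    · rw [indicator_of_mem (show x ∈ Icc (U + q) 1 from ⟨h, hx.2⟩), max_eq_left (by linarith)]
      ring
    · rw [indicator_of_notMem (fun h' => h h'.1), max_eq_right (by linarith)]
  rw [IsReservationValue, this, eq_comm]

end Signals

/-! ### Signals used as deviations. -/

section PointSignals

variable {μ : ℝ}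

/-- The uninformative signal. -/
def Signal.point (hμ : μ ∈ Icc (0 : ℝ) 1) : Signal μ :=
  Signal.mk' (Measure.dirac μ) (by rw [ae_dirac_eq]; exact hμ) (by simp)

/-- The law with mass `1 - w` transported by `T` from `F`, and an atom of mass `w` at `y`. -/
theorem Signal.exists_mix (F : Measure ℝ) [IsProbabilityMeasure F] {T : ℝ → ℝ} (hT : Measurable T)
    (hTF : ∀ᵐ x ∂F, T x ∈ Icc (0 : ℝ) 1) {w y : ℝ} (hw : w ∈ Icc (0 : ℝ) 1)
    (hy : y ∈ Icc (0 : ℝ) 1) (hm : (1 - w) * ∫ x, T x ∂F + w * y = μ) :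
    ∃ H : Signal μ, ∀ f : ℝ → ℝ≥0∞, Measurable f → ∫⁻ x, f x ∂H.1 =
      ENNReal.ofReal (1 - w) * ∫⁻ x, f (T x) ∂F + ENNReal.ofReal w * f y := by
  have hw1 : 0 ≤ 1 - w := by linarith [hw.2]
  let M : Measure ℝ := ENNReal.ofReal (1 - w) • F.map T + ENNReal.ofReal w • Measure.dirac y
  have hpm : IsProbabilityMeasure (F.map T) := Measure.isProbabilityMeasure_map hT.aemeasurable
  have : IsProbabilityMeasure M := ⟨by
    simp only [M, Measure.add_apply, Measure.smul_apply, measure_univ, smul_eq_mul, mul_one]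
    rw [← ENNReal.ofReal_add hw1 hw.1]; simp⟩
  have hmap : ∀ᵐ x ∂(F.map T), x ∈ Icc (0 : ℝ) 1 :=
    (ae_map_iff hT.aemeasurable measurableSet_Icc).2 hTF
  have hM : ∀ᵐ x ∂M, x ∈ Icc (0 : ℝ) 1 := by
    refine ae_add_measure_iff.2 ⟨Measure.ae_smul_measure hmap _, Measure.ae_smul_measure ?_ _⟩
    rw [ae_dirac_eq]; exact hy
  refine ⟨Signal.mk' M hM ?_, fun f hf => ?_⟩
  · have i1 : Integrable (fun x => x) (F.map T) := integrable_id_unit hmap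
    have i2 : Integrable (fun x => x) (Measure.dirac y) :=
      integrable_dirac (by simp)
    rw [integral_add_measure (i1.smul_measure ENNReal.ofReal_ne_top)
      (i2.smul_measure ENNReal.ofReal_ne_top), integral_smul_measure, integral_smul_measure,
      ENNReal.toReal_ofReal hw1, ENNReal.toReal_ofReal hw.1, integral_dirac,
      integral_map hT.aemeasurable (by fun_prop)]
    simpa using hm
  · change ∫⁻ x, f x ∂M = _
    rw [lintegral_add_measure, lintegral_smul_measure, lintegral_smul_measure, lintegral_map hf hT,
      lintegral_dirac' _ hf]
    rfl

end PointSignals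

/-! ### The law of price and posterior induced by a mixed strategy. -/

section OutcomeLaw

variable {μ : ℝ}

theorem measurable_dirac_prod :
    Measurable fun a : ℝ≥0 × Signal μ => (Measure.dirac a.1).prod a.2.1 := by
  let k : Kernel (ℝ≥0 × Signal μ) ℝ := ⟨fun a => a.2.1, measurable_subtype_coe.comp measurable_snd⟩
  have : IsMarkovKernel k := ⟨fun a => inferInstanceAs (IsProbabilityMeasure a.2.1)⟩
  have h := (Kernel.deterministic (Prod.fst : ℝ≥0 × Signal μ → ℝ≥0) measurable_fst ×ₖ k).measurable
  convert h using 2 with a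
  rw [Kernel.prod_apply, Kernel.deterministic_apply]
  rfl

instance isProbabilityMeasure_outcomeLaw (σ : Measure (ℝ≥0 × Signal μ)) [IsProbabilityMeasure σ] :
    IsProbabilityMeasure (outcomeLaw σ) :=
  isProbabilityMeasure_bind measurable_dirac_prod.aemeasurable
    (Filter.Eventually.of_forall fun _ => inferInstance)

theorem lintegral_outcomeLaw (σ : Measure (ℝ≥0 × Signal μ)) {f : ℝ≥0 × ℝ → ℝ≥0∞}
    (hf : Measurable f) :
    ∫⁻ a, f a ∂outcomeLaw σ = ∫⁻ a, ∫⁻ x, f (a.1, x) ∂a.2.1 ∂σ := by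
  rw [outcomeLaw, Measure.lintegral_bind measurable_dirac_prod.aemeasurable hf.aemeasurable]
  refine lintegral_congr fun a => ?_
  rw [lintegral_prod _ hf.aemeasurable, lintegral_dirac']
  exact hf.lintegral_prod_right'

theorem measurable_lintegral_signal {f : ℝ≥0 × ℝ → ℝ≥0∞} (hf : Measurable f) :
    Measurable fun a : ℝ≥0 × Signal μ => ∫⁻ x, f (a.1, x) ∂a.2.1 := by
  have := (Measure.measurable_lintegral hf).comp (measurable_dirac_prod (μ := μ))
  convert this using 2 with a
  simp only [Function.comp_apply]
  rw [lintegral_prod _ hf.aemeasurable, lintegral_dirac']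
  exact hf.lintegral_prod_right'

theorem ae_outcomeLaw_iff (σ : Measure (ℝ≥0 × Signal μ)) {P : ℝ≥0 × ℝ → Prop}
    (hP : MeasurableSet {a | P a}) :
    (∀ᵐ a ∂outcomeLaw σ, P a) ↔ ∀ᵐ a ∂σ, ∀ᵐ x ∂a.2.1, P (a.1, x) := by
  have h := lintegral_outcomeLaw σ (f := {a | P a}ᶜ.indicator 1)
    (measurable_one.indicator hP.compl)
  rw [lintegral_indicator_one hP.compl] at h
  have hm := measurable_lintegral_signal (μ := μ) (measurable_one.indicator hP.compl)
  rw [ae_iff, show {a | ¬ P a} = {a | P a}ᶜ from rfl, h, lintegral_eq_zero_iff hm]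
  refine Filter.eventually_congr (Filter.Eventually.of_forall fun a => ?_)
  have e : ∀ x, {a | P a}ᶜ.indicator (1 : ℝ≥0 × ℝ → ℝ≥0∞) (a.1, x) =
      (Prod.mk a.1 ⁻¹' {a | P a}ᶜ).indicator 1 x := fun x => rfl
  simp only [e, Pi.zero_apply]
  rw [lintegral_indicator_one (measurable_prodMk_left hP.compl)]
  rfl

end OutcomeLaw

/-! ### The index value and the loss from a visit. -/

section IndexValue

variable {n : ℕ} {c : ℝ} {p : Fin n → ℝ≥0} {B : Fin n → Measure ℝ} {U : Fin n → ℝ}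

theorem fold_max_univ (f : Fin n → ℝ) (i : Fin n) :
    Finset.univ.fold max 0 f = max (f i) ((Finset.univ.erase i).fold max 0 f) := by
  conv_lhs => rw [← Finset.insert_erase (Finset.mem_univ i)]
  rw [Finset.fold_insert (Finset.notMem_erase i _)]

theorem measurable_fold_max {Ω : Type*} [MeasurableSpace Ω] (s : Finset (Fin n))
    {f : Ω → Fin n → ℝ} (hf : ∀ j, Measurable fun ω => f ω j) :
    Measurable fun ω => s.fold max 0 (f ω) := by
  induction s using Finset.induction_on with
  | empty => simp
  | insert a s ha ih =>
    simp only [Finset.fold_insert ha]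
    exact (hf a).max ih

/-- The reward of each firm once all visited firms are evaluated at the realized posteriors `x` and
all other firms at their effective values, with posteriors `y`. -/
def capped (p : Fin n → ℝ≥0) (U : Fin n → ℝ) (v : List (Fin n)) (x y : Fin n → ℝ) (j : Fin n) : ℝ :=
  if j ∈ v then x j - p j else min (y j - p j) (U j)

/-- The expected maximum of the outside option, of the sampled rewards and of the effective values
of the firms that have not been visited. -/
def indexValue (p : Fin n → ℝ≥0) (B : Fin n → Measure ℝ) (U : Fin n → ℝ) (v : List (Fin n))
    (x : Fin n → ℝ) : ℝ :=
  ∫ y, Finset.univ.fold max 0 (capped p U v x y) ∂Measure.pi B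

/-- The maximum of the outside option and of the capped rewards of the firms other than `i`. -/
def rivalMax (p : Fin n → ℝ≥0) (U : Fin n → ℝ) (v : List (Fin n)) (i : Fin n)
    (x y : Fin n → ℝ) : ℝ :=
  (Finset.univ.erase i).fold max 0 (capped p U v x y)

/-- `U` are reservation values of firms with prices `p` and signals `B`. -/
structure IsIndex (c : ℝ) (p : Fin n → ℝ≥0) (B : Fin n → Measure ℝ) (U : Fin n → ℝ) : Prop where
  isProb : ∀ j, IsProbabilityMeasure (B j)
  ae_mem : ∀ j, ∀ᵐ x ∂B j, x ∈ Icc (0 : ℝ) 1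
  excess_eq : ∀ j, excess (B j) (U j + p j) = c

theorem measurable_capped (v : List (Fin n)) (x : Fin n → ℝ) (j : Fin n) :
    Measurable fun y => capped p U v x y j := by
  unfold capped
  split_ifs
  · exact measurable_const
  · exact ((measurable_pi_apply j).sub_const _).min measurable_const

theorem rivalMax_update_right (v : List (Fin n)) (i : Fin n) (x y : Fin n → ℝ) (z : ℝ) :
    rivalMax p U v i x (Function.update y i z) = rivalMax p U v i x y := by
  refine Finset.fold_congr fun j hj => ?_
  simp [capped, Function.update_of_ne (Finset.ne_of_mem_erase hj)]

theorem rivalMax_cons (v : List (Fin n)) (i : Fin n) (x y : Fin n → ℝ) (z : ℝ) :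
    rivalMax p U (i :: v) i (Function.update x i z) y = rivalMax p U v i x y := by
  refine Finset.fold_congr fun j hj => ?_
  have := Finset.ne_of_mem_erase hj
  simp [capped, this]

theorem fold_capped_update {v : List (Fin n)} {i : Fin n} (hi : i ∉ v) (x y : Fin n → ℝ) (z : ℝ) :
    Finset.univ.fold max 0 (capped p U v x (Function.update y i z)) =
      max (min (z - p i) (U i)) (rivalMax p U v i x y) := by
  rw [fold_max_univ _ i, ← rivalMax_update_right v i x y z]
  simp [capped, hi, rivalMax]

theorem fold_capped_cons (v : List (Fin n)) (i : Fin n) (x y : Fin n → ℝ) (z : ℝ) :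
    Finset.univ.fold max 0 (capped p U (i :: v) (Function.update x i z) y) =
      max (z - p i) (rivalMax p U v i x y) := by
  rw [fold_max_univ _ i, ← rivalMax_cons v i x y z]
  simp [capped, rivalMax]

theorem fold_capped_nonneg (s : Finset (Fin n)) (v : List (Fin n)) (x y : Fin n → ℝ) :
    0 ≤ s.fold max 0 (capped p U v x y) :=
  (Finset.le_fold_max _).2 (Or.inl le_rfl)

theorem fold_capped_le (s : Finset (Fin n)) (v : List (Fin n)) (x y : Fin n → ℝ) :
    s.fold max 0 (capped p U v x y) ≤ ∑ j, (|x j| + p j + |U j|) := by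
  have h0 : ∀ j, 0 ≤ |x j| + p j + |U j| := fun j => by positivity
  refine (Finset.fold_max_le _).2 ⟨Finset.sum_nonneg fun j _ => h0 j, fun j _ => ?_⟩
  refine le_trans ?_ (Finset.single_le_sum (fun j _ => h0 j) (Finset.mem_univ j))
  have := (p j).coe_nonneg
  unfold capped
  split_ifs
  · linarith [le_abs_self (x j), abs_nonneg (U j)]
  · linarith [min_le_right (y j - p j) (U j), le_abs_self (U j), abs_nonneg (x j)]

theorem measurable_fold_capped (s : Finset (Fin n)) (v : List (Fin n)) (x : Fin n → ℝ) :
    Measurable fun y => s.fold max 0 (capped p U v x y) :=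
  measurable_fold_max s fun j => measurable_capped v x j

theorem integrable_fold_capped [∀ j, IsProbabilityMeasure (B j)] (s : Finset (Fin n))
    (v : List (Fin n)) (x : Fin n → ℝ) :
    Integrable (fun y => s.fold max 0 (capped p U v x y)) (Measure.pi B) :=
  Integrable.of_bound (measurable_fold_capped s v x).aestronglyMeasurable _
    (Filter.Eventually.of_forall fun y => by
      rw [Real.norm_of_nonneg (fold_capped_nonneg s v x y)]; exact fold_capped_le s v x y)

theorem stopPayoff_le_fold (v : List (Fin n)) (x y : Fin n → ℝ) :
    stopPayoff p v x ≤ Finset.univ.fold max 0 (capped p U v x y) := by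
  refine (Finset.fold_max_le _).2 ⟨fold_capped_nonneg _ v x y, fun j hj => ?_⟩
  refine (Finset.le_fold_max _).2 (Or.inr ⟨j, Finset.mem_univ j, ?_⟩)
  simp [capped, List.mem_toFinset.1 hj]

theorem stopPayoff_nonneg (v : List (Fin n)) (x : Fin n → ℝ) : 0 ≤ stopPayoff p v x :=
  (Finset.le_fold_max _).2 (Or.inl le_rfl)

theorem le_stopPayoff {v : List (Fin n)} {j : Fin n} (hj : j ∈ v) (x : Fin n → ℝ) :
    x j - p j ≤ stopPayoff p v x :=
  (Finset.le_fold_max _).2 (Or.inr ⟨j, List.mem_toFinset.2 hj, le_rfl⟩)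

theorem stopPayoff_le_indexValue (h : IsIndex c p B U) (v : List (Fin n)) (x : Fin n → ℝ) :
    stopPayoff p v x ≤ indexValue p B U v x := by
  have := h.isProb
  calc stopPayoff p v x = ∫ _, stopPayoff p v x ∂Measure.pi B := by simp
    _ ≤ _ := integral_mono (integrable_const _) (integrable_fold_capped _ v x) fun y =>
        stopPayoff_le_fold v x y

theorem indexValue_nonneg (v : List (Fin n)) (x : Fin n → ℝ) : 0 ≤ indexValue p B U v x :=
  integral_nonneg fun y => fold_capped_nonneg _ v x y

theorem indexValue_eq_stopPayoff (h : IsIndex c p B U) {v : List (Fin n)} {x : Fin n → ℝ}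
    (hU : ∀ k, k ∉ v → U k ≤ stopPayoff p v x) : indexValue p B U v x = stopPayoff p v x := by
  have := h.isProb
  have : ∀ y, Finset.univ.fold max 0 (capped p U v x y) = stopPayoff p v x := fun y => by
    refine le_antisymm ((Finset.fold_max_le _).2 ⟨stopPayoff_nonneg v x, fun j _ => ?_⟩)
      (stopPayoff_le_fold v x y)
    unfold capped
    split_ifs with hj
    · exact le_stopPayoff hj x
    · exact (min_le_right _ _).trans (hU j hj)
  simp [indexValue, this]

/-- Equality would bound every effective value by the stopping payoff almost surely. The hypothesis
`hB` takes the place of `0 < c`, so the result also serves the tie-breaking claim at `c = 0`. -/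
theorem stopPayoff_lt_indexValue (h : IsIndex c p B U) {v : List (Fin n)} {x : Fin n → ℝ}
    {k : Fin n} (hk : k ∉ v) (hB : ¬ ∀ᵐ z ∂B k, z ≤ stopPayoff p v x + p k)
    (hU : stopPayoff p v x < U k) : stopPayoff p v x < indexValue p B U v x := by
  have := h.isProb
  by_contra hlt
  push Not at hlt
  have hle := fun y => stopPayoff_le_fold (p := p) (U := U) v x y
  have hi := integrable_fold_capped (B := B) (p := p) (U := U) Finset.univ v x
  have h0 : ∫ y, (Finset.univ.fold max 0 (capped p U v x y) - stopPayoff p v x) ∂Measure.pi B = 0 := by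
    rw [integral_sub hi (integrable_const _)]
    have := stopPayoff_le_indexValue h v x
    simp only [integral_const, probReal_univ, smul_eq_mul, one_mul]
    unfold indexValue at this hlt
    linarith
  replace h0 := (integral_eq_zero_iff_of_nonneg
    (f := fun y => Finset.univ.fold max 0 (capped p U v x y) - stopPayoff p v x)
    (fun y => sub_nonneg.2 (hle y)) (hi.sub (integrable_const _))).1 h0
  refine hB ?_
  refine ae_of_ae_pi B k measurableSet_Iic ?_
  filter_upwards [h0] with y hy
  have hy' : Finset.univ.fold max 0 (capped p U v x y) = stopPayoff p v x := sub_eq_zero.1 hy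
  have : capped p U v x y k ≤ stopPayoff p v x := by
    rw [← hy']; exact (Finset.le_fold_max _).2 (Or.inr ⟨k, Finset.mem_univ k, le_rfl⟩)
  simp only [capped, hk, if_false] at this
  rcases min_le_iff.1 this with h' | h'
  · linarith
  · linarith

/-- The loss from visiting a firm with reward `a` and reservation value `u` when the other options
are worth `m`. -/
def indexGap (a u m : ℝ) : ℝ := max (min a u) m + max (a - u) 0 - max a m

theorem indexGap_nonneg (a u m : ℝ) : 0 ≤ indexGap a u m := by
  unfold indexGap
  rcases le_total a u with h | h
  · rw [min_eq_left h]; linarith [le_max_right (a - u) 0]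
  · rw [min_eq_right h, max_eq_left (by linarith : (0 : ℝ) ≤ a - u)]
    rcases le_total a m with h' | h'
    · rw [max_eq_right h']; linarith [le_max_right u m]
    · rw [max_eq_left h']; linarith [le_max_left u m]

theorem indexGap_eq_zero {a u m : ℝ} (h : m ≤ u) : indexGap a u m = 0 := by
  unfold indexGap
  rcases le_total a u with h' | h'
  · rw [min_eq_left h', max_eq_right (by linarith : a - u ≤ 0)]; ring
  · rw [min_eq_right h', max_eq_left (by linarith : (0 : ℝ) ≤ a - u), max_eq_left h,
      max_eq_left (h.trans h')]; ring

theorem le_of_indexGap_eq_zero {a u m : ℝ} (h : indexGap a u m = 0) (ha : u < a) : m ≤ u := by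
  by_contra hm
  push Not at hm
  unfold indexGap at h
  rw [min_eq_right ha.le, max_eq_left (by linarith : (0 : ℝ) ≤ a - u), max_eq_right hm.le] at h
  rcases le_total a m with h' | h'
  · rw [max_eq_right h'] at h; linarith
  · rw [max_eq_left h'] at h; linarith

theorem integrable_fold_cons (h : IsIndex c p B U) (v : List (Fin n)) (i : Fin n) (x : Fin n → ℝ) :
    Integrable (fun a : ℝ × (Fin n → ℝ) => max (a.1 - p i) (rivalMax p U v i x a.2))
      ((B i).prod (Measure.pi B)) := by
  have := h.isProb
  have hm : Measurable fun a : ℝ × (Fin n → ℝ) => rivalMax p U v i x a.2 :=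
    (measurable_fold_capped _ v x).comp measurable_snd
  refine Integrable.of_bound ((measurable_fst.sub_const _).max hm).aestronglyMeasurable
    (1 + ∑ j, (|x j| + p j + |U j|)) ?_
  have h1 : ∀ᵐ a ∂(B i).prod (Measure.pi B), a.1 ∈ Icc (0 : ℝ) 1 :=
    Measure.quasiMeasurePreserving_fst.ae (h.ae_mem i)
  filter_upwards [h1] with a ha
  have hN : 0 ≤ rivalMax p U v i x a.2 := fold_capped_nonneg _ v x a.2
  rw [Real.norm_of_nonneg (hN.trans (le_max_right _ _))]
  have hp := (p i).coe_nonneg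
  have hs : rivalMax p U v i x a.2 ≤ ∑ j, (|x j| + p j + |U j|) := fold_capped_le _ v x a.2
  refine max_le ?_ (by linarith)
  linarith [ha.2]

theorem integrable_indexValue_update (h : IsIndex c p B U) (v : List (Fin n)) (i : Fin n)
    (x : Fin n → ℝ) :
    Integrable (fun z => indexValue p B U (i :: v) (Function.update x i z)) (B i) := by
  have := h.isProb
  have := (integrable_fold_cons h v i x).integral_prod_left
  simpa only [indexValue, fold_capped_cons] using this

/-- By definition of the reservation value, `c` is the expectation of `max (a - u) 0`. The visiting
cost can therefore be moved under the integral, and the loss from a visit is compared pointwise. -/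
theorem integrable_indexGap (h : IsIndex c p B U) (v : List (Fin n)) (i : Fin n) (x : Fin n → ℝ) :
    Integrable (fun a : ℝ × (Fin n → ℝ) => indexGap (a.1 - p i) (U i) (rivalMax p U v i x a.2))
      ((B i).prod (Measure.pi B)) ∧
    (i ∉ v → indexValue p B U v x -
      (∫ z, indexValue p B U (i :: v) (Function.update x i z) ∂B i - c) =
      ∫ a, indexGap (a.1 - p i) (U i) (rivalMax p U v i x a.2) ∂(B i).prod (Measure.pi B)) := by
  have := h.isProb
  have hm : Measurable fun a : ℝ × (Fin n → ℝ) => rivalMax p U v i x a.2 :=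
    (measurable_fold_capped _ v x).comp measurable_snd
  have i1 : Integrable (fun a : ℝ × (Fin n → ℝ) =>
      max (min (a.1 - p i) (U i)) (rivalMax p U v i x a.2)) ((B i).prod (Measure.pi B)) := by
    refine Integrable.of_bound ((((measurable_fst.sub_const _).min
      measurable_const).max hm).aestronglyMeasurable) (|U i| + ∑ j, (|x j| + p j + |U j|)) ?_
    refine Filter.Eventually.of_forall fun a => ?_
    have hN : 0 ≤ rivalMax p U v i x a.2 := fold_capped_nonneg _ v x a.2
    have hs : rivalMax p U v i x a.2 ≤ ∑ j, (|x j| + p j + |U j|) := fold_capped_le _ v x a.2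
    rw [Real.norm_of_nonneg (hN.trans (le_max_right _ _))]
    refine max_le ((min_le_right _ _).trans ?_) (by linarith [abs_nonneg (U i)])
    linarith [le_abs_self (U i)]
  have i2 : Integrable (fun a : ℝ × (Fin n → ℝ) => max (a.1 - p i - U i) 0)
      ((B i).prod (Measure.pi B)) := by
    have := (integrable_excess (h.ae_mem i) (U i + p i)).comp_fst (Measure.pi B)
    refine this.congr (Filter.Eventually.of_forall fun a => ?_)
    simp only
    congr 1; ring
  have i3 := integrable_fold_cons h v i x
  refine ⟨(i1.add i2).sub i3, fun hi => ?_⟩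
  have e1 : indexValue p B U v x = ∫ a, max (min (a.1 - p i) (U i)) (rivalMax p U v i x a.2)
      ∂(B i).prod (Measure.pi B) := by
    rw [indexValue, integral_pi_eq_update B i (measurable_fold_capped _ v x)]
    simp only [fold_capped_update hi]
  have e2 : ∫ a, max (a.1 - p i - U i) 0 ∂(B i).prod (Measure.pi B) = c := by
    rw [integral_prod _ i2, ← h.excess_eq i]
    simp only [integral_const, probReal_univ, smul_eq_mul, one_mul, excess]
    congr 1; ext z; congr 1; ring
  have e3 : ∫ z, indexValue p B U (i :: v) (Function.update x i z) ∂B i =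
      ∫ a, max (a.1 - p i) (rivalMax p U v i x a.2) ∂(B i).prod (Measure.pi B) := by
    rw [integral_prod _ i3]
    simp only [indexValue, fold_capped_cons]
  have e4 := integral_sub (i1.add i2) i3
  have e5 := integral_add i1 i2
  simp only [Pi.add_apply] at e4
  unfold indexGap
  rw [e4, e5, ← e1, e2, ← e3]
  ring

theorem visit_le_indexValue (h : IsIndex c p B U) {v : List (Fin n)} {i : Fin n} (hi : i ∉ v)
    (x : Fin n → ℝ) :
    ∫ z, indexValue p B U (i :: v) (Function.update x i z) ∂B i - c ≤ indexValue p B U v x := by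
  have h1 := (integrable_indexGap h v i x).2 hi
  have h2 : 0 ≤ ∫ a, indexGap (a.1 - p i) (U i) (rivalMax p U v i x a.2)
      ∂(B i).prod (Measure.pi B) := integral_nonneg fun a => indexGap_nonneg _ _ _
  linarith

theorem visit_eq_indexValue (h : IsIndex c p B U) {v : List (Fin n)} {i : Fin n} (hi : i ∉ v)
    {x : Fin n → ℝ} (hs : stopPayoff p v x ≤ U i) (hU : ∀ k, k ∉ v → U k ≤ U i) :
    ∫ z, indexValue p B U (i :: v) (Function.update x i z) ∂B i - c = indexValue p B U v x := by
  have h1 := (integrable_indexGap h v i x).2 hi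
  have h2 : ∀ y, rivalMax p U v i x y ≤ U i := fun y => by
    refine (Finset.fold_max_le _).2 ⟨(stopPayoff_nonneg v x).trans hs, fun j _ => ?_⟩
    unfold capped
    split_ifs with hj
    · exact (le_stopPayoff hj x).trans hs
    · exact (min_le_right _ _).trans (hU j hj)
  simp only [indexGap_eq_zero (h2 _), integral_zero] at h1
  linarith

/-- If visiting firm `i` is optimal, then no option has a larger reservation value. -/
theorem le_of_visit_eq (h : IsIndex c p B U) (hc : 0 < c) {v : List (Fin n)} {i : Fin n}
    (hi : i ∉ v) {x : Fin n → ℝ}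
    (hv : indexValue p B U v x ≤
      ∫ z, indexValue p B U (i :: v) (Function.update x i z) ∂B i - c) :
    stopPayoff p v x ≤ U i ∧ ∀ k, k ∉ v → U k ≤ U i := by
  have := h.isProb
  obtain ⟨hint, h1⟩ := integrable_indexGap h v i x
  have h0 : ∫ a, indexGap (a.1 - p i) (U i) (rivalMax p U v i x a.2)
      ∂(B i).prod (Measure.pi B) = 0 :=
    le_antisymm (by linarith [h1 hi]) (integral_nonneg fun a => indexGap_nonneg _ _ _)
  rw [integral_eq_zero_iff_of_nonneg (fun a => indexGap_nonneg _ _ _) hint] at h0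
  have h2 := Measure.ae_ae_of_ae_prod h0
  have hnot := not_ae_le_of_excess hc (h.excess_eq i)
  -- The gap detects a better alternative only at rewards above `U i`. Such posteriors have positive
  -- probability because `c > 0`.
  obtain ⟨z, hz, hzU⟩ : ∃ z, (∀ᵐ y ∂Measure.pi B,
      indexGap (z - p i) (U i) (rivalMax p U v i x y) = 0) ∧ U i + p i < z := by
    by_contra hcon
    push Not at hcon
    exact hnot (by filter_upwards [h2] with z hz using hcon z hz)
  have h3 : ∀ᵐ y ∂Measure.pi B, rivalMax p U v i x y ≤ U i := by
    filter_upwards [hz] with y hy using le_of_indexGap_eq_zero hy (by linarith)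
  constructor
  · obtain ⟨y, hy⟩ := h3.exists
    have := (Finset.fold_max_le _).1 hy
    refine (Finset.fold_max_le _).2 ⟨this.1, fun j hj => ?_⟩
    have hj' := List.mem_toFinset.1 hj
    have hji : j ≠ i := fun e => hi (e ▸ hj')
    simpa [capped, hj'] using this.2 j (Finset.mem_erase.2 ⟨hji, Finset.mem_univ j⟩)
  · intro k hk
    rcases eq_or_ne k i with rfl | hki
    · exact le_rfl
    by_contra hlt
    push Not at hlt
    -- If `U k > U i`, an effective value of `k` that never exceeds `U i` leaves no posterior above
    -- the threshold of `k`.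
    refine not_ae_le_of_excess hc (h.excess_eq k) ?_
    refine ae_of_ae_pi B k measurableSet_Iic ?_
    filter_upwards [h3] with y hy
    have := ((Finset.fold_max_le _).1 hy).2 k (Finset.mem_erase.2 ⟨hki, Finset.mem_univ k⟩)
    simp only [capped, hk, if_false] at this
    rcases min_le_iff.1 this with h' | h'
    · linarith
    · linarith

end IndexValue

/-! ### Backward induction: the index value bounds every policy. -/

section UpperBound

variable {n : ℕ} {c : ℝ} {p : Fin n → ℝ≥0} {B : Fin n → Measure ℝ} {U : Fin n → ℝ}

theorem length_lt_of_notMem {v : List (Fin n)} (hv : v.Nodup) {i : Fin n} (hi : i ∉ v) :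
    v.length < n := by
  have := (List.nodup_cons.2 ⟨hi, hv⟩).length_le_card
  simp at this
  omega

theorem mem_of_length_ge {v : List (Fin n)} (hv : v.Nodup) (hn : ¬ v.length < n) (i : Fin n) :
    i ∈ v := by
  by_contra hi
  exact hn (length_lt_of_notMem hv hi)

theorem SearchPolicy.visit_eq_zero (π : SearchPolicy n) {v : List (Fin n)} (hv : v.Nodup)
    (hn : ¬ v.length < n) (x : Fin n → ℝ) (j : Fin n) : π.visit v x j = 0 :=
  π.visit_unvisited v x j (mem_of_length_ge hv hn j)

/-- At information sets without repetitions the recursion for the payoff needs no case distinction. -/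
theorem searchPayoff_eq (π : SearchPolicy n) {v : List (Fin n)} (hv : v.Nodup) (x : Fin n → ℝ) :
    searchPayoff c p B π v x = ∑ i, π.buy v x i * (x i - p i) +
      ∑ j, π.visit v x j *
        (∫ z, searchPayoff c p B π (j :: v) (Function.update x j z) ∂(B j) - c) := by
  rw [searchPayoff]
  split_ifs with hn
  · rfl
  · simp [π.visit_eq_zero hv hn]

theorem buyProb_eq (π : SearchPolicy n) {v : List (Fin n)} (hv : v.Nodup) (x : Fin n → ℝ)
    (i : Fin n) : buyProb π x i v = π.buy v x i + ∑ j, π.visit v x j * buyProb π x i (j :: v) := by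
  rw [buyProb]
  split_ifs with hn
  · rfl
  · simp [π.visit_eq_zero hv hn]

/-- Induction over information sets, from the last one backwards. -/
theorem infoSet_induction {P : List (Fin n) → Prop}
    (step : ∀ v : List (Fin n), v.Nodup → (∀ j, j ∉ v → P (j :: v)) → P v) :
    ∀ v : List (Fin n), v.Nodup → P v := by
  have : ∀ m : ℕ, ∀ v : List (Fin n), v.Nodup → n - v.length = m → P v := by
    intro m
    induction m with
    | zero =>
      intro v hv hm
      exact step v hv fun j hj => absurd (length_lt_of_notMem hv hj) (by omega)
    | succ m ih =>
      intro v hv hm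
      exact step v hv fun j hj => ih (j :: v) (List.nodup_cons.2 ⟨hj, hv⟩) (by simp; omega)
  exact fun v hv => this _ v hv rfl

/-- No search policy is worth more than the index value. -/
theorem searchPayoff_le_indexValue (h : IsIndex c p B U) (hc : 0 ≤ c) (π : SearchPolicy n) :
    ∀ v : List (Fin n), v.Nodup → ∀ x, searchPayoff c p B π v x ≤ indexValue p B U v x := by
  refine infoSet_induction fun v hv ih x => ?_
  rw [searchPayoff_eq π hv]
  have h0 := indexValue_nonneg (p := p) (B := B) (U := U) v x
  have hb : ∑ i, π.buy v x i * (x i - p i) ≤ ∑ i, π.buy v x i * indexValue p B U v x := by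
    refine Finset.sum_le_sum fun i _ => ?_
    by_cases hi : i ∈ v
    · exact mul_le_mul_of_nonneg_left
        ((le_stopPayoff hi x).trans (stopPayoff_le_indexValue h v x)) (π.buy_nonneg v x i)
    · simp [π.buy_visited v x i hi]
  have hj : ∑ j, π.visit v x j *
      (∫ z, searchPayoff c p B π (j :: v) (Function.update x j z) ∂(B j) - c) ≤
      ∑ j, π.visit v x j * indexValue p B U v x := by
    refine Finset.sum_le_sum fun j _ => ?_
    by_cases hj : j ∈ v
    · simp [π.visit_unvisited v x j hj]
    refine mul_le_mul_of_nonneg_left ?_ (π.visit_nonneg v x j)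
    -- A non-integrable continuation payoff has Bochner integral `0` by convention. The visit then
    -- counts as `-c`, which is still below the nonnegative index value.
    by_cases hint : Integrable
        (fun z => searchPayoff c p B π (j :: v) (Function.update x j z)) (B j)
    · refine le_trans (sub_le_sub_right (integral_mono hint
        (integrable_indexValue_update h v j x) fun z => ih j hj _) c) (visit_le_indexValue h hj x)
    · rw [integral_undef hint]; linarith
  have ht := π.total v x
  have hq := mul_nonneg (π.quit_nonneg v x) h0
  rw [← Finset.sum_mul] at hb hj
  have : indexValue p B U v x = (∑ j, π.visit v x j) * indexValue p B U v x +
      (∑ j, π.buy v x j) * indexValue p B U v x + π.quit v x * indexValue p B U v x := by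
    rw [← add_mul, ← add_mul, ht, one_mul]
  linarith

end UpperBound

/-! ### The index rule as a measurable policy, and its optimality. -/

section IndexPolicy

variable {n : ℕ}

/-- `j` is the first maximizer of `f` on `s`. -/
def IsFirstMax (s : Finset (Fin n)) (f : Fin n → ℝ) (j : Fin n) : Prop :=
  j ∈ s ∧ ∀ k ∈ s, f k ≤ f j ∧ (f k = f j → j ≤ k)

theorem IsFirstMax.eq {s : Finset (Fin n)} {f : Fin n → ℝ} {j k : Fin n} (hj : IsFirstMax s f j)
    (hk : IsFirstMax s f k) : j = k := by
  have h1 := hj.2 k hk.1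
  have h2 := hk.2 j hj.1
  have e : f k = f j := le_antisymm h1.1 h2.1
  exact le_antisymm (h1.2 e) (h2.2 e.symm)

theorem exists_isFirstMax {s : Finset (Fin n)} (hs : s.Nonempty) (f : Fin n → ℝ) :
    ∃ j, IsFirstMax s f j := by
  obtain ⟨m, hm, hmax⟩ := s.exists_max_image f hs
  have hne : (s.filter fun k => f k = f m).Nonempty := ⟨m, by simp [hm]⟩
  have hmem := Finset.min'_mem _ hne
  rw [Finset.mem_filter] at hmem
  refine ⟨_, hmem.1, fun k hk => ⟨(hmax k hk).trans_eq hmem.2.symm, fun e => ?_⟩⟩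
  exact Finset.min'_le _ k (by simp [hk, e, hmem.2])

open Classical in
theorem sum_isFirstMax {s : Finset (Fin n)} (hs : s.Nonempty) (f : Fin n → ℝ) (g : Fin n → ℝ) :
    ∃ m, IsFirstMax s f m ∧ ∑ j, (if IsFirstMax s f j then (1 : ℝ) else 0) * g j = g m := by
  obtain ⟨m, hm⟩ := exists_isFirstMax hs f
  refine ⟨m, hm, ?_⟩
  rw [Finset.sum_eq_single m]
  · simp [hm]
  · intro j _ hj
    rw [if_neg fun h => hj (h.eq hm), zero_mul]
  · simp

/-- Some firm that has not been visited has a reservation value above the best reward so far. -/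
def Continues (v : List (Fin n)) (U d : Fin n → ℝ) : Prop :=
  ∃ k, k ∉ v ∧ v.toFinset.fold max 0 d < U k

open Classical in
/-- Probability of visiting firm `j` under the index rule, given reservation values `U` and
rewards `d`. -/
def indexVisit (v : List (Fin n)) (U d : Fin n → ℝ) (j : Fin n) : ℝ :=
  if Continues v U d ∧ IsFirstMax (Finset.univ.filter (· ∉ v)) U j then 1 else 0

open Classical in
/-- Probability of buying from firm `j` under the index rule. -/
def indexBuy (v : List (Fin n)) (U d : Fin n → ℝ) (j : Fin n) : ℝ :=
  if (¬ Continues v U d ∧ ∃ k, k ∈ v ∧ 0 ≤ d k) ∧ IsFirstMax v.toFinset d j then 1 else 0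

open Classical in
/-- Probability of taking the outside option under the index rule. -/
def indexQuit (v : List (Fin n)) (U d : Fin n → ℝ) : ℝ :=
  if ¬ Continues v U d ∧ ¬ ∃ k, k ∈ v ∧ 0 ≤ d k then 1 else 0

open Classical in
theorem sum_indexVisit (v : List (Fin n)) (U d g : Fin n → ℝ) :
    (¬ Continues v U d ∧ ∑ j, indexVisit v U d j * g j = 0) ∨
      (Continues v U d ∧ ∃ m, IsFirstMax (Finset.univ.filter (· ∉ v)) U m ∧
        ∑ j, indexVisit v U d j * g j = g m) := by
  by_cases hC : Continues v U d
  · refine Or.inr ⟨hC, ?_⟩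
    have hne : (Finset.univ.filter (· ∉ v)).Nonempty := by
      obtain ⟨k, hk, -⟩ := hC
      exact ⟨k, by simp [hk]⟩
    simpa [indexVisit, hC] using sum_isFirstMax hne U g
  · exact Or.inl ⟨hC, by simp [indexVisit, hC]⟩

open Classical in
theorem sum_indexBuy (v : List (Fin n)) (U d g : Fin n → ℝ) :
    (¬ (¬ Continues v U d ∧ ∃ k, k ∈ v ∧ 0 ≤ d k) ∧ ∑ j, indexBuy v U d j * g j = 0) ∨
      ((¬ Continues v U d ∧ ∃ k, k ∈ v ∧ 0 ≤ d k) ∧ ∃ m, IsFirstMax v.toFinset d m ∧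
        ∑ j, indexBuy v U d j * g j = g m) := by
  by_cases hC : ¬ Continues v U d ∧ ∃ k, k ∈ v ∧ 0 ≤ d k
  · refine Or.inr ⟨hC, ?_⟩
    have hne : v.toFinset.Nonempty := by
      obtain ⟨-, k, hk, -⟩ := hC
      exact ⟨k, by simp [hk]⟩
    obtain ⟨m, hm, e⟩ := sum_isFirstMax hne d g
    refine ⟨m, hm, ?_⟩
    rw [← e]
    exact Finset.sum_congr rfl fun j _ => by rw [indexBuy, if_congr (and_iff_right hC) rfl rfl]
  · exact Or.inl ⟨hC, by simp only [indexBuy, hC, false_and]; simp⟩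

theorem index_total (v : List (Fin n)) (U d : Fin n → ℝ) :
    ∑ j, indexVisit v U d j + ∑ j, indexBuy v U d j + indexQuit v U d = 1 := by
  have h1 := sum_indexVisit v U d 1
  have h2 := sum_indexBuy v U d 1
  simp only [Pi.one_apply, mul_one] at h1 h2
  unfold indexQuit
  by_cases hC : Continues v U d <;> by_cases hk : ∃ k, k ∈ v ∧ 0 ≤ d k <;>
    · simp only [hC, hk, not_true, not_false_eq_true, true_and, and_true, false_and, and_false,
        or_false, false_or, and_self] at h1 h2
      first
        | simp [h2, h1.choose_spec.2, hC, hk]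
        | simp [h1, h2.choose_spec.2, hC, hk]
        | simp [h1, h2, hC, hk]

section Measurability

variable {Ω : Type*} [MeasurableSpace Ω] {U d : Ω → Fin n → ℝ}

theorem measurableSet_isFirstMax (s : Finset (Fin n)) {f : Ω → Fin n → ℝ}
    (hf : ∀ j, Measurable fun ω => f ω j) (j : Fin n) :
    MeasurableSet {ω | IsFirstMax s (f ω) j} := by
  unfold IsFirstMax
  refine (MeasurableSet.const _).inter ?_
  change MeasurableSet {ω | ∀ k ∈ s, f ω k ≤ f ω j ∧ (f ω k = f ω j → j ≤ k)}
  simp only [ofPred_forall]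
  refine MeasurableSet.iInter fun k => MeasurableSet.iInter fun _ => ?_
  refine (measurableSet_le (hf k) (hf j)).inter ?_
  exact (measurableSet_eq_fun (hf k) (hf j)).imp (MeasurableSet.const _)

theorem measurableSet_continues (v : List (Fin n)) (hU : ∀ j, Measurable fun ω => U ω j)
    (hd : ∀ j, Measurable fun ω => d ω j) : MeasurableSet {ω | Continues v (U ω) (d ω)} := by
  unfold Continues
  simp only [ofPred_exists]
  refine MeasurableSet.iUnion fun k => ?_
  exact (MeasurableSet.const _).inter (measurableSet_lt (measurable_fold_max _ hd) (hU k))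

theorem measurableSet_affordable (v : List (Fin n)) (hd : ∀ j, Measurable fun ω => d ω j) :
    MeasurableSet {ω | ∃ k, k ∈ v ∧ 0 ≤ d ω k} := by
  simp only [ofPred_exists]
  refine MeasurableSet.iUnion fun k => ?_
  exact (MeasurableSet.const _).inter (measurableSet_le measurable_const (hd k))

theorem measurable_indexVisit (v : List (Fin n)) (hU : ∀ j, Measurable fun ω => U ω j)
    (hd : ∀ j, Measurable fun ω => d ω j) (j : Fin n) :
    Measurable fun ω => indexVisit v (U ω) (d ω) j :=
  Measurable.ite ((measurableSet_continues v hU hd).inter (measurableSet_isFirstMax _ hU j))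
    measurable_const measurable_const

theorem measurable_indexBuy (v : List (Fin n)) (hU : ∀ j, Measurable fun ω => U ω j)
    (hd : ∀ j, Measurable fun ω => d ω j) (j : Fin n) :
    Measurable fun ω => indexBuy v (U ω) (d ω) j :=
  Measurable.ite (((measurableSet_continues v hU hd).compl.inter
    (measurableSet_affordable v hd)).inter (measurableSet_isFirstMax _ hd j))
    measurable_const measurable_const

theorem measurable_indexQuit (v : List (Fin n)) (hU : ∀ j, Measurable fun ω => U ω j)
    (hd : ∀ j, Measurable fun ω => d ω j) : Measurable fun ω => indexQuit v (U ω) (d ω) :=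
  Measurable.ite ((measurableSet_continues v hU hd).compl.inter
    (measurableSet_affordable v hd).compl) measurable_const measurable_const

end Measurability

open Classical in
theorem index_congr {v : List (Fin n)} (U : Fin n → ℝ) {d d' : Fin n → ℝ}
    (h : ∀ j ∈ v, d j = d' j) :
    indexVisit v U d = indexVisit v U d' ∧ indexBuy v U d = indexBuy v U d' ∧
      indexQuit v U d = indexQuit v U d' := by
  have hf : v.toFinset.fold max 0 d = v.toFinset.fold max 0 d' :=
    Finset.fold_congr fun j hj => h j (List.mem_toFinset.1 hj)
  have hC : Continues v U d ↔ Continues v U d' := by unfold Continues; rw [hf]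
  have hk : (∃ k, k ∈ v ∧ 0 ≤ d k) ↔ ∃ k, k ∈ v ∧ 0 ≤ d' k :=
    exists_congr fun k => and_congr_right fun hk => by rw [h k hk]
  have hm : ∀ j, IsFirstMax v.toFinset d j ↔ IsFirstMax v.toFinset d' j := fun j => by
    refine and_congr_right fun hj => forall₂_congr fun k hk => ?_
    rw [h k (List.mem_toFinset.1 hk), h j (List.mem_toFinset.1 hj)]
  refine ⟨?_, ?_, ?_⟩
  · funext j; exact if_congr (and_congr hC Iff.rfl) rfl rfl
  · funext j; exact if_congr (and_congr (and_congr (not_congr hC) hk) (hm j)) rfl rfl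
  · exact if_congr (and_congr (not_congr hC) (not_congr hk)) rfl rfl

/-- The policy that visits a firm with the highest reservation value as long as this exceeds the best
reward so far, and then stops. -/
def indexPolicy (U : Fin n → ℝ) (p : Fin n → ℝ≥0) : SearchPolicy n where
  visit v x j := indexVisit v U (fun k => x k - p k) j
  buy v x j := indexBuy v U (fun k => x k - p k) j
  quit v x := indexQuit v U fun k => x k - p k
  visit_nonneg v x j := by unfold indexVisit; split_ifs <;> norm_num
  buy_nonneg v x j := by unfold indexBuy; split_ifs <;> norm_num
  quit_nonneg v x := by unfold indexQuit; split_ifs <;> norm_num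
  total v x := index_total v U _
  visit_unvisited v x j hj := if_neg fun h => by simpa [hj] using h.2.1
  buy_visited v x j hj := if_neg fun h => hj (List.mem_toFinset.1 h.2.1)
  adapted v x x' h := by
    have := index_congr (v := v) U (d := fun k => x k - p k) (d' := fun k => x' k - p k)
      fun j hj => by rw [h j hj]
    exact this
  measurable_visit v j := measurable_indexVisit (U := fun _ => U)
    (d := fun (x : Fin n → ℝ) k => x k - p k) v
    (fun _ => measurable_const)
    (fun k => (measurable_pi_apply k).sub_const _) j
  measurable_buy v j := measurable_indexBuy (U := fun _ => U)
    (d := fun (x : Fin n → ℝ) k => x k - p k) v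
    (fun _ => measurable_const)
    (fun k => (measurable_pi_apply k).sub_const _) j
  measurable_quit v := measurable_indexQuit (U := fun _ => U)
    (d := fun (x : Fin n → ℝ) k => x k - p k) v
    (fun _ => measurable_const)
    (fun k => (measurable_pi_apply k).sub_const _)

variable {c : ℝ} {p : Fin n → ℝ≥0} {B : Fin n → Measure ℝ} {U : Fin n → ℝ}

/-- The index policy attains the index value. -/
theorem searchPayoff_indexPolicy (h : IsIndex c p B U) :
    ∀ v : List (Fin n), v.Nodup →
      ∀ x, searchPayoff c p B (indexPolicy U p) v x = indexValue p B U v x := by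
  refine infoSet_induction fun v hv ih x => ?_
  rw [searchPayoff_eq _ hv]
  set d : Fin n → ℝ := fun k => x k - p k with hd
  change ∑ i, indexBuy v U d i * d i + ∑ j, indexVisit v U d j * (∫ z, searchPayoff c p B
    (indexPolicy U p) (j :: v) (Function.update x j z) ∂(B j) - c) = _
  have hs : stopPayoff p v x = v.toFinset.fold max 0 d := rfl
  rcases sum_indexVisit v U d (fun j => ∫ z, searchPayoff c p B (indexPolicy U p) (j :: v)
      (Function.update x j z) ∂(B j) - c) with ⟨hC, e1⟩ | ⟨hC, m, hm, e1⟩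
  · rw [e1, indexValue_eq_stopPayoff h fun k hk => by
      rw [hs]; by_contra hlt; exact hC ⟨k, hk, not_le.1 hlt⟩]
    rcases sum_indexBuy v U d d with ⟨hk, e2⟩ | ⟨⟨-, k, hk, hk'⟩, m, hm, e2⟩
    · rw [e2, hs, add_zero]
      refine (le_antisymm ((Finset.fold_max_le _).2 ⟨le_rfl, fun j hj => ?_⟩)
        ((Finset.le_fold_max _).2 (Or.inl le_rfl))).symm
      by_contra hlt
      exact hk ⟨hC, j, List.mem_toFinset.1 hj, (not_le.1 hlt).le⟩
    · rw [e2, hs, add_zero]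
      refine le_antisymm ((Finset.le_fold_max _).2 (Or.inr ⟨m, hm.1, le_rfl⟩))
        ((Finset.fold_max_le _).2 ⟨hk'.trans (hm.2 k (List.mem_toFinset.2 hk)).1,
          fun j hj => (hm.2 j hj).1⟩)
  · have hmv : m ∉ v := by simpa using hm.1
    have hU : ∀ k, k ∉ v → U k ≤ U m := fun k hk => (hm.2 k (by simp [hk])).1
    have hb : ∑ i, indexBuy v U d i * d i = 0 := by
      rcases sum_indexBuy v U d d with ⟨-, e2⟩ | ⟨⟨hC', -⟩, -⟩
      · exact e2
      · exact absurd hC hC'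
    rw [e1, hb, zero_add]
    simp only [ih m hmv]
    obtain ⟨k, hk, hlt⟩ := hC
    exact visit_eq_indexValue h hmv (hs ▸ hlt.le.trans (hU k hk)) hU

theorem sequentiallyRational_indexPolicy (h : IsIndex c p B U) (hc : 0 ≤ c) :
    SequentiallyRational c p B (indexPolicy U p) := fun v hv x _ τ => by
  rw [searchPayoff_indexPolicy h v hv]
  exact searchPayoff_le_indexValue h hc τ v hv x

end IndexPolicy

/-! ### Behaviour of an arbitrary optimal policy. -/

section Rational

variable {n : ℕ} {c : ℝ} {p : Fin n → ℝ≥0} {B : Fin n → Measure ℝ} {U : Fin n → ℝ}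
  {π : SearchPolicy n}

theorem searchPayoff_eq_indexValue (h : IsIndex c p B U) (hc : 0 ≤ c)
    (hπ : SequentiallyRational c p B π) {v : List (Fin n)} (hv : v.Nodup) {x : Fin n → ℝ}
    (hx : ∀ i, x i ∈ Icc (0 : ℝ) 1) : searchPayoff c p B π v x = indexValue p B U v x := by
  refine le_antisymm (searchPayoff_le_indexValue h hc π v hv x) ?_
  rw [← searchPayoff_indexPolicy h v hv x]
  exact hπ v hv x hx _

theorem update_mem_unit {x : Fin n → ℝ} (hx : ∀ i, x i ∈ Icc (0 : ℝ) 1) {z : ℝ}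
    (hz : z ∈ Icc (0 : ℝ) 1) (i j : Fin n) : Function.update x i z j ∈ Icc (0 : ℝ) 1 := by
  rcases eq_or_ne j i with rfl | hj
  · simpa using hz
  · simpa [Function.update_of_ne hj] using hx j

theorem integral_searchPayoff_eq (h : IsIndex c p B U) (hc : 0 ≤ c)
    (hπ : SequentiallyRational c p B π) {v : List (Fin n)} (hv : v.Nodup) {x : Fin n → ℝ}
    (hx : ∀ i, x i ∈ Icc (0 : ℝ) 1) {j : Fin n} (hj : j ∉ v) :
    ∫ z, searchPayoff c p B π (j :: v) (Function.update x j z) ∂B j =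
      ∫ z, indexValue p B U (j :: v) (Function.update x j z) ∂B j := by
  refine integral_congr_ae ?_
  filter_upwards [h.ae_mem j] with z hz
  exact searchPayoff_eq_indexValue h hc hπ (List.nodup_cons.2 ⟨hj, hv⟩) (update_mem_unit hx hz j)

/-- The index value solves the Bellman equation along a rational policy. -/
theorem indexValue_eq (h : IsIndex c p B U) (hc : 0 ≤ c)
    (hπ : SequentiallyRational c p B π) {v : List (Fin n)} (hv : v.Nodup) {x : Fin n → ℝ}
    (hx : ∀ i, x i ∈ Icc (0 : ℝ) 1) :
    indexValue p B U v x = ∑ i, π.buy v x i * (x i - p i) + ∑ j, π.visit v x j *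
      (∫ z, indexValue p B U (j :: v) (Function.update x j z) ∂(B j) - c) := by
  rw [← searchPayoff_eq_indexValue h hc hπ hv hx, searchPayoff_eq π hv]
  congr 1
  refine Finset.sum_congr rfl fun j _ => ?_
  by_cases hj : j ∈ v
  · simp [π.visit_unvisited v x j hj]
  · rw [integral_searchPayoff_eq h hc hπ hv hx hj]

/-- The Bellman equation writes the index value as an average of action payoffs, none of which
exceeds it. The weighted shortfalls are nonnegative with sum zero, so every action of positive
probability attains the index value. -/
theorem optimal_actions (h : IsIndex c p B U) (hc : 0 ≤ c)
    (hπ : SequentiallyRational c p B π) {v : List (Fin n)} (hv : v.Nodup) {x : Fin n → ℝ}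
    (hx : ∀ i, x i ∈ Icc (0 : ℝ) 1) :
    (∀ i, 0 < π.buy v x i → x i - p i = indexValue p B U v x) ∧
    (∀ j, 0 < π.visit v x j → ∫ z, indexValue p B U (j :: v) (Function.update x j z) ∂(B j) - c =
      indexValue p B U v x) ∧
    (0 < π.quit v x → indexValue p B U v x = 0) := by
  set Φ := indexValue p B U v x with hΦ
  have h0 : 0 ≤ Φ := indexValue_nonneg v x
  set g : Fin n → ℝ := fun j =>
    ∫ z, indexValue p B U (j :: v) (Function.update x j z) ∂(B j) - c with hg
  have hb : ∀ i ∈ Finset.univ, 0 ≤ π.buy v x i * (Φ - (x i - p i)) := fun i _ => by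
    by_cases hi : i ∈ v
    · exact mul_nonneg (π.buy_nonneg v x i)
        (sub_nonneg.2 ((le_stopPayoff hi x).trans (stopPayoff_le_indexValue h v x)))
    · simp [π.buy_visited v x i hi]
  have hj : ∀ j ∈ Finset.univ, 0 ≤ π.visit v x j * (Φ - g j) := fun j _ => by
    by_cases hj : j ∈ v
    · simp [π.visit_unvisited v x j hj]
    · exact mul_nonneg (π.visit_nonneg v x j) (sub_nonneg.2 (visit_le_indexValue h hj x))
  have hq : 0 ≤ π.quit v x * Φ := mul_nonneg (π.quit_nonneg v x) h0
  have hsum : ∑ i, π.buy v x i * (Φ - (x i - p i)) + ∑ j, π.visit v x j * (Φ - g j) +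
      π.quit v x * Φ = 0 := by
    have ht := π.total v x
    have hB := indexValue_eq h hc hπ hv hx
    simp only [mul_sub, Finset.sum_sub_distrib, ← Finset.sum_mul] at hB ⊢
    simp only [hg, mul_sub, Finset.sum_sub_distrib, ← Finset.sum_mul]
    rw [← hΦ] at hB
    linear_combination Φ * ht + hB
  have hb' := Finset.sum_nonneg hb
  have hj' := Finset.sum_nonneg hj
  refine ⟨fun i hi => ?_, fun j hpos => ?_, fun hpos => ?_⟩
  · have := (Finset.sum_eq_zero_iff_of_nonneg hb).1 (by linarith) i (Finset.mem_univ i)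
    rcases mul_eq_zero.1 this with e | e <;> linarith
  · have := (Finset.sum_eq_zero_iff_of_nonneg hj).1 (by linarith) j (Finset.mem_univ j)
    rcases mul_eq_zero.1 this with e | e <;> linarith
  · have : π.quit v x * Φ = 0 := by linarith
    rcases mul_eq_zero.1 this with e | e <;> linarith

theorem notMem_of_visit_pos {v : List (Fin n)} {x : Fin n → ℝ} {j : Fin n}
    (hj : 0 < π.visit v x j) : j ∉ v := fun hm => by
  rw [π.visit_unvisited v x j hm] at hj
  exact lt_irrefl _ hj

theorem mem_of_buy_pos {v : List (Fin n)} {x : Fin n → ℝ} {j : Fin n}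
    (hj : 0 < π.buy v x j) : j ∈ v := by
  by_contra hm
  rw [π.buy_visited v x j hm] at hj
  exact lt_irrefl _ hj

theorem le_of_visit_pos (h : IsIndex c p B U) (hc : 0 < c)
    (hπ : SequentiallyRational c p B π) {v : List (Fin n)} (hv : v.Nodup) {x : Fin n → ℝ}
    (hx : ∀ i, x i ∈ Icc (0 : ℝ) 1) {i : Fin n} (hi : 0 < π.visit v x i) :
    stopPayoff p v x ≤ U i ∧ ∀ k, k ∉ v → U k ≤ U i :=
  le_of_visit_eq h hc (notMem_of_visit_pos hi) ((optimal_actions h hc.le hπ hv hx).2.1 i hi).ge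

theorem stopPayoff_lt_of_lt (h : IsIndex c p B U) (hc : 0 < c) {v : List (Fin n)} {x : Fin n → ℝ}
    {k : Fin n} (hk : k ∉ v) (hU : stopPayoff p v x < U k) :
    stopPayoff p v x < indexValue p B U v x :=
  have := h.isProb
  stopPayoff_lt_indexValue h hk (fun hle => not_ae_le_of_excess hc (h.excess_eq k) (by
    filter_upwards [hle] with z hz using by linarith)) hU

/-- The consumer stops only if no firm left has a reservation value above the best reward. -/
theorem le_stopPayoff_of_stop (h : IsIndex c p B U) (hc : 0 < c)
    (hπ : SequentiallyRational c p B π) {v : List (Fin n)} (hv : v.Nodup) {x : Fin n → ℝ}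
    (hx : ∀ i, x i ∈ Icc (0 : ℝ) 1) (hs : 0 < π.quit v x ∨ ∃ i, 0 < π.buy v x i) {k : Fin n}
    (hk : k ∉ v) : U k ≤ stopPayoff p v x := by
  by_contra hlt
  have h1 := stopPayoff_lt_of_lt h hc hk (not_le.1 hlt)
  have hopt := optimal_actions h hc.le hπ hv hx
  rcases hs with hq | ⟨i, hi⟩
  · linarith [hopt.2.2 hq, stopPayoff_nonneg (p := p) v x]
  · linarith [hopt.1 i hi, le_stopPayoff (p := p) (mem_of_buy_pos hi) x]

/-- If firm `i` beats the other sampled rewards, the outside option and the reservation values of the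
firms left, then the consumer buys from `i` at once. -/
theorem buy_eq_one (h : IsIndex c p B U) (hc : 0 < c)
    (hπ : SequentiallyRational c p B π) {v : List (Fin n)} (hv : v.Nodup) {x : Fin n → ℝ}
    (hx : ∀ i, x i ∈ Icc (0 : ℝ) 1) {i : Fin n} (hi : i ∈ v) (h0 : 0 < x i - p i)
    (hv' : ∀ j ∈ v, j ≠ i → x j - p j < x i - p i) (hU : ∀ k, k ∉ v → U k < x i - p i) :
    π.buy v x i = 1 := by
  have hopt := optimal_actions h hc.le hπ hv hx
  have hs := le_stopPayoff (p := p) hi x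
  have hΦ := hs.trans (stopPayoff_le_indexValue h v x)
  have hvis : ∀ j, π.visit v x j = 0 := fun j => by
    by_contra hne
    have hpos := lt_of_le_of_ne (π.visit_nonneg v x j) (Ne.symm hne)
    linarith [(le_of_visit_pos h hc hπ hv hx hpos).1, hU j (notMem_of_visit_pos hpos)]
  have hq : π.quit v x = 0 := by
    by_contra hne
    have hpos := lt_of_le_of_ne (π.quit_nonneg v x) (Ne.symm hne)
    linarith [hopt.2.2 hpos]
  have hb : ∀ j, j ≠ i → π.buy v x j = 0 := fun j hj => by
    by_contra hne
    have hpos := lt_of_le_of_ne (π.buy_nonneg v x j) (Ne.symm hne)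
    linarith [hopt.1 j hpos, hv' j (mem_of_buy_pos hpos) hj]
  have ht := π.total v x
  rw [hq, Finset.sum_eq_single i (fun j _ hj => hb j hj) (by simp)] at ht
  simpa [hvis] using ht

theorem buyProb_nonneg (π : SearchPolicy n) (x : Fin n → ℝ) (i : Fin n) :
    ∀ v : List (Fin n), v.Nodup → 0 ≤ buyProb π x i v := by
  refine infoSet_induction fun v hv ih => ?_
  rw [buyProb_eq π hv]
  refine add_nonneg (π.buy_nonneg v x i) (Finset.sum_nonneg fun j _ => ?_)
  by_cases hj : j ∈ v
  · simp [π.visit_unvisited v x j hj]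
  · exact mul_nonneg (π.visit_nonneg v x j) (ih j hj)

theorem sum_buyProb_le_one (π : SearchPolicy n) (x : Fin n → ℝ) :
    ∀ v : List (Fin n), v.Nodup → ∑ i, buyProb π x i v ≤ 1 := by
  refine infoSet_induction fun v hv ih => ?_
  simp only [buyProb_eq π hv, Finset.sum_add_distrib]
  rw [Finset.sum_comm]
  have : ∀ j ∈ Finset.univ, ∑ i, π.visit v x j * buyProb π x i (j :: v) ≤ π.visit v x j := by
    intro j _
    rw [← Finset.mul_sum]
    by_cases hj : j ∈ v
    · simp [π.visit_unvisited v x j hj]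
    · exact mul_le_of_le_one_right (π.visit_nonneg v x j) (ih j hj)
  have := Finset.sum_le_sum this
  linarith [π.total v x, π.quit_nonneg v x]

theorem buyProb_le_one (π : SearchPolicy n) (x : Fin n → ℝ) (i : Fin n) {v : List (Fin n)}
    (hv : v.Nodup) : buyProb π x i v ≤ 1 :=
  (Finset.single_le_sum (fun j _ => buyProb_nonneg π x j v hv) (Finset.mem_univ i)).trans
    (sum_buyProb_le_one π x v hv)

theorem buyProb_eq_one_of_buy {x : Fin n → ℝ} {i : Fin n} {v : List (Fin n)} (hv : v.Nodup)
    (hb : π.buy v x i = 1) : buyProb π x i v = 1 := by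
  refine le_antisymm (buyProb_le_one π x i hv) ?_
  rw [buyProb_eq π hv, hb]
  refine le_add_of_nonneg_right (Finset.sum_nonneg fun j _ => ?_)
  by_cases hj : j ∈ v
  · simp [π.visit_unvisited v x j hj]
  · exact mul_nonneg (π.visit_nonneg v x j) (buyProb_nonneg π x i _ (List.nodup_cons.2 ⟨hj, hv⟩))

/-- A firm that is visited although its rivals are left and that turns out better than its
reservation value sells at once. -/
theorem buyProb_cons_eq_one (h : IsIndex c p B U) (hc : 0 < c)
    (hπ : SequentiallyRational c p B π) {v : List (Fin n)} (hv : v.Nodup) {x : Fin n → ℝ}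
    (hx : ∀ i, x i ∈ Icc (0 : ℝ) 1) {i : Fin n} (hi : 0 < π.visit v x i) (hxi : U i < x i - p i) :
    buyProb π x i (i :: v) = 1 := by
  have hiv := notMem_of_visit_pos hi
  have hv' := List.nodup_cons.2 ⟨hiv, hv⟩
  obtain ⟨h1, h2⟩ := le_of_visit_pos h hc hπ hv hx hi
  refine buyProb_eq_one_of_buy hv' (buy_eq_one h hc hπ hv' hx List.mem_cons_self
    (by linarith [stopPayoff_nonneg (p := p) v x]) (fun j hj hji => ?_) fun k hk => ?_)
  · have := le_stopPayoff (p := p) ((List.mem_cons.1 hj).resolve_left hji) x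
    linarith
  · linarith [h2 k fun hm => hk (List.mem_cons_of_mem _ hm)]

/-- A posterior above the threshold sells at least as often as any other one. -/
theorem buyProb_le_of_threshold (h : IsIndex c p B U) (hc : 0 < c)
    (hπ : SequentiallyRational c p B π) {x x' : Fin n → ℝ} (hx' : ∀ i, x' i ∈ Icc (0 : ℝ) 1)
    {i : Fin n} (hxx' : ∀ j, j ≠ i → x j = x' j) (hxi : U i < x' i - p i) :
    ∀ v : List (Fin n), v.Nodup → i ∉ v → buyProb π x i v ≤ buyProb π x' i v := by
  refine infoSet_induction fun v hv ih hi => ?_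
  -- Until `i` is visited, its posterior cannot influence the policy; once it is visited, the
  -- posterior above the threshold sells with probability one.
  have had := π.adapted v x x' fun j hj => hxx' j fun e => hi (e ▸ hj)
  rw [buyProb_eq π hv, buyProb_eq π hv, had.1, had.2.1]
  refine add_le_add le_rfl (Finset.sum_le_sum fun j _ => ?_)
  rcases (π.visit_nonneg v x' j).eq_or_lt with e | hpos
  · simp [← e]
  refine mul_le_mul_of_nonneg_left ?_ hpos.le
  have hj := notMem_of_visit_pos hpos
  rcases eq_or_ne j i with rfl | hji
  · rw [buyProb_cons_eq_one h hc hπ hv hx' hpos hxi]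
    exact buyProb_le_one π x _ (List.nodup_cons.2 ⟨hj, hv⟩)
  · exact ih j hj fun hm => (List.mem_cons.1 hm).elim (fun e => hji e.symm) hi

/-- The consumer never buys at a loss. -/
theorem nonneg_of_buyProb_pos (h : IsIndex c p B U) (hc : 0 ≤ c)
    (hπ : SequentiallyRational c p B π) {x : Fin n → ℝ} (hx : ∀ i, x i ∈ Icc (0 : ℝ) 1)
    {i : Fin n} : ∀ v : List (Fin n), v.Nodup → 0 < buyProb π x i v → 0 ≤ x i - p i := by
  refine infoSet_induction fun v hv ih hpos => ?_
  rw [buyProb_eq π hv] at hpos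
  by_contra hneg
  have hb : π.buy v x i = 0 := by
    by_contra hne
    have := (optimal_actions h hc hπ hv hx).1 i
      (lt_of_le_of_ne (π.buy_nonneg v x i) (Ne.symm hne))
    linarith [indexValue_nonneg (p := p) (B := B) (U := U) v x]
  have : ∑ j, π.visit v x j * buyProb π x i (j :: v) ≤ 0 := by
    refine Finset.sum_nonpos fun j _ => ?_
    by_cases hj : j ∈ v
    · simp [π.visit_unvisited v x j hj]
    · exact mul_nonpos_of_nonneg_of_nonpos (π.visit_nonneg v x j)
        (not_lt.1 fun hp => hneg (ih j hj hp))
  linarith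

/-- If firm `i` never sells although its posterior exceeds the threshold, then search ends with a
rival whose reward is at least the reservation value of `i`. -/
theorem exists_reward_ge (h : IsIndex c p B U) (hc : 0 < c)
    (hπ : SequentiallyRational c p B π) {x : Fin n → ℝ} (hx : ∀ i, x i ∈ Icc (0 : ℝ) 1)
    {i : Fin n} (hU : 0 < U i) (hxi : U i < x i - p i) :
    ∀ v : List (Fin n), v.Nodup → i ∉ v → buyProb π x i v = 0 → ∃ k, k ≠ i ∧ U i ≤ x k - p k := by
  refine infoSet_induction fun v hv ih hi hb => ?_
  by_cases hs : 0 < π.quit v x ∨ ∃ k, 0 < π.buy v x k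
  · have hle := le_stopPayoff_of_stop h hc hπ hv hx hs hi
    rcases (Finset.le_fold_max _).1 hle with h0 | ⟨k, hk, hk'⟩
    · linarith
    · exact ⟨k, fun e => hi (e ▸ List.mem_toFinset.1 hk), hk'⟩
  push Not at hs
  obtain ⟨j, hj⟩ : ∃ j, 0 < π.visit v x j := by
    by_contra hcon
    push Not at hcon
    have := π.total v x
    linarith [Finset.sum_nonpos fun j (_ : j ∈ Finset.univ) => hcon j,
      Finset.sum_nonpos fun j (_ : j ∈ Finset.univ) => hs.2 j]
  have hjv := notMem_of_visit_pos hj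
  have hterm : ∀ k ∈ Finset.univ, 0 ≤ π.visit v x k * buyProb π x i (k :: v) := fun k _ => by
    by_cases hk : k ∈ v
    · simp [π.visit_unvisited v x k hk]
    · exact mul_nonneg (π.visit_nonneg v x k)
        (buyProb_nonneg π x i _ (List.nodup_cons.2 ⟨hk, hv⟩))
  rw [buyProb_eq π hv] at hb
  have h0 := (Finset.sum_eq_zero_iff_of_nonneg hterm).1
    (by linarith [π.buy_nonneg v x i, Finset.sum_nonneg hterm]) j (Finset.mem_univ j)
  have hb0 : buyProb π x i (j :: v) = 0 := (mul_eq_zero.1 h0).resolve_left hj.ne'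
  rcases eq_or_ne j i with rfl | hji
  · rw [buyProb_cons_eq_one h hc hπ hv hx hj hxi] at hb0
    norm_num at hb0
  · exact ih j hjv (fun hm => (List.mem_cons.1 hm).elim (fun e => hji e.symm) hi) hb0

theorem visit_nil_sum (h : IsIndex c p B U) (hc : 0 < c)
    (hπ : SequentiallyRational c p B π) {x : Fin n → ℝ} (hx : ∀ i, x i ∈ Icc (0 : ℝ) 1)
    {i : Fin n} (hU : 0 < U i) : ∑ j, π.visit [] x j = 1 := by
  have ht := π.total [] x
  have hb : ∑ j, π.buy [] x j = 0 := Finset.sum_eq_zero fun j _ => π.buy_visited [] x j (by simp)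
  have hq : π.quit [] x = 0 := by
    by_contra hne
    have := le_stopPayoff_of_stop h hc hπ List.nodup_nil hx
      (Or.inl (lt_of_le_of_ne (π.quit_nonneg [] x) (Ne.symm hne))) (k := i) (by simp)
    simp [stopPayoff] at this
    linarith
  linarith

/-- Some firm is visited first and has a maximal reservation value. It cannot be `i`, since `i`
would then sell at once. -/
theorem exists_index_ge (h : IsIndex c p B U) (hc : 0 < c)
    (hπ : SequentiallyRational c p B π) {x : Fin n → ℝ} (hx : ∀ i, x i ∈ Icc (0 : ℝ) 1)
    {i : Fin n} (hU : 0 < U i) (hxi : U i < x i - p i) (hb : buyProb π x i [] = 0) :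
    ∃ k, k ≠ i ∧ U i ≤ U k := by
  obtain ⟨j, hj⟩ : ∃ j, 0 < π.visit [] x j := by
    by_contra hcon
    push Not at hcon
    linarith [visit_nil_sum h hc hπ hx hU, Finset.sum_nonpos fun j (_ : j ∈ Finset.univ) => hcon j]
  refine ⟨j, ?_, (le_of_visit_pos h hc hπ List.nodup_nil hx hj).2 i (by simp)⟩
  rintro rfl
  have h1 := buyProb_cons_eq_one h hc hπ List.nodup_nil hx hj hxi
  rw [buyProb_eq π List.nodup_nil] at hb
  have hterm : ∀ k ∈ Finset.univ, 0 ≤ π.visit [] x k * buyProb π x j [k] := fun k _ =>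
    mul_nonneg (π.visit_nonneg [] x k) (buyProb_nonneg π x j _ (List.nodup_singleton k))
  have h0 := (Finset.sum_eq_zero_iff_of_nonneg hterm).1
    (by linarith [π.buy_nonneg [] x j, Finset.sum_nonneg hterm]) j (Finset.mem_univ j)
  rw [h1, mul_one] at h0
  linarith

/-- A firm whose reservation value and reward exceed the reservation values of its rivals sells for
sure. -/
theorem buyProb_eq_one (h : IsIndex c p B U) (hc : 0 < c)
    (hπ : SequentiallyRational c p B π) {x : Fin n → ℝ} (hx : ∀ i, x i ∈ Icc (0 : ℝ) 1)
    {i : Fin n} (hU : 0 < U i) (h0 : 0 < x i - p i)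
    (hk : ∀ k, k ≠ i → U k < U i ∧ U k < x i - p i) : buyProb π x i [] = 1 := by
  have hv : ∀ j, j ≠ i → π.visit [] x j = 0 := fun j hj => by
    by_contra hne
    have := (le_of_visit_pos h hc hπ List.nodup_nil hx
      (lt_of_le_of_ne (π.visit_nonneg [] x j) (Ne.symm hne))).2 i (by simp)
    linarith [(hk j hj).1]
  have hsum := visit_nil_sum h hc hπ hx hU
  rw [Finset.sum_eq_single i (fun j _ hj => hv j hj) (by simp)] at hsum
  rw [buyProb_eq π List.nodup_nil, Finset.sum_eq_single i (fun j _ hj => by simp [hv j hj])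
    (by simp), hsum, π.buy_visited [] x i (by simp), zero_add, one_mul]
  refine buyProb_eq_one_of_buy (List.nodup_singleton i) (buy_eq_one h hc hπ
    (List.nodup_singleton i) hx (by simp) h0 (fun j hj hji => ?_) fun k hk' => ?_)
  · exact absurd (List.mem_singleton.1 hj) hji
  · exact (hk k fun e => hk' (by simp [e])).2

end Rational

/-! ### The value of search against expected rewards net of a single visiting cost. -/

section Accounting

variable {n : ℕ} {c : ℝ} {p : Fin n → ℝ≥0} {B : Fin n → Measure ℝ} {U : Fin n → ℝ}
  {π : SearchPolicy n}

theorem measurable_buyProb {Ω : Type*} [MeasurableSpace Ω] {π : Ω → SearchPolicy n}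
    {X : Ω → Fin n → ℝ} (hv : ∀ v j, Measurable fun ω => (π ω).visit v (X ω) j)
    (hb : ∀ v j, Measurable fun ω => (π ω).buy v (X ω) j) (i : Fin n) :
    ∀ v : List (Fin n), v.Nodup → Measurable fun ω => buyProb (π ω) (X ω) i v := by
  refine infoSet_induction fun v hvn ih => ?_
  simp only [buyProb_eq _ hvn]
  refine (hb v i).add (Finset.measurable_sum _ fun j _ => ?_)
  by_cases hj : j ∈ v
  · simp [(π _).visit_unvisited v _ j hj]
  · exact (hv v j).mul (ih j hj)

/-- The posteriors `x` of the visited firms together with the posteriors `y` of the other ones. -/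
def splice (v : List (Fin n)) (x y : Fin n → ℝ) (j : Fin n) : ℝ := if j ∈ v then x j else y j

theorem splice_update {v : List (Fin n)} {j : Fin n} (hj : j ∉ v) (x y : Fin n → ℝ) (z : ℝ) :
    splice v x (Function.update y j z) = splice (j :: v) (Function.update x j z) y := by
  funext k
  rcases eq_or_ne k j with rfl | hk
  · simp [splice, hj]
  · simp [splice, hk]

theorem measurable_splice (v : List (Fin n)) (x : Fin n → ℝ) : Measurable (splice v x) := by
  refine measurable_pi_lambda _ fun j => ?_
  unfold splice
  split_ifs
  · exact measurable_const
  · exact measurable_pi_apply j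

/-- The reward that the consumer earns from `v` on at the posteriors `y`, net of the cost of visiting
the firm she buys from. -/
def netReward (c : ℝ) (p : Fin n → ℝ≥0) (π : SearchPolicy n) (v : List (Fin n))
    (y : Fin n → ℝ) : ℝ :=
  ∑ i, buyProb π y i v * (y i - p i - if i ∈ v then 0 else c)

theorem measurable_netReward {v : List (Fin n)} (hv : v.Nodup) : Measurable (netReward c p π v) :=
  Finset.measurable_sum _ fun i _ =>
    (measurable_buyProb (π := fun _ => π) (X := fun x => x) π.measurable_visit
      π.measurable_buy i v hv).mul (((measurable_pi_apply i).sub_const _).sub_const _)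

theorem abs_netReward_le (hc : 0 ≤ c) {v : List (Fin n)} (hv : v.Nodup) {y : Fin n → ℝ}
    (hy : ∀ i, y i ∈ Icc (0 : ℝ) 1) : |netReward c p π v y| ≤ ∑ i, (1 + (p i : ℝ) + c) := by
  refine (Finset.abs_sum_le_sum_abs _ _).trans (Finset.sum_le_sum fun i _ => ?_)
  rw [abs_mul, abs_of_nonneg (buyProb_nonneg π y i v hv)]
  refine (mul_le_of_le_one_left (abs_nonneg _) (buyProb_le_one π y i hv)).trans ?_
  have := (p i).coe_nonneg
  obtain ⟨h0, h1⟩ := hy i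
  rw [abs_le]
  split_ifs <;> constructor <;> linarith

theorem integrable_netReward_splice (h : IsIndex c p B U) (hc : 0 ≤ c) {v w : List (Fin n)}
    (hw : w.Nodup) {x : Fin n → ℝ} (hx : ∀ i, x i ∈ Icc (0 : ℝ) 1) :
    Integrable (fun y => netReward c p π w (splice v x y)) (Measure.pi B) := by
  have := h.isProb
  refine Integrable.of_bound
    ((measurable_netReward hw).comp (measurable_splice v x)).aestronglyMeasurable
    (∑ i, (1 + (p i : ℝ) + c)) ?_
  filter_upwards [ae_pi_of_ae B h.ae_mem] with y hy
  refine abs_netReward_le hc hw fun i => ?_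
  unfold splice
  split_ifs
  exacts [hx i, hy i]

/-- The consumer pays `c` for every visit, whereas `netReward` charges it only for the firm finally
bought from. Dropping the other costs gives the inequality. -/
theorem le_netReward (hc : 0 ≤ c) {v : List (Fin n)} (hv : v.Nodup) (x y : Fin n → ℝ) :
    ∑ i, π.buy v x i * (x i - p i) +
      ∑ j, π.visit v x j * (netReward c p π (j :: v) (splice v x y) - c) ≤
      netReward c p π v (splice v x y) := by
  set w := splice v x y with hw
  have hwx : ∀ j ∈ v, x j = w j := fun j hj => by simp [hw, splice, hj]
  obtain ⟨e1, e2, -⟩ := π.adapted v x w hwx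
  have hsplit : netReward c p π v w = ∑ i, π.buy v w i * (w i - p i - if i ∈ v then 0 else c) +
      ∑ j, π.visit v w j *
        ∑ i, buyProb π w i (j :: v) * (w i - p i - if i ∈ v then 0 else c) := by
    unfold netReward
    simp only [buyProb_eq π hv, add_mul, Finset.sum_add_distrib, Finset.sum_mul, Finset.mul_sum]
    rw [Finset.sum_comm]
    simp only [mul_assoc]
  rw [hsplit, e1, e2]
  refine add_le_add (Finset.sum_le_sum fun i _ => ?_) (Finset.sum_le_sum fun j _ => ?_)
  · by_cases hi : i ∈ v
    · simp [hi, hwx i hi]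
    · simp [π.buy_visited v w i hi]
  · by_cases hj : j ∈ v
    · simp [π.visit_unvisited v w j hj]
    refine mul_le_mul_of_nonneg_left ?_ (π.visit_nonneg v w j)
    have hjv := List.nodup_cons.2 ⟨hj, hv⟩
    have : ∑ i, buyProb π w i (j :: v) * (w i - p i - if i ∈ v then 0 else c) =
        netReward c p π (j :: v) w - buyProb π w j (j :: v) * c := by
      unfold netReward
      rw [eq_sub_iff_add_eq, ← Finset.add_sum_erase _ _ (Finset.mem_univ j),
        ← Finset.add_sum_erase Finset.univ (fun i => buyProb π w i (j :: v) *
          (w i - p i - if i ∈ j :: v then 0 else c)) (Finset.mem_univ j)]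
      have : ∀ i ∈ Finset.univ.erase j, buyProb π w i (j :: v) *
          (w i - p i - if i ∈ j :: v then 0 else c) = buyProb π w i (j :: v) *
          (w i - p i - if i ∈ v then 0 else c) := fun i hi => by
        simp [Finset.ne_of_mem_erase hi]
      rw [Finset.sum_congr rfl this]
      simp only [hj, List.mem_cons_self, if_false, if_true]
      ring
    rw [this]
    exact sub_le_sub_left (mul_le_of_le_one_left hc (buyProb_le_one π w j hjv)) _

/-- Backward induction over information sets. All posteriors are drawn beforehand, and those of
visited firms are overwritten by `splice`; a visit moves one drawn posterior to the revealed side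
(`splice_update`). -/
theorem indexValue_le_integral_netReward (h : IsIndex c p B U) (hc : 0 ≤ c)
    (hπ : SequentiallyRational c p B π) :
    ∀ v : List (Fin n), v.Nodup → ∀ x : Fin n → ℝ, (∀ i, x i ∈ Icc (0 : ℝ) 1) →
      indexValue p B U v x ≤ ∫ y, netReward c p π v (splice v x y) ∂Measure.pi B := by
  have := h.isProb
  refine infoSet_induction fun v hv ih x hx => ?_
  rw [indexValue_eq h hc hπ hv hx]
  have hi : ∀ j ∈ Finset.univ, Integrable (fun y => π.visit v x j *
      (netReward c p π (j :: v) (splice v x y) - c)) (Measure.pi B) := fun j _ => by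
    by_cases hj : j ∈ v
    · simp [π.visit_unvisited v x j hj]
    · exact ((integrable_netReward_splice h hc (List.nodup_cons.2 ⟨hj, hv⟩) hx).sub
        (integrable_const c)).const_mul _
  have hstep : ∑ i, π.buy v x i * (x i - p i) + ∑ j, π.visit v x j *
      (∫ y, netReward c p π (j :: v) (splice v x y) ∂Measure.pi B - c) ≤
      ∫ y, netReward c p π v (splice v x y) ∂Measure.pi B := by
    refine le_trans (le_of_eq ?_) (integral_mono ((integrable_const _).add
      (integrable_finsetSum _ hi)) (integrable_netReward_splice h hc hv hx)
      fun y => le_netReward hc hv x y)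
    have e := integral_add (μ := Measure.pi B)
      (integrable_const (∑ i, π.buy v x i * (x i - p i))) (integrable_finsetSum _ hi)
    simp only [Pi.add_apply] at e ⊢
    rw [e, integral_finsetSum _ hi]
    simp only [integral_const, probReal_univ, smul_eq_mul, one_mul]
    congr 1
    refine Finset.sum_congr rfl fun j _ => ?_
    by_cases hj : j ∈ v
    · simp [π.visit_unvisited v x j hj]
    · rw [integral_const_mul, integral_sub
        (integrable_netReward_splice h hc (List.nodup_cons.2 ⟨hj, hv⟩) hx) (integrable_const c)]
      simp
  refine le_trans (add_le_add le_rfl (Finset.sum_le_sum fun j _ => ?_)) hstep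
  by_cases hj : j ∈ v
  · simp [π.visit_unvisited v x j hj]
  refine mul_le_mul_of_nonneg_left (sub_le_sub_right ?_ c) (π.visit_nonneg v x j)
  have hjv := List.nodup_cons.2 ⟨hj, hv⟩
  have hm := (measurable_netReward (c := c) (p := p) (π := π) hjv).comp (measurable_splice v x)
  have hint : Integrable (fun a : ℝ × (Fin n → ℝ) =>
      netReward c p π (j :: v) (splice v x (Function.update a.2 j a.1)))
      ((B j).prod (Measure.pi B)) := by
    have := integrable_netReward_splice (π := π) (v := v) h hc hjv hx
    rw [← pi_eq_map_update B j] at this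
    exact (integrable_map_measure hm.aestronglyMeasurable
      (measurable_update_prod j).aemeasurable).1 this
  have e := integral_pi_eq_update B j hm
  simp only [Function.comp_apply] at e
  rw [e, integral_prod _ hint]
  refine integral_mono_ae (integrable_indexValue_update h v j x) hint.integral_prod_left ?_
  filter_upwards [h.ae_mem j] with z hz
  simp only [splice_update hj]
  exact ih j hj _ (update_mem_unit hx hz j)

/-- The value of search is at most the expected reward net of the cost of one visit. -/
theorem indexValue_nil_le (h : IsIndex c p B U) (hc : 0 ≤ c) (hπ : SequentiallyRational c p B π) :
    indexValue p B U [] 0 ≤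
      ∫ y, ∑ i, buyProb π y i [] * (y i - p i - c) ∂Measure.pi B := by
  have := indexValue_le_integral_netReward h hc hπ [] List.nodup_nil 0 fun _ => by simp
  have e : ∀ y : Fin n → ℝ, splice [] 0 y = y := fun y => by funext j; simp [splice]
  simpa [netReward, e] using this

/-- Visiting firm `k` and buying there is feasible. -/
theorem le_indexValue_nil (h : IsIndex c p B U) (k : Fin n) :
    ∫ x, x ∂B k - c - p k ≤ indexValue p B U [] 0 := by
  have := h.isProb
  have h1 := visit_le_indexValue h (v := []) (i := k) (by simp) 0
  have h2 : ∫ z, (z - p k) ∂B k ≤ ∫ z, indexValue p B U [k] (Function.update 0 k z) ∂B k := by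
    refine integral_mono ((integrable_id_unit (h.ae_mem k)).sub (integrable_const _))
      (integrable_indexValue_update h [] k 0) fun z => ?_
    have := (le_stopPayoff (p := p) (v := [k]) (j := k) (by simp) (Function.update 0 k z)).trans
      (stopPayoff_le_indexValue h _ _)
    simpa using this
  rw [integral_sub (integrable_id_unit (h.ae_mem k)) (integrable_const _)] at h2
  simp at h2
  linarith

end Accounting

/-! ### Equilibria with zero prices and useless information. -/

section Existence

variable {n : ℕ} {μ c : ℝ}

/-- The law of the posterior of a firm that plays the mixed strategy `σ`. -/
theorem exists_average_signal (σ : Measure (ℝ≥0 × Signal μ)) [IsProbabilityMeasure σ]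
    (hμ : 0 ≤ μ) :
    ∃ F : Signal μ, F.1 = (outcomeLaw σ).map Prod.snd := by
  have : IsProbabilityMeasure ((outcomeLaw σ).map Prod.snd) :=
    Measure.isProbabilityMeasure_map measurable_snd.aemeasurable
  have hmem : ∀ᵐ x ∂(outcomeLaw σ).map Prod.snd, x ∈ Icc (0 : ℝ) 1 := by
    refine (ae_map_iff measurable_snd.aemeasurable measurableSet_Icc).2
      ((ae_outcomeLaw_iff σ (measurable_snd measurableSet_Icc)).2 ?_)
    exact Filter.Eventually.of_forall fun a => a.2.ae_mem
  refine ⟨Signal.mk' _ hmem ?_, rfl⟩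
  rw [integral_eq_lintegral_of_nonneg_ae (by filter_upwards [hmem] with x hx using hx.1)
    (by fun_prop), lintegral_map (by fun_prop) measurable_snd,
    lintegral_outcomeLaw σ (f := fun a => ENNReal.ofReal a.2) (by fun_prop)]
  have : ∀ a : ℝ≥0 × Signal μ, ∫⁻ x, ENNReal.ofReal x ∂a.2.1 = ENNReal.ofReal μ := fun a =>
    a.2.lintegral_ofReal
  simp [this, hμ]

/-- The assessment in which the conjecture is `F` whatever the prices and the consumer follows the
index rule. -/
def indexAssessment (c : ℝ) (σ : Measure (ℝ≥0 × Signal μ)) (hσ : IsProbabilityMeasure σ)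
    (F : Signal μ) : Assessment n μ where
  firm := σ
  isProb := hσ
  belief _ _ := F
  measurable_belief _ := measurable_const
  policy p := indexPolicy (fun j => μ - c - p j) p
  measurable_visit v j := measurable_indexVisit
    (U := fun (ω : (Fin n → ℝ≥0) × (Fin n → ℝ)) k => μ - c - ω.1 k)
    (d := fun (ω : (Fin n → ℝ≥0) × (Fin n → ℝ)) k => ω.2 k - ω.1 k) v
    (fun k => by fun_prop) (fun k => by fun_prop) j
  measurable_buy v j := measurable_indexBuy
    (U := fun (ω : (Fin n → ℝ≥0) × (Fin n → ℝ)) k => μ - c - ω.1 k)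
    (d := fun (ω : (Fin n → ℝ≥0) × (Fin n → ℝ)) k => ω.2 k - ω.1 k) v
    (fun k => by fun_prop) (fun k => by fun_prop) j
  measurable_quit v := measurable_indexQuit
    (U := fun (ω : (Fin n → ℝ≥0) × (Fin n → ℝ)) k => μ - c - ω.1 k)
    (d := fun (ω : (Fin n → ℝ≥0) × (Fin n → ℝ)) k => ω.2 k - ω.1 k) v
    (fun k => by fun_prop) (fun k => by fun_prop)

/-- Below the support the excess is the mean minus the threshold, so at `μ - c` it equals `c`. -/
theorem isIndex_of_ae_le (F : Signal μ) (hF : ∀ᵐ x ∂F.1, μ - c ≤ x) (p : Fin n → ℝ≥0) :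
    IsIndex c p (fun _ => F.1) fun j => μ - c - p j where
  isProb _ := inferInstance
  ae_mem _ := F.ae_mem
  excess_eq j := by
    rw [sub_add_cancel, excess_of_ae_le F.ae_mem hF, F.2.2.2]; ring

/-- Against rivals that charge nothing and whose posteriors are at least `μ - c`, a firm with a
positive price never sells. -/
theorem buyProb_indexPolicy_eq_zero (hn : 2 ≤ n) {p : Fin n → ℝ≥0} {x : Fin n → ℝ}
    {i : Fin n} (hi : 0 < p i) (hrival : ∀ j, j ≠ i → p j = 0 ∧ μ - c ≤ x j) :
    buyProb (indexPolicy (fun j => μ - c - p j) p) x i [] = 0 := by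
  set U : Fin n → ℝ := fun j => μ - c - p j with hU
  obtain ⟨k, hk⟩ : ∃ k, k ≠ i := by
    have : Nontrivial (Fin n) := Fin.nontrivial_iff_two_le.2 hn
    exact exists_ne i
  rw [buyProb_eq _ List.nodup_nil, (indexPolicy U p).buy_visited [] x i (by simp), zero_add]
  refine Finset.sum_eq_zero fun j _ => ?_
  by_cases hji : j = i
  -- Firm `i` is not visited first, because a rival with price `0` has a strictly larger reservation
  -- value.
  · subst hji
    refine mul_eq_zero_of_left (if_neg fun h => ?_) _
    have := (h.2.2 k (by simp)).1
    simp only [hU, (hrival k hk).1, NNReal.coe_zero] at this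
    have : (0 : ℝ) < p j := by exact_mod_cast hi
    linarith
  -- After a first visit to a rival, the sampled reward is at least `μ - c` and hence at least every
  -- reservation value, so search ends before `i` is seen.
  · refine mul_eq_zero_of_right _ ?_
    rw [buyProb_eq _ (List.nodup_singleton j), (indexPolicy U p).buy_visited [j] x i
      (by simpa using Ne.symm hji), zero_add]
    refine Finset.sum_eq_zero fun m _ => mul_eq_zero_of_left (if_neg fun h => ?_) _
    obtain ⟨l, -, hl⟩ := h.1
    have h1 := (hrival j hji).2
    have h2 : x j - p j ≤ stopPayoff p [j] x := le_stopPayoff (by simp) x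
    have h3 : stopPayoff p [j] x < U l := hl
    simp only [(hrival j hji).1, NNReal.coe_zero, hU] at h2 h3
    linarith [(p l).coe_nonneg]

/-- The index rule continues only if some unvisited `U k` strictly exceeds the stopping payoff. As
almost every reward of `k` is at least `U k`, continuing is then strictly better, also for `c = 0`.
-/
theorem stopsWhenIndifferent_indexPolicy (F : Signal μ) (hF : ∀ᵐ x ∂F.1, μ - c ≤ x)
    (p : Fin n → ℝ≥0) :
    StopsWhenIndifferent c p (fun _ => F.1) (indexPolicy (fun j => μ - c - p j) p) := by
  intro v hv x _ htie j
  have h := isIndex_of_ae_le F hF p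
  have hle := htie (indexPolicy (fun j => μ - c - p j) p)
  rw [searchPayoff_indexPolicy h v hv] at hle
  refine if_neg fun hC => ?_
  obtain ⟨k, hk, hlt⟩ := hC.1
  have hlt' : stopPayoff p v x < μ - c - p k := hlt
  refine absurd (stopPayoff_lt_indexValue h hk (fun hz => ?_) hlt') (not_lt.2 hle)
  obtain ⟨z, h1, h2⟩ := (hz.and hF).exists
  linarith

theorem exists_equilibrium (hn : 2 ≤ n) (hμ : 0 ≤ μ) (hc : 0 ≤ c)
    (σ : Measure (ℝ≥0 × Signal μ)) (hσ : IsProbabilityMeasure σ)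
    (hσ0 : ∀ᵐ a ∂σ, a.1 = 0 ∧ Useless μ c a.2.1) :
    ∃ A : Assessment n μ, A.IsEquilibrium c ∧ A.firm = σ ∧
      (∀ i j, A.belief i = A.belief j) ∧
      ∀ p, StopsWhenIndifferent c p (A.conjecture p) (A.policy p) := by
  obtain ⟨F, hF⟩ := exists_average_signal σ hμ
  have hm : MeasurableSet {a : ℝ≥0 × ℝ | a.1 = 0 ∧ μ - c ≤ a.2} :=
    (measurable_fst (measurableSet_singleton 0)).inter (measurable_snd measurableSet_Ici)
  have hL : ∀ᵐ a ∂outcomeLaw σ, a.1 = 0 ∧ μ - c ≤ a.2 := by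
    rw [ae_outcomeLaw_iff σ hm]
    filter_upwards [hσ0] with a ha
    filter_upwards [(useless_iff a.2).1 ha.2] with x hx using ⟨ha.1, hx⟩
  have hFle : ∀ᵐ x ∂F.1, μ - c ≤ x := by
    rw [hF, ae_map_iff measurable_snd.aemeasurable measurableSet_Ici]
    filter_upwards [hL] with a ha using ha.2
  refine ⟨indexAssessment c σ hσ F, ⟨?_, ?_, ?_⟩, rfl, fun _ _ => rfl, fun p =>
    stopsWhenIndifferent_indexPolicy F hFle p⟩
  · intro i τ hτ
    -- Every deviation earns exactly zero: at price `0` trivially, at a positive price for lack of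
    -- sales.
    refine le_trans (le_of_eq ?_) zero_le
    have hprob : ∀ j, IsProbabilityMeasure
        (Function.update (fun _ : Fin n => outcomeLaw σ) i (outcomeLaw τ) j) := fun j => by
      rcases eq_or_ne j i with rfl | hj
      · simpa using isProbabilityMeasure_outcomeLaw τ
      · simpa [Function.update_of_ne hj] using isProbabilityMeasure_outcomeLaw σ
    have hae := ae_pi_of_ae (Function.update (fun _ : Fin n => outcomeLaw σ) i (outcomeLaw τ))
      (P := fun j a => j ≠ i → a.1 = 0 ∧ μ - c ≤ a.2) fun j => by
        rcases eq_or_ne j i with rfl | hj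
        · simp
        · simpa [Function.update_of_ne hj, hj] using hL
    rw [profit, lintegral_eq_zero_of_ae_eq_zero]
    filter_upwards [hae] with ω hω
    rcases (zero_le (a := (ω i).1)).eq_or_lt with h0 | hpos
    · simp [← h0]
    · have := buyProb_indexPolicy_eq_zero (p := fun j => (ω j).1) (x := fun j => (ω j).2) hn
        hpos hω
      simp [indexAssessment, this]
  · exact fun p => sequentiallyRational_indexPolicy (isIndex_of_ae_le F hFle p) hc
  · intro i
    change outcomeLaw (σ.map fun a => (a.1, F)) = outcomeLaw σ
    -- As the price is almost surely `0`, the joint law is determined by the law of the posterior,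
    -- which is `F` by its choice as the average signal.
    refine Measure.ext_of_lintegral _ fun f hf => ?_
    have hg : Measurable fun a : ℝ≥0 × ℝ => f (0, a.2) := hf.comp (by fun_prop)
    have e : ∫⁻ x, f (0, x) ∂F.1 = ∫⁻ a, f (0, a.2) ∂outcomeLaw σ := by
      rw [hF, lintegral_map (f := fun x => f (0, x)) (hf.comp (by fun_prop)) measurable_snd]
    rw [lintegral_outcomeLaw _ hf, lintegral_map (measurable_lintegral_signal hf) (by fun_prop)]
    calc ∫⁻ a, ∫⁻ x, f (a.1, x) ∂F.1 ∂σ = ∫⁻ _, ∫⁻ x, f (0, x) ∂F.1 ∂σ := by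
          refine lintegral_congr_ae ?_
          filter_upwards [hσ0] with a ha
          rw [ha.1]
      _ = ∫⁻ a, f (0, a.2) ∂outcomeLaw σ := by simp [e]
      _ = ∫⁻ a, f a ∂outcomeLaw σ := by
          refine lintegral_congr_ae ?_
          filter_upwards [hL] with a ha
          rw [← ha.1]

end Existence

/-! ### A perturbation of the signal, and atoms of a price law. -/

section Envelope

variable {μ c r : ℝ}

/-- If the probability `D` of a sale is maximal at all posteriors above the threshold `r`, then a
signal that maximizes the probability of a sale sells with maximal probability almost surely. -/
theorem ae_eq_of_signal_optimal (hμ : μ < 1) (hc : 0 < c) (F : Signal μ) (hr : excess F.1 r = c)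
    (hr0 : 0 ≤ r) {D : ℝ → ℝ≥0∞} (hD : Measurable D) (hD1 : ∀ x, D x ≤ 1)
    (hDr : ∀ x, ∀ x' ∈ Icc (0 : ℝ) 1, r < x' → D x ≤ D x')
    (hopt : ∀ H : Signal μ, ∫⁻ x, D x ∂H.1 ≤ ∫⁻ x, D x ∂F.1) : ∀ᵐ x ∂F.1, D x = D 1 := by
  have hr1 : r < 1 := lt_one_of_excess F.ae_mem hc hr
  -- Halving the excess over `r` keeps each posterior on its side of `r`, and so leaves `D`
  -- unchanged on the unit interval, while the mean falls by `c / 2`.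
  set T : ℝ → ℝ := fun x => x - max (x - r) 0 / 2 with hT
  have hTm : Measurable T := by fun_prop
  have hTval : ∀ x, (x ≤ r → T x = x) ∧ (r < x → r < T x ∧ T x ≤ x) := fun x => by
    constructor
    · intro h; simp [hT, max_eq_right (by linarith : x - r ≤ 0)]
    · intro h
      simp only [hT, max_eq_left (by linarith : 0 ≤ x - r)]
      constructor <;> linarith
  have hTmem : ∀ x ∈ Icc (0 : ℝ) 1, T x ∈ Icc (0 : ℝ) 1 := fun x hx => by
    rcases le_or_gt x r with h | h
    · rwa [(hTval x).1 h]
    · exact ⟨hr0.trans ((hTval x).2 h).1.le, ((hTval x).2 h).2.trans hx.2⟩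
  have hDT : ∀ x ∈ Icc (0 : ℝ) 1, D (T x) = D x := fun x hx => by
    rcases le_or_gt x r with h | h
    · rw [(hTval x).1 h]
    · exact le_antisymm (hDr _ x hx h) (hDr _ _ (hTmem x hx) ((hTval x).2 h).1)
  have hTint : ∫ x, T x ∂F.1 = μ - c / 2 := by
    rw [integral_sub (integrable_id_unit F.ae_mem) ((integrable_excess F.ae_mem r).div_const 2),
      integral_div, F.2.2.2]
    unfold excess at hr
    rw [hr]
  have hden : 0 < 1 - μ + c / 2 := by linarith
  -- The weight of the atom at `1` that restores the mean: it solves `(1 - w) * (μ - c / 2) + w =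
  -- μ`.
  set w : ℝ := c / 2 / (1 - μ + c / 2) with hw
  have hw0 : 0 < w := by positivity
  have hw1 : w ≤ 1 := (div_le_one hden).2 (by linarith)
  obtain ⟨H, hH⟩ := Signal.exists_mix (μ := μ) F.1 (w := w) (y := 1) hTm
    (by filter_upwards [F.ae_mem] with x hx using hTmem x hx) ⟨hw0.le, hw1⟩ (by simp) (by
      rw [hTint]
      have : w * (1 - μ + c / 2) = c / 2 := div_mul_cancel₀ _ hden.ne'
      linarith)
  have hle := hopt H
  rw [hH D hD, lintegral_congr_ae (g := D)
    (by filter_upwards [F.ae_mem] with x hx using hDT x hx)] at hle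
  set I := ∫⁻ x, D x ∂F.1 with hI
  have hI1 : I ≤ 1 := by
    calc I ≤ ∫⁻ _, 1 ∂F.1 := lintegral_mono hD1
      _ = 1 := by simp
  have hItop : I ≠ ∞ := (hI1.trans_lt ENNReal.one_lt_top).ne
  have hsum : I = ENNReal.ofReal (1 - w) * I + ENNReal.ofReal w * I := by
    rw [← add_mul, ← ENNReal.ofReal_add (by linarith) hw0.le]; simp
  have hDI : D 1 ≤ I := by
    have h1 : ENNReal.ofReal (1 - w) * I + ENNReal.ofReal w * D 1 ≤
        ENNReal.ofReal (1 - w) * I + ENNReal.ofReal w * I := by rw [← hsum]; exact hle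
    have h2 := (ENNReal.add_le_add_iff_left (ENNReal.mul_ne_top ENNReal.ofReal_ne_top hItop)).1 h1
    exact (ENNReal.mul_le_mul_iff_right (by simpa using hw0) ENNReal.ofReal_ne_top).1 h2
  refine ae_eq_of_ae_le_of_lintegral_le (Filter.Eventually.of_forall fun x =>
    hDr x 1 (by simp) hr1) hItop aemeasurable_const ?_
  simpa using hDI

end Envelope

/-- A law on the prices whose tails stay bounded away from zero has an atom at its maximum. -/
theorem exists_top_atom (G : Measure ℝ≥0) [IsProbabilityMeasure G] {δ : ℝ≥0∞} (hδ : 0 < δ)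
    {M : ℝ≥0} (h : ∀ᵐ q ∂G, q ≤ M ∧ δ ≤ G (Ici q)) :
    ∃ t ≤ M, G {t} ≠ 0 ∧ ∀ᵐ q ∂G, q ≤ t := by
  set S : Set ℝ≥0 := {q | q ≤ M ∧ δ ≤ G (Ici q)} with hS
  have hbdd : BddAbove S := ⟨M, fun q hq => hq.1⟩
  have hne : S.Nonempty := h.exists
  have hle : ∀ᵐ q ∂G, q ≤ sSup S := by
    filter_upwards [h] with q hq using le_csSup hbdd hq
  refine ⟨sSup S, csSup_le hne fun q hq => hq.1, ?_, hle⟩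
  -- The closed tails at `u k` decrease to the closed tail at the supremum, which thus has mass at
  -- least `δ`. As there is no mass beyond the supremum, the point itself carries it.
  obtain ⟨u, hu, hlim, huS⟩ := exists_seq_tendsto_sSup hne hbdd
  have hIci : Ici (sSup S) = ⋂ k, Ici (u k) := by
    ext q
    simp only [mem_Ici, mem_iInter]
    exact ⟨fun hq k => (le_csSup hbdd (huS k)).trans hq, fun hq => le_of_tendsto' hlim hq⟩
  have hδS : δ ≤ G (Ici (sSup S)) := by
    rw [hIci]
    refine ge_of_tendsto' (tendsto_measure_iInter_atTop
      (fun k => measurableSet_Ici.nullMeasurableSet) (fun k l hkl => Ici_subset_Ici.2 (hu hkl))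
      ⟨0, measure_ne_top _ _⟩) fun k => (huS k).2
  intro h0
  have h1 : G (Ioi (sSup S)) = 0 := by
    rw [ae_iff] at hle
    simpa [Ioi] using hle
  have : G (Ici (sSup S)) ≤ 0 := by
    rw [← Ioi_insert, insert_eq]
    exact (measure_union_le _ _).trans (by simp [h0, h1])
  exact hδ.not_ge (hδS.trans this)

/-! ### Sales, demand and profit on and off the path of play. -/

section Equilibrium

variable {n : ℕ} {μ c : ℝ} {A : Assessment n μ}

/-- The law of the prices. -/
def Assessment.priceLaw (A : Assessment n μ) : Measure ℝ≥0 := A.firm.map Prod.fst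

/-- The law of (price, posterior) on the path of play. -/
def Assessment.law (A : Assessment n μ) : Measure (ℝ≥0 × ℝ) := outcomeLaw A.firm

instance : IsProbabilityMeasure A.firm := A.isProb

instance : IsProbabilityMeasure A.priceLaw :=
  Measure.isProbabilityMeasure_map measurable_fst.aemeasurable

instance : IsProbabilityMeasure A.law := isProbabilityMeasure_outcomeLaw _

theorem measurable_conjecture (i : Fin n) : Measurable fun q => (A.belief i q).1 :=
  measurable_subtype_coe.comp (A.measurable_belief i)

theorem measurable_belief_graph (i : Fin n) : Measurable fun q => (q, A.belief i q) :=
  measurable_id.prodMk (A.measurable_belief i)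

/-- Bayes consistency allows posteriors on the path to be drawn from the conjecture about any chosen
firm `i`, although these conjectures may differ across firms off a null set of prices only in name
of the index. -/
theorem law_eq (hA : A.IsEquilibrium c) (i : Fin n) :
    A.law = outcomeLaw (A.priceLaw.map fun q => (q, A.belief i q)) := by
  rw [Assessment.law, ← hA.consistent i, Assessment.priceLaw,
    Measure.map_map (measurable_belief_graph i) measurable_fst]
  rfl

theorem lintegral_law (hA : A.IsEquilibrium c) (i : Fin n) (f : ℝ≥0 × ℝ → ℝ≥0∞)
    (hf : Measurable f) :
    ∫⁻ a, f a ∂A.law = ∫⁻ q, ∫⁻ x, f (q, x) ∂(A.belief i q).1 ∂A.priceLaw := by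
  rw [law_eq hA i, lintegral_outcomeLaw _ hf, lintegral_map (measurable_lintegral_signal hf)
    (measurable_belief_graph i)]

theorem ae_law (hA : A.IsEquilibrium c) (i : Fin n) {P : ℝ≥0 × ℝ → Prop}
    (hP : MeasurableSet {a | P a}) (h : ∀ᵐ a ∂A.law, P a) :
    ∀ᵐ q ∂A.priceLaw, ∀ᵐ x ∂(A.belief i q).1, P (q, x) := by
  rw [law_eq hA i, ae_outcomeLaw_iff _ hP] at h
  exact ae_of_ae_map (measurable_belief_graph i).aemeasurable h

theorem ae_law_mem_unit : ∀ᵐ a ∂A.law, a.2 ∈ Icc (0 : ℝ) 1 := by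
  rw [Assessment.law, ae_outcomeLaw_iff _ (measurable_snd measurableSet_Icc)]
  exact Filter.Eventually.of_forall fun a => a.2.ae_mem

theorem ae_law_of_ae_price {P : ℝ≥0 → Prop} (h : ∀ᵐ q ∂A.priceLaw, P q) :
    ∀ᵐ a ∂A.law, P a.1 := by
  -- `P` may involve thresholds picked by choice, so its measurability is not available; a
  -- measurable null superset replaces it.
  obtain ⟨s, hs, hsm, hs0⟩ := exists_measurable_superset_of_null (ae_iff.1 h)
  have h' : ∀ᵐ q ∂A.priceLaw, q ∉ s := measure_eq_zero_iff_ae_notMem.1 hs0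
  have : ∀ᵐ a ∂A.law, a.1 ∉ s := by
    refine (ae_outcomeLaw_iff _ (P := fun a => a.1 ∉ s) (measurable_fst hsm.compl)).2 ?_
    filter_upwards [ae_of_ae_map measurable_fst.aemeasurable h'] with a ha
    exact Filter.Eventually.of_forall fun _ => ha
  filter_upwards [this] with a ha
  by_contra hcon
  exact ha (hs hcon)

theorem law_fst : A.law.map Prod.fst = A.priceLaw := by
  ext s hs
  rw [Measure.map_apply measurable_fst hs, ← lintegral_indicator_one (measurable_fst hs),
    Assessment.law, lintegral_outcomeLaw _ (measurable_one.indicator (measurable_fst hs)),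
    Assessment.priceLaw, ← lintegral_indicator_one hs,
    lintegral_map (measurable_one.indicator hs) measurable_fst]
  refine lintegral_congr fun a => ?_
  have : ∀ x, (Prod.fst ⁻¹' s).indicator (1 : ℝ≥0 × ℝ → ℝ≥0∞) (a.1, x) = s.indicator 1 a.1 :=
    fun x => rfl
  simp [this]

/-- The probability of a sale of firm `i` given the prices and posteriors of all firms. -/
def Assessment.sale (A : Assessment n μ) (i : Fin n) (ω : Fin n → ℝ≥0 × ℝ) : ℝ :=
  buyProb (A.policy fun j => (ω j).1) (fun j => (ω j).2) i []

theorem measurable_sale (i : Fin n) : Measurable (A.sale i) := by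
  have hz : Measurable fun ω : Fin n → ℝ≥0 × ℝ =>
      ((fun j => (ω j).1, fun j => (ω j).2) : (Fin n → ℝ≥0) × (Fin n → ℝ)) :=
    (measurable_pi_lambda _ fun j => measurable_fst.comp (measurable_pi_apply j)).prodMk
      (measurable_pi_lambda _ fun j => measurable_snd.comp (measurable_pi_apply j))
  exact measurable_buyProb (π := fun ω : Fin n → ℝ≥0 × ℝ => A.policy fun j => (ω j).1)
    (X := fun ω j => (ω j).2) (fun v j => (A.measurable_visit v j).comp hz)
    (fun v j => (A.measurable_buy v j).comp hz) i [] List.nodup_nil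

theorem sale_nonneg (i : Fin n) (ω : Fin n → ℝ≥0 × ℝ) : 0 ≤ A.sale i ω :=
  buyProb_nonneg _ _ _ _ List.nodup_nil

theorem sale_le_one (i : Fin n) (ω : Fin n → ℝ≥0 × ℝ) : A.sale i ω ≤ 1 :=
  buyProb_le_one _ _ _ List.nodup_nil

theorem sum_sale_le_one (ω : Fin n → ℝ≥0 × ℝ) : ∑ i, A.sale i ω ≤ 1 :=
  sum_buyProb_le_one _ _ _ List.nodup_nil

/-- The expected probability of a sale of firm `i` with given price and posterior when its rivals
follow the equilibrium strategy. -/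
def Assessment.demand (A : Assessment n μ) (i : Fin n) (a : ℝ≥0 × ℝ) : ℝ≥0∞ :=
  ∫⁻ ω, ENNReal.ofReal (A.sale i (Function.update ω i a)) ∂Measure.pi fun _ : Fin n => A.law

theorem measurable_demand (i : Fin n) : Measurable (A.demand i) :=
  Measurable.lintegral_prod_right' (f := fun b : (ℝ≥0 × ℝ) × (Fin n → ℝ≥0 × ℝ) =>
    ENNReal.ofReal (A.sale i (Function.update b.2 i b.1)))
    (((measurable_sale i).comp (measurable_update_prod i)).ennreal_ofReal)

theorem measurable_demand_mk (i : Fin n) (q : ℝ≥0) : Measurable fun x => A.demand i (q, x) :=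
  (measurable_demand i).comp measurable_prodMk_left

theorem demand_le_one (i : Fin n) (a : ℝ≥0 × ℝ) : A.demand i a ≤ 1 := by
  calc A.demand i a ≤ ∫⁻ _, 1 ∂Measure.pi fun _ : Fin n => A.law :=
        lintegral_mono fun ω => by simpa using sale_le_one i _
    _ = 1 := by simp

/-- Equilibrium profit of firm `i`. -/
def Assessment.eqProfit (A : Assessment n μ) (i : Fin n) : ℝ≥0∞ :=
  profit A.policy (fun _ => outcomeLaw A.firm) i

theorem lintegral_sale_mul (i : Fin n) {f : ℝ≥0 × ℝ → ℝ≥0∞} (hf : Measurable f)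
    (L : Measure (ℝ≥0 × ℝ)) [IsProbabilityMeasure L] :
    ∫⁻ ω, f (ω i) * ENNReal.ofReal (A.sale i ω)
      ∂Measure.pi (Function.update (fun _ : Fin n => A.law) i L) = ∫⁻ a, f a * A.demand i a ∂L := by
  rw [lintegral_pi_update (fun _ : Fin n => A.law) i L
    (f := fun ω => f (ω i) * ENNReal.ofReal (A.sale i ω))
    ((hf.comp (measurable_pi_apply i)).mul (measurable_sale i).ennreal_ofReal)]
  refine lintegral_congr fun a => ?_
  simp only [Function.update_self]
  rw [lintegral_const_mul]
  · rfl
  · exact ((measurable_sale i).comp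
      ((measurable_update_prod i).comp measurable_prodMk_left)).ennreal_ofReal

theorem lintegral_sale_mul_law (i : Fin n) {f : ℝ≥0 × ℝ → ℝ≥0∞} (hf : Measurable f) :
    ∫⁻ ω, f (ω i) * ENNReal.ofReal (A.sale i ω) ∂Measure.pi (fun _ : Fin n => A.law) =
      ∫⁻ a, f a * A.demand i a ∂A.law := by
  have := lintegral_sale_mul (A := A) i hf A.law
  rwa [Function.update_eq_self i fun _ : Fin n => A.law] at this

theorem eqProfit_eq (i : Fin n) : A.eqProfit i = ∫⁻ a, (a.1 : ℝ≥0∞) * A.demand i a ∂A.law :=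
  lintegral_sale_mul_law i (f := fun a => (a.1 : ℝ≥0∞)) (by fun_prop)

theorem deviation_le (hA : A.IsEquilibrium c) (i : Fin n) (q : ℝ≥0) (F : Signal μ) :
    (q : ℝ≥0∞) * ∫⁻ x, A.demand i (q, x) ∂F.1 ≤ A.eqProfit i := by
  have h := hA.firm_optimal i (Measure.dirac (q, F)) inferInstance
  refine le_trans (le_of_eq ?_) h
  have hf : Measurable fun a : ℝ≥0 × ℝ => (a.1 : ℝ≥0∞) := by fun_prop
  have e := lintegral_sale_mul (A := A) i hf (outcomeLaw (Measure.dirac (q, F)))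
  have hm : Measurable fun a : ℝ≥0 × ℝ => (a.1 : ℝ≥0∞) * A.demand i a :=
    hf.mul (measurable_demand i)
  rw [lintegral_outcomeLaw _ hm, lintegral_dirac' _ (measurable_lintegral_signal hm)] at e
  simp only at e
  rw [lintegral_const_mul _ (measurable_demand_mk i _)] at e
  exact e.symm

/-- A choice of thresholds for the conjectured signals. -/
def Assessment.IsThreshold (A : Assessment n μ) (c : ℝ) (r : Fin n → ℝ≥0 → ℝ) : Prop :=
  ∀ i q, excess (A.belief i q).1 (r i q) = c

theorem exists_isThreshold (A : Assessment n μ) (hc : 0 ≤ c) : ∃ r, A.IsThreshold c r := by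
  choose r hr using fun (i : Fin n) (q : ℝ≥0) => exists_excess_eq (A.belief i q).ae_mem hc
  exact ⟨r, fun i q => (hr i q).1⟩

variable {r : Fin n → ℝ≥0 → ℝ}

theorem Assessment.IsThreshold.le (hr : A.IsThreshold c r) (i : Fin n) (q : ℝ≥0) :
    μ - c ≤ r i q := by
  have := mean_sub_le_of_excess (A.belief i q).ae_mem (hr i q)
  rwa [(A.belief i q).2.2.2] at this

theorem Assessment.IsThreshold.isIndex (hr : A.IsThreshold c r) (p : Fin n → ℝ≥0) :
    IsIndex c p (A.conjecture p) fun j => r j (p j) - p j where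
  isProb _ := Signal.isProbabilityMeasure _
  ae_mem j := (A.belief j (p j)).ae_mem
  excess_eq j := by rw [sub_add_cancel]; exact hr j (p j)

theorem ae_mem_unit : ∀ᵐ ω ∂Measure.pi (fun _ : Fin n => A.law), ∀ j, (ω j).2 ∈ Icc (0 : ℝ) 1 :=
  ae_pi_of_ae _ fun _ => ae_law_mem_unit

theorem update_snd_mem {ω : Fin n → ℝ≥0 × ℝ} (hω : ∀ j, (ω j).2 ∈ Icc (0 : ℝ) 1) (i : Fin n)
    {a : ℝ≥0 × ℝ} (ha : a.2 ∈ Icc (0 : ℝ) 1) (j : Fin n) :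
    (Function.update ω i a j).2 ∈ Icc (0 : ℝ) 1 := by
  rcases eq_or_ne j i with rfl | hj
  · simpa using ha
  · simpa [Function.update_of_ne hj] using hω j

theorem price_le_of_sale_pos (hA : A.IsEquilibrium c) (hc : 0 ≤ c) {ω : Fin n → ℝ≥0 × ℝ}
    (hω : ∀ j, (ω j).2 ∈ Icc (0 : ℝ) 1) {i : Fin n} (hs : 0 < A.sale i ω) :
    ((ω i).1 : ℝ) ≤ (ω i).2 := by
  obtain ⟨r, hr⟩ := exists_isThreshold A hc
  have := nonneg_of_buyProb_pos (hr.isIndex _) hc (hA.consumer_optimal fun j => (ω j).1)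
    (x := fun j => (ω j).2) hω (i := i) [] List.nodup_nil hs
  linarith

theorem eqProfit_le_one (hA : A.IsEquilibrium c) (hc : 0 ≤ c) (i : Fin n) : A.eqProfit i ≤ 1 := by
  calc A.eqProfit i ≤ ∫⁻ _, 1 ∂Measure.pi fun _ : Fin n => A.law := by
        refine lintegral_mono_ae ?_
        filter_upwards [ae_mem_unit (A := A)] with ω hω
        rcases (sale_nonneg (A := A) i ω).eq_or_lt with h0 | hpos
        · have : buyProb (A.policy fun j => (ω j).1) (fun j => (ω j).2) i [] = 0 := h0.symm
          simp [this]
        · have h1 := (price_le_of_sale_pos hA hc hω hpos).trans (hω i).2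
          refine mul_le_one' (by exact_mod_cast h1) (ENNReal.ofReal_le_one.2 (sale_le_one (A := A) i ω))
    _ = 1 := by simp

/-- At almost every equilibrium price, the conjectured signal is a best reply. -/
theorem ae_profit_eq (hA : A.IsEquilibrium c) (hc : 0 ≤ c) (i : Fin n) :
    ∀ᵐ q : ℝ≥0 ∂A.priceLaw, (q : ℝ≥0∞) * ∫⁻ x, A.demand i (q, x) ∂(A.belief i q).1 = A.eqProfit i := by
  have hm : Measurable fun a : ℝ≥0 × ℝ => (a.1 : ℝ≥0∞) * A.demand i a :=
    Measurable.mul (by fun_prop) (measurable_demand i)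
  have e : A.eqProfit i =
      ∫⁻ q : ℝ≥0, (q : ℝ≥0∞) * ∫⁻ x, A.demand i (q, x) ∂(A.belief i q).1 ∂A.priceLaw := by
    rw [eqProfit_eq, lintegral_law hA i _ hm]
    exact lintegral_congr fun q =>
      lintegral_const_mul (q : ℝ≥0∞) (measurable_demand_mk i q)
  have hfin : A.eqProfit i ≠ ∞ := ((eqProfit_le_one hA hc i).trans_lt ENNReal.one_lt_top).ne
  -- No price with its conjectured signal earns more than the equilibrium profit, yet their average
  -- is that profit; hence equality almost everywhere.
  refine ae_eq_of_ae_le_of_lintegral_le (Filter.Eventually.of_forall fun q =>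
    deviation_le hA i q _) (e ▸ hfin) aemeasurable_const ?_
  rw [← e]; simp

/-- The comparison `buyProb_le_of_threshold` holds for almost every draw of the rivals and is
integrated over them. It is the monotonicity required by `ae_eq_of_signal_optimal`. -/
theorem demand_le_of_threshold (hA : A.IsEquilibrium c) (hc : 0 < c) (hr : A.IsThreshold c r)
    (i : Fin n) (q : ℝ≥0) (x : ℝ) {x' : ℝ} (hx' : x' ∈ Icc (0 : ℝ) 1) (hlt : r i q < x') :
    A.demand i (q, x) ≤ A.demand i (q, x') := by
  refine lintegral_mono_ae ?_
  filter_upwards [ae_mem_unit (A := A)] with ω hω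
  refine ENNReal.ofReal_le_ofReal ?_
  unfold Assessment.sale
  have hp : (fun j => (Function.update ω i (q, x) j).1) =
      fun j => (Function.update ω i (q, x') j).1 := by
    funext j
    rcases eq_or_ne j i with rfl | hj
    · simp
    · simp [Function.update_of_ne hj]
  rw [hp]
  refine buyProb_le_of_threshold (hr.isIndex _) hc (hA.consumer_optimal _)
    (x' := fun j => (Function.update ω i (q, x') j).2)
    (update_snd_mem hω i hx') (fun j hj => ?_) ?_ [] List.nodup_nil (by simp)
  · simp [Function.update_of_ne hj]
  · simpa using hlt

/-- At almost every positive equilibrium price, all posteriors sell with the same probability. -/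
theorem ae_demand_eq (hA : A.IsEquilibrium c) (hμ : μ < 1) (hc : 0 < c) (hcμ : c ≤ μ)
    (i : Fin n) : ∀ᵐ q ∂A.priceLaw, 0 < q →
      ∀ᵐ x ∂(A.belief i q).1, A.demand i (q, x) = A.demand i (q, 1) := by
  obtain ⟨r, hr⟩ := exists_isThreshold A hc.le
  filter_upwards [ae_profit_eq hA hc.le i] with q hq hpos
  refine ae_eq_of_signal_optimal hμ hc (A.belief i q) (hr i q) (by linarith [hr.le i q])
    (D := fun x => A.demand i (q, x)) (measurable_demand_mk i _)
    (fun x => demand_le_one i _)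
    (fun x x' hx' hlt => demand_le_of_threshold hA hc hr i q x hx' hlt) fun H => ?_
  have := deviation_le hA i q H
  rw [← hq] at this
  exact (ENNReal.mul_le_mul_iff_right (by simpa using hpos.ne') ENNReal.coe_ne_top).1 this

end Equilibrium

/-! ### With positive prices, search yields no more than one visit. -/

section Efficiency

variable {n : ℕ} {μ c : ℝ} {A : Assessment n μ}

theorem integrable_of_sale_bound {f : (Fin n → ℝ≥0 × ℝ) → ℝ} (hf : Measurable f) {C : ℝ}
    (hC : ∀ ω : Fin n → ℝ≥0 × ℝ, (∀ j, (ω j).2 ∈ Icc (0 : ℝ) 1) → |f ω| ≤ C) :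
    Integrable f (Measure.pi fun _ : Fin n => A.law) :=
  Integrable.of_bound hf.aestronglyMeasurable C (by
    filter_upwards [ae_mem_unit (A := A)] with ω hω using hC ω hω)

/-- If prices are positive, then a sale carries no news about the posterior. -/
theorem integral_posterior_mul_sale (hA : A.IsEquilibrium c) (hμ : μ < 1) (hc : 0 < c)
    (hcμ : c ≤ μ) (hpos : ∀ᵐ q ∂A.priceLaw, 0 < q) (i : Fin n) :
    ∫ ω, (ω i).2 * A.sale i ω ∂(Measure.pi fun _ : Fin n => A.law) =
      μ * ∫ ω, A.sale i ω ∂(Measure.pi fun _ : Fin n => A.law) := by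
  have hμ0 : 0 ≤ μ := hc.le.trans hcμ
  have hD := measurable_demand (A := A) i
  have hfx : Measurable fun a : ℝ≥0 × ℝ => ENNReal.ofReal a.2 := by fun_prop
  have key : ∫⁻ ω, ENNReal.ofReal (ω i).2 * ENNReal.ofReal (A.sale i ω)
      ∂(Measure.pi fun _ : Fin n => A.law) =
      ENNReal.ofReal μ * ∫⁻ ω, ENNReal.ofReal (A.sale i ω)
        ∂(Measure.pi fun _ : Fin n => A.law) := by
    have e1 := lintegral_sale_mul_law (A := A) i hfx
    have e2 := lintegral_sale_mul_law (A := A) i (f := 1) measurable_one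
    simp only [Pi.one_apply, one_mul] at e2
    -- Conditionally on its own price, demand is almost surely constant in the posterior, so it
    -- factors out and leaves the mean `μ`.
    rw [e1, e2, lintegral_law hA i (fun a => ENNReal.ofReal a.2 * A.demand i a) (hfx.mul hD),
      lintegral_law hA i _ hD, ← lintegral_const_mul (f := fun q => ∫⁻ x, A.demand i (q, x)
        ∂(A.belief i q).1) _ ((measurable_lintegral_signal hD).comp (measurable_belief_graph i))]
    refine lintegral_congr_ae ?_
    filter_upwards [ae_demand_eq hA hμ hc hcμ i, hpos] with q hq hq0
    rw [lintegral_congr_ae (g := fun _ => A.demand i (q, 1)) (hq hq0),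
      lintegral_congr_ae (g := fun x => ENNReal.ofReal x * A.demand i (q, 1)) (by
        filter_upwards [hq hq0] with x hx using by rw [hx]),
      lintegral_mul_const _ (by fun_prop), (A.belief i q).lintegral_ofReal]
    simp
  have hs : Integrable (A.sale i) (Measure.pi fun _ : Fin n => A.law) :=
    integrable_of_sale_bound (measurable_sale i) (C := 1) fun ω _ => by
      rw [abs_of_nonneg (sale_nonneg i ω)]; exact sale_le_one i ω
  have hxs : Integrable (fun ω => (ω i).2 * A.sale i ω) (Measure.pi fun _ : Fin n => A.law) :=
    integrable_of_sale_bound ((measurable_snd.comp (measurable_pi_apply i)).mul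
      (measurable_sale i)) (C := 1) fun ω hω => by
        rw [abs_of_nonneg (mul_nonneg (hω i).1 (sale_nonneg i ω))]
        exact mul_le_one₀ (hω i).2 (sale_nonneg i ω) (sale_le_one i ω)
  have hae : ∀ᵐ ω ∂(Measure.pi fun _ : Fin n => A.law), 0 ≤ (ω i).2 * A.sale i ω := by
    filter_upwards [ae_mem_unit (A := A)] with ω hω using mul_nonneg (hω i).1 (sale_nonneg i ω)
  have h1 := ofReal_integral_eq_lintegral_ofReal hxs hae
  have h2 := ofReal_integral_eq_lintegral_ofReal hs
    (Filter.Eventually.of_forall fun ω => sale_nonneg i ω)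
  rw [← ENNReal.ofReal_eq_ofReal_iff (integral_nonneg_of_ae hae)
    (mul_nonneg hμ0 (integral_nonneg fun ω => sale_nonneg i ω)), ENNReal.ofReal_mul hμ0, h1, h2,
    ← key]
  refine lintegral_congr_ae ?_
  filter_upwards [ae_mem_unit (A := A)] with ω hω
  rw [ENNReal.ofReal_mul (hω i).1]

/-- The expected payoff from visiting one firm with a lowest price and buying there, or from staying
out if this is better. -/
def oneVisitValue (μ c : ℝ) (p : Fin n → ℝ≥0) : ℝ := Finset.univ.fold max 0 fun k => μ - c - p k

theorem oneVisitValue_nonneg (p : Fin n → ℝ≥0) : 0 ≤ oneVisitValue μ c p :=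
  (Finset.le_fold_max _).2 (Or.inl le_rfl)

theorem le_oneVisitValue (p : Fin n → ℝ≥0) (k : Fin n) : μ - c - p k ≤ oneVisitValue μ c p :=
  (Finset.le_fold_max _).2 (Or.inr ⟨k, Finset.mem_univ k, le_rfl⟩)

theorem measurable_oneVisitValue : Measurable (oneVisitValue (n := n) μ c) :=
  measurable_fold_max _ fun k => by fun_prop

theorem oneVisitValue_le (hcμ : c ≤ μ) (p : Fin n → ℝ≥0) : oneVisitValue μ c p ≤ μ - c :=
  (Finset.fold_max_le _).2 ⟨by linarith, fun k _ => by linarith [(p k).coe_nonneg]⟩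

theorem oneVisitValue_le_indexValue {r : Fin n → ℝ≥0 → ℝ} (hr : A.IsThreshold c r)
    (p : Fin n → ℝ≥0) : oneVisitValue μ c p ≤
      indexValue p (A.conjecture p) (fun j => r j (p j) - p j) [] 0 := by
  refine (Finset.fold_max_le _).2 ⟨indexValue_nonneg _ _, fun k _ => ?_⟩
  have := le_indexValue_nil (hr.isIndex p) k
  rwa [show ∫ x, x ∂A.conjecture p k = μ from (A.belief k (p k)).2.2.2] at this

theorem sum_sale_le_oneVisitValue (ω : Fin n → ℝ≥0 × ℝ) :
    ∑ i, A.sale i ω * (μ - c - (ω i).1) ≤ oneVisitValue μ c fun j => (ω j).1 := by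
  set m := oneVisitValue μ c fun j => (ω j).1
  calc ∑ i, A.sale i ω * (μ - c - (ω i).1) ≤ ∑ i, A.sale i ω * m :=
        Finset.sum_le_sum fun i _ => mul_le_mul_of_nonneg_left
          (le_oneVisitValue (fun j => (ω j).1) i) (sale_nonneg i ω)
    _ = (∑ i, A.sale i ω) * m := (Finset.sum_mul _ _ _).symm
    _ ≤ m := mul_le_of_le_one_left (oneVisitValue_nonneg _) (sum_sale_le_one ω)

/-- If prices are positive, then search is worth no more than one visit to a cheapest firm, and only
cheapest firms sell. -/
theorem sales_efficient (hA : A.IsEquilibrium c) (hμ : μ < 1) (hc : 0 < c)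
    (hcμ : c ≤ μ) (hpos : ∀ᵐ q ∂A.priceLaw, 0 < q) {r : Fin n → ℝ≥0 → ℝ}
    (hr : A.IsThreshold c r) :
    (∀ᵐ p ∂(Measure.pi fun _ : Fin n => A.priceLaw),
      indexValue p (A.conjecture p) (fun j => r j (p j) - p j) [] 0 ≤ oneVisitValue μ c p) ∧
    ∀ᵐ ω ∂(Measure.pi fun _ : Fin n => A.law), ∀ i, 0 < A.sale i ω →
      ((ω i).1 : ℝ) ≤ μ - c ∧ ∀ k, (ω i).1 ≤ (ω k).1 := by
  set Lω := Measure.pi fun _ : Fin n => A.law with hLω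
  set Gn := Measure.pi fun _ : Fin n => A.priceLaw with hGn
  set K := piKernel (κ := fun i q => (A.belief i q).1) measurable_conjecture with hK
  -- Prices are drawn first and posteriors then from the conjectures, so the inner integral at given
  -- prices is the expectation the consumer forms.
  have hdis : Lω = (Gn ⊗ₘ K).map fun a => fun i => (a.1 i, a.2 i) :=
    pi_eq_map_compProd A.priceLaw measurable_conjecture (fun _ => A.law) (lintegral_law hA)
  set f : (Fin n → ℝ≥0 × ℝ) → ℝ := fun ω => ∑ i, A.sale i ω * ((ω i).2 - (ω i).1 - c) with hf
  set J : (Fin n → ℝ≥0 × ℝ) → ℝ := fun ω => ∑ i, A.sale i ω * (μ - c - (ω i).1) with hJ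
  have hfm : Measurable f := Finset.measurable_sum _ fun i _ => (measurable_sale i).mul (by fun_prop)
  have hJm : Measurable J := Finset.measurable_sum _ fun i _ => (measurable_sale i).mul (by fun_prop)
  -- Prices need not be bounded a priori, but where a sale occurs the price is at most the
  -- posterior. This bounds the integrands.
  have hprice : ∀ ω : Fin n → ℝ≥0 × ℝ, (∀ j, (ω j).2 ∈ Icc (0 : ℝ) 1) → ∀ i (t C : ℝ),
      (((ω i).1 : ℝ) ≤ (ω i).2 → |t| ≤ C) → 0 ≤ C → |A.sale i ω * t| ≤ C := by
    intro ω hω i t C h hC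
    rw [abs_mul, abs_of_nonneg (sale_nonneg i ω)]
    rcases (sale_nonneg (A := A) i ω).eq_or_lt with h0 | h0
    · rw [← h0]; simpa using hC
    · exact (mul_le_of_le_one_left (abs_nonneg t) (sale_le_one i ω)).trans
        (h (price_le_of_sale_pos hA hc.le hω h0))
  have hfi : Integrable f Lω := integrable_of_sale_bound hfm (C := ∑ _ : Fin n, (1 + c))
    fun ω hω => (Finset.abs_sum_le_sum_abs _ _).trans <| Finset.sum_le_sum fun i _ =>
      hprice ω hω i _ _ (fun h => abs_le.2 (by
        have := hω i; have := (ω i).1.coe_nonneg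
        constructor <;> linarith [this, (hω i).1, (hω i).2])) (by linarith)
  have hJi : Integrable J Lω := integrable_of_sale_bound hJm (C := ∑ _ : Fin n, (1 + c))
    fun ω hω => (Finset.abs_sum_le_sum_abs _ _).trans <| Finset.sum_le_sum fun i _ =>
      hprice ω hω i _ _ (fun h => abs_le.2 (by
        have := (ω i).1.coe_nonneg
        constructor <;> linarith [(hω i).1, (hω i).2])) (by linarith)
  have hfJ : ∫ ω, f ω ∂Lω = ∫ ω, J ω ∂Lω := by
    have hs : ∀ i, Integrable (A.sale i) Lω := fun i =>
      integrable_of_sale_bound (measurable_sale i) (C := 1) fun ω hω => by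
        simpa using hprice ω hω i 1 1 (by simp) zero_le_one
    have hxs : ∀ i, Integrable (fun ω => (ω i).2 * A.sale i ω) Lω := fun i =>
      integrable_of_sale_bound ((measurable_snd.comp (measurable_pi_apply i)).mul
        (measurable_sale i)) (C := 1) fun ω hω => by
          rw [mul_comm]
          exact hprice ω hω i _ 1 (fun _ => abs_le.2 (by
            constructor <;> linarith [(hω i).1, (hω i).2])) zero_le_one
    rw [← sub_eq_zero, ← integral_sub hfi hJi]
    have : ∀ ω, f ω - J ω = ∑ i, ((ω i).2 * A.sale i ω - μ * A.sale i ω) := fun ω => by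
      simp only [hf, hJ]
      rw [← Finset.sum_sub_distrib]
      exact Finset.sum_congr rfl fun i _ => by ring
    simp only [this]
    have hd : ∀ i ∈ Finset.univ, Integrable (fun ω => (ω i).2 * A.sale i ω - μ * A.sale i ω) Lω :=
      fun i _ => (hxs i).sub ((hs i).const_mul μ)
    rw [integral_finsetSum _ hd]
    refine Finset.sum_eq_zero fun i _ => ?_
    rw [integral_sub (hxs i) ((hs i).const_mul μ), integral_const_mul,
      integral_posterior_mul_sale hA hμ hc hcμ hpos i, sub_self]
  have hfc : Integrable (fun a : (Fin n → ℝ≥0) × (Fin n → ℝ) => f fun i => (a.1 i, a.2 i))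
      (Gn ⊗ₘ K) := by
    rw [hdis] at hfi
    exact (integrable_map_measure hfm.aestronglyMeasurable measurable_zip.aemeasurable).1 hfi
  set I : (Fin n → ℝ≥0) → ℝ := fun p => ∫ y, f (fun i => (p i, y i)) ∂K p with hI
  have hIi : Integrable I Gn := Integrable.integral_compProd hfc
  have hfI : ∫ ω, f ω ∂Lω = ∫ p, I p ∂Gn := by
    conv_lhs => rw [hdis]
    rw [integral_map measurable_zip.aemeasurable hfm.aestronglyMeasurable,
      Measure.integral_compProd hfc]
  set m := oneVisitValue (n := n) μ c with hm
  have hmm : Measurable m := measurable_oneVisitValue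
  have hmb : ∀ p, |m p| ≤ μ - c := fun p => by
    rw [abs_of_nonneg (oneVisitValue_nonneg p)]; exact oneVisitValue_le hcμ p
  have hmi : Integrable m Gn := Integrable.of_bound hmm.aestronglyMeasurable _
    (Filter.Eventually.of_forall hmb)
  have hfst : Measurable fun (ω : Fin n → ℝ≥0 × ℝ) (j : Fin n) => (ω j).1 := by fun_prop
  have hmi' : Integrable (fun ω : Fin n → ℝ≥0 × ℝ => m fun j => (ω j).1) Lω :=
    Integrable.of_bound (hmm.comp hfst).aestronglyMeasurable _
      (Filter.Eventually.of_forall fun ω => hmb _)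
  have hmL : ∫ ω, m (fun j => (ω j).1) ∂Lω = ∫ p, m p ∂Gn := by
    have : Lω.map (fun ω j => (ω j).1) = Gn := by
      have h1 : ∀ _ : Fin n, IsProbabilityMeasure (A.law.map Prod.fst) := fun _ => by
        rw [law_fst]; infer_instance
      rw [hLω, Measure.pi_map_pi (f := fun (_ : Fin n) (a : ℝ≥0 × ℝ) => a.1)
        fun _ => measurable_fst.aemeasurable]
      simp only [hGn, law_fst]
    rw [← this, integral_map hfst.aemeasurable hmm.aestronglyMeasurable]
  have hΦ := fun p => oneVisitValue_le_indexValue hr p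
  have hΦI : ∀ p, indexValue p (A.conjecture p) (fun j => r j (p j) - p j) [] 0 ≤ I p := fun p =>
    indexValue_nil_le (hr.isIndex p) hc.le (hA.consumer_optimal p)
  have hJle : ∀ ω, J ω ≤ m fun j => (ω j).1 := sum_sale_le_oneVisitValue
  have hJm' : ∫ ω, J ω ∂Lω ≤ ∫ p, m p ∂Gn := by
    rw [← hmL]; exact integral_mono hJi hmi' hJle
  -- The chain `∫ I = ∫ f = ∫ J ≤ ∫ m ≤ ∫ I` collapses. The index value lies pointwise between `m`
  -- and `I`, so it need not be measurable in the prices.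
  have hmI : ∫ p, m p ∂Gn ≤ ∫ p, I p ∂Gn := integral_mono hmi hIi fun p => (hΦ p).trans (hΦI p)
  constructor
  · have h0 : ∫ p, (I p - m p) ∂Gn = 0 := by rw [integral_sub hIi hmi]; linarith
    have h1 := (integral_eq_zero_iff_of_nonneg (f := fun p => I p - m p)
      (fun p => sub_nonneg.2 ((hΦ p).trans (hΦI p))) (hIi.sub hmi)).1 h0
    filter_upwards [h1] with p hp
    have : I p - m p = 0 := hp
    linarith [hΦI p]
  · have h0 : ∫ ω, (m (fun j => (ω j).1) - J ω) ∂Lω = 0 := by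
      rw [integral_sub hmi' hJi, hmL]; linarith
    have h1 := (integral_eq_zero_iff_of_nonneg (f := fun ω => m (fun j => (ω j).1) - J ω)
      (fun ω => sub_nonneg.2 (hJle ω)) (hmi'.sub hJi)).1 h0
    filter_upwards [h1] with ω hω i hi
    have hω' : m (fun j => (ω j).1) - J ω = 0 := hω
    set M := m (fun j => (ω j).1) with hM
    have hM0 : 0 ≤ M := oneVisitValue_nonneg _
    have hterm : ∀ k ∈ Finset.univ, 0 ≤ A.sale k ω * (M - (μ - c - (ω k).1)) := fun k _ =>
      mul_nonneg (sale_nonneg k ω) (sub_nonneg.2 (le_oneVisitValue (fun j => (ω j).1) k))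
    have hsum : ∑ k, A.sale k ω * (M - (μ - c - (ω k).1)) = 0 := by
      refine le_antisymm ?_ (Finset.sum_nonneg hterm)
      simp only [mul_sub (A.sale _ ω) M, Finset.sum_sub_distrib, ← Finset.sum_mul]
      have := mul_le_of_le_one_left hM0 (sum_sale_le_one (A := A) ω)
      change (∑ k, A.sale k ω) * M - J ω ≤ 0
      linarith
    have := (Finset.sum_eq_zero_iff_of_nonneg hterm).1 hsum i (Finset.mem_univ i)
    have hMi : M = μ - c - (ω i).1 := by
      rcases mul_eq_zero.1 this with h | h <;> linarith
    refine ⟨by linarith, fun k => ?_⟩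
    have := le_oneVisitValue (μ := μ) (c := c) (fun j => (ω j).1) k
    have : ((ω i).1 : ℝ) ≤ (ω k).1 := by
      change μ - c - ((ω k).1 : ℝ) ≤ M at this
      linarith
    exact_mod_cast this

end Efficiency

/-! ### Undercutting at the highest price excludes profits. -/

section ZeroProfit

variable {n : ℕ} {μ c : ℝ} {A : Assessment n μ} {r : Fin n → ℝ≥0 → ℝ}

theorem of_ae_of_atom {α : Type*} [MeasurableSpace α] {m : Measure α} {P : α → Prop} {t : α}
    (h : ∀ᵐ a ∂m, P a) (ht : m {t} ≠ 0) : P t := by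
  by_contra hcon
  exact ht (measure_mono_null (fun a ha => by rw [mem_singleton_iff.1 ha]; exact hcon) (ae_iff.1 h))

theorem law_preimage (s : Set ℝ≥0) (hs : MeasurableSet s) :
    A.law (Prod.fst ⁻¹' s) = A.priceLaw s := by
  rw [← law_fst, Measure.map_apply measurable_fst hs]

/-- The conjectures at an atom of the price distribution agree. -/
theorem conjecture_eq_of_atom (hA : A.IsEquilibrium c) {t : ℝ≥0} (ht : A.priceLaw {t} ≠ 0)
    (i j : Fin n) : (A.belief i t).1 = (A.belief j t).1 := by
  have h : ∀ i, ∀ s, MeasurableSet s →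
      A.law ({t} ×ˢ s) = (A.belief i t).1 s * A.priceLaw {t} := fun i s hs => by
    have hm : MeasurableSet (({t} : Set ℝ≥0) ×ˢ s) := (measurableSet_singleton t).prod hs
    rw [← lintegral_indicator_one hm, lintegral_law hA i _ (measurable_one.indicator hm)]
    have e : ∀ q, ∫⁻ x, (({t} : Set ℝ≥0) ×ˢ s).indicator (1 : ℝ≥0 × ℝ → ℝ≥0∞) (q, x)
        ∂(A.belief i q).1 = ({t} : Set ℝ≥0).indicator (fun _ => (A.belief i t).1 s) q := by
      intro q
      by_cases hq : q = t
      · subst hq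
        have : ∀ x, (({q} : Set ℝ≥0) ×ˢ s).indicator (1 : ℝ≥0 × ℝ → ℝ≥0∞) (q, x) =
            s.indicator 1 x := fun x => by by_cases hx : x ∈ s <;> simp [hx]
        simp [this, lintegral_indicator_one hs]
      · simp [indicator, hq]
    simp only [e]
    rw [lintegral_indicator (measurableSet_singleton t)]
    simp
  ext s hs
  have := (h i s hs).symm.trans (h j s hs)
  exact (ENNReal.mul_left_inj ht (measure_ne_top _ _)).1 this

/-- If search is worth no more than one visit although all prices and signals are the same, then
the signals are useless. -/
theorem threshold_eq_of_atom (hA : A.IsEquilibrium c) (hn : 2 ≤ n) (hc : 0 < c)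
    (hr : A.IsThreshold c r) {t : ℝ≥0} (ht : A.priceLaw {t} ≠ 0)
    (hΦ : indexValue (fun _ => t) (A.conjecture fun _ => t) (fun j => r j t - t) [] 0 ≤ μ - c - t)
    (l : Fin n) : r l t = μ - c := by
  have : Nontrivial (Fin n) := Fin.nontrivial_iff_two_le.2 hn
  obtain ⟨k, hk⟩ := exists_ne l
  set p : Fin n → ℝ≥0 := fun _ => t with hp
  have h : IsIndex c p (A.conjecture p) fun j => r j t - t := hr.isIndex p
  have hB : A.conjecture p k = (A.belief l t).1 := conjecture_eq_of_atom hA ht k l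
  have hmem := (A.belief l t).ae_mem
  have h1 := visit_le_indexValue h (v := []) (i := k) (by simp) 0
  have hi := integrable_indexValue_update h [] k 0
  have hi' : Integrable (fun z => z - (t : ℝ)) (A.belief l t).1 :=
    (integrable_id_unit hmem).sub (integrable_const _)
  rw [hB] at h1 hi
  have hle : ∀ z, z - t ≤ indexValue p (A.conjecture p) (fun j => r j t - t) [k]
      (Function.update 0 k z) := fun z => by
    have := (le_stopPayoff (p := p) (v := [k]) (j := k) (by simp) (Function.update 0 k z)).trans
      (stopPayoff_le_indexValue h _ _)
    simpa [hp] using this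
  have hint : ∫ z, (z - (t : ℝ)) ∂(A.belief l t).1 = μ - t := by
    rw [integral_sub (integrable_id_unit hmem) (integrable_const _), (A.belief l t).2.2.2]
    simp
  have h0 : ∫ z, (indexValue p (A.conjecture p) (fun j => r j t - t) [k]
      (Function.update 0 k z) - (z - t)) ∂(A.belief l t).1 = 0 := by
    refine le_antisymm ?_ (integral_nonneg fun z => sub_nonneg.2 (hle z))
    rw [integral_sub hi hi', hint]
    linarith
  have h2 := (integral_eq_zero_iff_of_nonneg (f := fun z => indexValue p (A.conjecture p)
    (fun j => r j t - t) [k] (Function.update 0 k z) - (z - t))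
    (fun z => sub_nonneg.2 (hle z)) (hi.sub hi')).1 h0
  -- The hypothesis leaves no gain from continuing after a visit to `k`. A posterior below the
  -- common threshold would make a visit to `l` strictly worthwhile.
  have h3 : ∀ᵐ z ∂(A.belief l t).1, r l t ≤ z := by
    filter_upwards [h2] with z hz
    have hz' : indexValue p (A.conjecture p) (fun j => r j t - t) [k] (Function.update 0 k z) -
      (z - t) = 0 := hz
    by_contra hlt
    have hs := stopPayoff_le_indexValue h [k] (Function.update 0 k z)
    have := stopPayoff_lt_of_lt h hc (v := [k]) (x := Function.update 0 k z) (k := l)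
      (by simpa using hk.symm) (by linarith)
    have hs' := le_stopPayoff (p := p) (v := [k]) (j := k) (by simp) (Function.update 0 k z)
    simp only [Function.update_self, hp] at hs'
    linarith
  have h4 := excess_of_ae_le hmem h3
  rw [hr l t, (A.belief l t).2.2.2] at h4
  linarith

/-- Against rivals that charge `t` and whose signals are useless, a firm that undercuts and gives no
information sells for sure. -/
theorem le_demand_of_undercut (hA : A.IsEquilibrium c) (hμ : μ ∈ Ioo (0 : ℝ) 1) (hc : 0 < c)
    (hr : A.IsThreshold c r) {t q : ℝ≥0} (ht : (t : ℝ) ≤ μ - c) (hq : q < t)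
    (hrt : ∀ k, r k t = μ - c) (i : Fin n) :
    A.priceLaw {t} ^ (n - 1) ≤ A.demand i (q, μ) := by
  have hqt : (q : ℝ) < t := by exact_mod_cast hq
  set s : Fin n → Set (ℝ≥0 × ℝ) := fun k => if k = i then univ else Prod.fst ⁻¹' {t} with hs
  have hms : MeasurableSet (univ.pi s) := MeasurableSet.univ_pi fun k => by
    simp only [hs]; split_ifs
    exacts [MeasurableSet.univ, measurable_fst (measurableSet_singleton t)]
  have hsμ : Measure.pi (fun _ : Fin n => A.law) (univ.pi s) = A.priceLaw {t} ^ (n - 1) := by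
    rw [Measure.pi_pi, ← Finset.mul_prod_erase _ _ (Finset.mem_univ i)]
    rw [Finset.prod_congr rfl (g := fun _ => A.priceLaw {t}) fun k hk => by
      simp only [hs, Finset.ne_of_mem_erase hk, if_false]
      exact law_preimage _ (measurableSet_singleton t)]
    simp [hs, Finset.card_erase_of_mem]
  rw [← hsμ, ← lintegral_indicator_one hms]
  refine lintegral_mono_ae ?_
  filter_upwards [ae_mem_unit (A := A)] with ω hω
  by_cases hmem : ω ∈ univ.pi s
  · have hk : ∀ k, k ≠ i → (ω k).1 = t := fun k hk => by
      have := hmem k (mem_univ k)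
      simpa [hs, hk] using this
    have hone : A.sale i (Function.update ω i (q, μ)) = 1 := by
      unfold Assessment.sale
      refine buyProb_eq_one (hr.isIndex _) hc (hA.consumer_optimal _)
        (x := fun j => (Function.update ω i (q, μ) j).2)
        (update_snd_mem hω i ⟨hμ.1.le, hμ.2.le⟩) ?_ ?_ fun k hki => ?_
      · have := hr.le i q
        simp only [Function.update_self]
        linarith
      · simp only [Function.update_self]
        linarith
      · have := hr.le i q
        simp only [Function.update_self, Function.update_of_ne hki, hk k hki, hrt k]
        constructor <;> linarith
    simp [hone, hmem]
  · simp [hmem]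

/-- Sales at a highest price `t` take place only if all firms charge `t`. -/
theorem sum_profit_le (hA : A.IsEquilibrium c) (hc : 0 ≤ c) {t : ℝ≥0} (ht : A.priceLaw {t} ≠ 0)
    (hmax : ∀ᵐ q ∂A.priceLaw, q ≤ t)
    (heff : ∀ᵐ ω ∂(Measure.pi fun _ : Fin n => A.law), ∀ i, 0 < A.sale i ω →
      ((ω i).1 : ℝ) ≤ μ - c ∧ ∀ k, (ω i).1 ≤ (ω k).1) :
    ∑ i, A.priceLaw {t} * A.eqProfit i ≤ t * A.priceLaw {t} ^ n := by
  set E : Set (Fin n → ℝ≥0 × ℝ) := univ.pi fun _ => Prod.fst ⁻¹' {t} with hE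
  have hEm : MeasurableSet E :=
    MeasurableSet.univ_pi fun _ => measurable_fst (measurableSet_singleton t)
  have hEμ : Measure.pi (fun _ : Fin n => A.law) E = A.priceLaw {t} ^ n := by
    rw [hE, Measure.pi_pi]
    simp [law_preimage {t} (measurableSet_singleton t)]
  have hmax' := ae_pi_of_ae (fun _ : Fin n => A.law) fun _ => ae_law_of_ae_price hmax
  have hsm : ∀ i, Measurable fun ω => E.indicator 1 ω * ENNReal.ofReal (A.sale i ω) := fun i =>
    (measurable_one.indicator hEm).mul (measurable_sale i).ennreal_ofReal
  have key : ∀ i, A.priceLaw {t} * A.eqProfit i ≤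
      t * ∫⁻ ω, E.indicator 1 ω * ENNReal.ofReal (A.sale i ω)
        ∂(Measure.pi fun _ : Fin n => A.law) := by
    intro i
    have hprofit := of_ae_of_atom (ae_profit_eq hA hc i) ht
    set f : ℝ≥0 × ℝ → ℝ≥0∞ := fun a => ({t} : Set ℝ≥0).indicator (fun q => (q : ℝ≥0∞)) a.1 with hf
    have hfm : Measurable f :=
      (measurable_coe_nnreal_ennreal.indicator (measurableSet_singleton t)).comp measurable_fst
    have e1 := lintegral_sale_mul_law (A := A) i hfm
    have e2 : ∫⁻ a, f a * A.demand i a ∂A.law = A.priceLaw {t} * A.eqProfit i := by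
      rw [lintegral_law hA i (fun a => f a * A.demand i a) (hfm.mul (measurable_demand i))]
      have : ∀ q, ∫⁻ x, f (q, x) * A.demand i (q, x) ∂(A.belief i q).1 =
          ({t} : Set ℝ≥0).indicator (fun _ => A.eqProfit i) q := by
        intro q
        by_cases hq : q = t
        · subst hq
          simp only [hf, mem_singleton_iff, indicator_of_mem]
          rw [lintegral_const_mul _ (measurable_demand_mk i q), hprofit]
        · simp [hf, indicator, hq]
      simp only [this]
      rw [lintegral_indicator (measurableSet_singleton t)]
      simp [mul_comm]
    rw [← e2, ← e1, ← lintegral_const_mul _ (hsm i)]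
    refine lintegral_mono_ae ?_
    filter_upwards [heff, hmax'] with ω h1 h2
    rcases (sale_nonneg (A := A) i ω).eq_or_lt with h0 | hpos
    · simp [← h0]
    by_cases hi : (ω i).1 = t
    · have hω : ω ∈ E := fun k _ =>
        le_antisymm (h2 k) (hi ▸ ((h1 i hpos).2 k))
      simp [hf, hi, hω]
    · simp [hf, indicator, hi]
  calc ∑ i, A.priceLaw {t} * A.eqProfit i ≤ ∑ i, t * ∫⁻ ω, E.indicator 1 ω *
        ENNReal.ofReal (A.sale i ω) ∂(Measure.pi fun _ : Fin n => A.law) :=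
        Finset.sum_le_sum fun i _ => key i
    _ = t * ∫⁻ ω, ∑ i, E.indicator 1 ω * ENNReal.ofReal (A.sale i ω)
        ∂(Measure.pi fun _ : Fin n => A.law) := by
        rw [← Finset.mul_sum, lintegral_finsetSum _ fun i _ => hsm i]
    _ ≤ t * ∫⁻ ω, E.indicator 1 ω ∂(Measure.pi fun _ : Fin n => A.law) := by
        refine mul_le_mul_right (lintegral_mono fun ω => ?_) _
        rw [← Finset.mul_sum, ← ENNReal.ofReal_sum_of_nonneg fun i _ => sale_nonneg i ω]
        exact mul_le_of_le_one_right' (ENNReal.ofReal_le_one.2 (sum_sale_le_one ω))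
    _ = t * A.priceLaw {t} ^ n := by rw [lintegral_indicator_one hEm, hEμ]

/-- If a firm makes profits, then prices are positive and have an atom at their maximum. -/
theorem exists_top_price (hA : A.IsEquilibrium c) (hn : 2 ≤ n) (hc : 0 ≤ c) (hcμ : c ≤ μ)
    (heff : ∀ᵐ ω ∂(Measure.pi fun _ : Fin n => A.law), ∀ i, 0 < A.sale i ω →
      ((ω i).1 : ℝ) ≤ μ - c ∧ ∀ k, (ω i).1 ≤ (ω k).1) {i : Fin n} (hi : A.eqProfit i ≠ 0) :
    ∃ t : ℝ≥0, (t : ℝ) ≤ μ - c ∧ A.priceLaw {t} ≠ 0 ∧ ∀ᵐ q ∂A.priceLaw, q ≤ t := by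
  have : Nontrivial (Fin n) := Fin.nontrivial_iff_two_le.2 hn
  obtain ⟨k, hk⟩ := exists_ne i
  set M : ℝ≥0 := ⟨μ - c, by linarith⟩ with hM
  have hGm : Measurable fun q : ℝ≥0 => A.priceLaw (Ici q) :=
    Antitone.measurable fun a b hab => measure_mono (Ici_subset_Ici.2 hab)
  have h1 : ∀ᵐ a ∂A.law, A.demand i a ≤ A.priceLaw (Ici a.1) ∧ (A.demand i a ≠ 0 → a.1 ≤ M) := by
    filter_upwards [ae_update_of_ae (fun _ : Fin n => A.law) i heff] with a ha
    constructor
    · have hm : MeasurableSet (Function.eval k ⁻¹' (Prod.fst ⁻¹' Ici a.1) :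
          Set (Fin n → ℝ≥0 × ℝ)) := (measurable_pi_apply k) (measurable_fst measurableSet_Ici)
      rw [← law_preimage (A := A) (Ici a.1) measurableSet_Ici,
        ← (measurePreserving_eval (fun _ : Fin n => A.law) k).measure_preimage
          (measurable_fst measurableSet_Ici).nullMeasurableSet, ← lintegral_indicator_one hm]
      refine lintegral_mono_ae ?_
      filter_upwards [ha] with ω hω
      rcases (sale_nonneg (A := A) i (Function.update ω i a)).eq_or_lt with h0 | hpos
      · simp [← h0]
      · have := (hω i hpos).2 k
        simp only [Function.update_self, Function.update_of_ne hk] at this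
        rw [indicator_of_mem (show ω ∈ Function.eval k ⁻¹' (Prod.fst ⁻¹' Ici a.1) from this)]
        exact ENNReal.ofReal_le_one.2 (sale_le_one i _)
    · intro hne
      by_contra hlt
      refine hne (lintegral_eq_zero_of_ae_eq_zero ?_)
      filter_upwards [ha] with ω hω
      rcases (sale_nonneg (A := A) i (Function.update ω i a)).eq_or_lt with h0 | hpos
      · simp [← h0]
      · have := (hω i hpos).1
        simp only [Function.update_self] at this
        exact absurd (NNReal.coe_le_coe.1 this) hlt
  have hmeas : MeasurableSet {a : ℝ≥0 × ℝ | A.demand i a ≤ A.priceLaw (Ici a.1) ∧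
      (A.demand i a ≠ 0 → a.1 ≤ M)} :=
    (measurableSet_le (measurable_demand i) (hGm.comp measurable_fst)).inter
      ((measurable_demand i (measurableSet_singleton 0)).compl.imp
        (measurable_fst measurableSet_Iic))
  have h2 := ae_law hA i hmeas h1
  -- At a price `q` a sale requires rival `k` to charge at least `q`, so the profit is at most `M`
  -- times the tail at `q`. This bounds the tail from below.
  have hδ : 0 < A.eqProfit i / M := ENNReal.div_pos hi ENNReal.coe_ne_top
  obtain ⟨t, htM, ht⟩ := exists_top_atom A.priceLaw hδ (M := M) (by
    filter_upwards [h2, ae_profit_eq hA hc i] with q hq hprofit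
    have hqM : q ≤ M := by
      by_contra hlt
      refine hi ?_
      rw [← hprofit, lintegral_eq_zero_of_ae_eq_zero, mul_zero]
      filter_upwards [hq] with x hx
      by_contra hne
      exact hlt (hx.2 hne)
    refine ⟨hqM, ENNReal.div_le_of_le_mul' ?_⟩
    rw [← hprofit]
    refine mul_le_mul' (by exact_mod_cast hqM) ?_
    calc ∫⁻ x, A.demand i (q, x) ∂(A.belief i q).1 ≤
        ∫⁻ _, A.priceLaw (Ici q) ∂(A.belief i q).1 := by
          refine lintegral_mono_ae ?_
          filter_upwards [hq] with x hx using hx.1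
      _ = A.priceLaw (Ici q) := by simp)
  exact ⟨t, by exact_mod_cast htM, ht⟩

/-- No firm makes profits. -/
theorem eqProfit_eq_zero (hA : A.IsEquilibrium c) (hn : 2 ≤ n) (hμ : μ ∈ Ioo (0 : ℝ) 1)
    (hc : 0 < c) (hcμ : c < μ) (i : Fin n) : A.eqProfit i = 0 := by
  by_contra hi
  obtain ⟨r, hr⟩ := exists_isThreshold A hc.le
  have hpos : ∀ᵐ q ∂A.priceLaw, 0 < q := by
    filter_upwards [ae_profit_eq hA hc.le i] with q hq
    refine pos_of_ne_zero fun h0 => hi ?_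
    rw [← hq, h0]; simp
  obtain ⟨hval, heff⟩ := sales_efficient hA hμ.2 hc hcμ.le hpos hr
  obtain ⟨t, htμ, ht, hmax⟩ := exists_top_price hA hn hc.le hcμ.le heff hi
  have ht0 : 0 < t := of_ae_of_atom hpos ht
  have ht0' : (0 : ℝ) < t := by exact_mod_cast ht0
  have hΦ : indexValue (fun _ => t) (A.conjecture fun _ => t) (fun j => r j t - t) [] 0 ≤
      μ - c - t := by
    have hne : Measure.pi (fun _ : Fin n => A.priceLaw) {fun _ => t} ≠ 0 := by
      rw [Measure.pi_singleton]
      simpa using fun h => absurd h ht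
    refine (of_ae_of_atom hval hne).trans ((Finset.fold_max_le _).2 ⟨by linarith, fun k _ => ?_⟩)
    exact le_rfl
  have hrt := threshold_eq_of_atom hA hn hc hr ht hΦ
  -- A factor below `1` undercuts, and one above `1 / n` gives the contradiction `n * (3 / 4) ≤ 1`;
  -- as `n ≥ 2`, the factor `3 / 4` does both.
  have hq : t * (3 / 4) < t := mul_lt_of_lt_one_right ht0 (by
    rw [div_lt_one (by norm_num)]; norm_num)
  have hdev : ∀ j, ((t * (3 / 4) : ℝ≥0) : ℝ≥0∞) * A.priceLaw {t} ^ (n - 1) ≤ A.eqProfit j := by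
    intro j
    have hd := deviation_le hA j (t * (3 / 4)) (Signal.point ⟨hμ.1.le, hμ.2.le⟩)
    refine le_trans (mul_le_mul_right ?_ _) hd
    change _ ≤ ∫⁻ x, A.demand j (t * (3 / 4), x) ∂Measure.dirac μ
    rw [lintegral_dirac' _ (measurable_demand_mk j _)]
    exact le_demand_of_undercut hA hμ hc hr htμ hq hrt j
  have hsum := sum_profit_le hA hc.le ht hmax heff
  set g := A.priceLaw {t} with hg
  have hlow : ∑ _ : Fin n, g * (((t * (3 / 4) : ℝ≥0) : ℝ≥0∞) * g ^ (n - 1)) ≤ t * g ^ n :=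
    (Finset.sum_le_sum fun j _ => mul_le_mul_right (hdev j) g).trans hsum
  have hgt : g ≠ ∞ := measure_ne_top _ _
  have hR := ENNReal.toReal_mono (ENNReal.mul_ne_top ENNReal.coe_ne_top (ENNReal.pow_ne_top hgt))
    hlow
  have hg0 : 0 < g.toReal := ENNReal.toReal_pos ht hgt
  have hgn : g.toReal * g.toReal ^ (n - 1) = g.toReal ^ n := by
    rw [← pow_succ']; congr 1; omega
  have hX : 0 < (t : ℝ) * g.toReal ^ n := by positivity
  have hn' : (2 : ℝ) ≤ n := by exact_mod_cast hn
  simp only [Finset.sum_const, Finset.card_univ, Fintype.card_fin, nsmul_eq_mul,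
    ENNReal.toReal_mul, ENNReal.toReal_natCast, ENNReal.toReal_pow, ENNReal.coe_toReal,
    NNReal.coe_mul, NNReal.coe_div, NNReal.coe_ofNat] at hR
  rw [show (n : ℝ) * (g.toReal * ((t : ℝ) * (3 / 4) * g.toReal ^ (n - 1))) =
    n * (3 / 4) * (t * (g.toReal * g.toReal ^ (n - 1))) by ring, hgn] at hR
  nlinarith

end ZeroProfit

/-! ### From zero profits to zero prices and useless information. -/

section Uniqueness

variable {n : ℕ} {μ c : ℝ} {A : Assessment n μ} {r : Fin n → ℝ≥0 → ℝ}

/-- If some rival is in a given set almost surely, then the set has full measure for one of them. -/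
theorem exists_ae_of_ae_exists {ι : Type*} [Fintype ι] [DecidableEq ι] {α : ι → Type*}
    [∀ j, MeasurableSpace (α j)] (L : ∀ j, Measure (α j)) [∀ j, IsProbabilityMeasure (L j)] (i : ι)
    {P : ∀ j, α j → Prop} (h : ∀ᵐ ω ∂Measure.pi L, ∃ k, k ≠ i ∧ P k (ω k)) :
    ∃ k, k ≠ i ∧ ∀ᵐ a ∂L k, P k a := by
  -- The exceptional event is a box, whose measure is a product, so some factor vanishes.
  -- `Measure.pi_pi` holds for arbitrary sets, which matters because the thresholds inside `P` need
  -- not be measurable.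
  have h0 : Measure.pi L (univ.pi fun k => if k = i then univ else {a | ¬ P k a}) = 0 := by
    refine measure_mono_null (fun ω hω => ?_) (ae_iff.1 h)
    rintro ⟨k, hk, hP⟩
    have hmem : ω k ∈ (if k = i then univ else {a | ¬ P k a}) := hω k (mem_univ k)
    rw [if_neg hk] at hmem
    exact hmem hP
  rw [Measure.pi_pi, Finset.prod_eq_zero_iff] at h0
  obtain ⟨k, -, hk⟩ := h0
  split_ifs at hk with hki
  · simp at hk
  · exact ⟨k, hki, ae_iff.2 hk⟩

/-- The witness may change with `m`, but there are finitely many candidates: were all of them below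
`a`, some `q m` would be smaller than every gap. -/
theorem exists_ge_of_forall_sub {ι : Type*} [Finite ι] {i : ι} {f : ι → ℝ} {a : ℝ} {q : ℕ → ℝ}
    (hq : Filter.Tendsto q Filter.atTop (nhds 0)) (h : ∀ m, ∃ k, k ≠ i ∧ a - q m ≤ f k) :
    ∃ k, k ≠ i ∧ a ≤ f k := by
  by_contra hcon
  push Not at hcon
  have : ∀ᶠ m in Filter.atTop, ∀ k, k ≠ i → q m < a - f k := by
    refine Filter.eventually_all.2 fun k => ?_
    by_cases hk : k = i
    · exact Filter.Eventually.of_forall fun _ h => absurd hk h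
    · filter_upwards [hq.eventually_lt_const (sub_pos.2 (hcon k hk))] with m hm _ using hm
  obtain ⟨m, hm⟩ := this.exists
  obtain ⟨k, hk, hle⟩ := h m
  linarith [hm k hk]

/-- Without profits, there is no demand at a positive price even if the match is known to be good. -/
theorem demand_one_eq_zero (hA : A.IsEquilibrium c) (hμ : μ ∈ Ioo (0 : ℝ) 1) {i : Fin n}
    (h0 : A.eqProfit i = 0) {q : ℝ≥0} (hq : 0 < q) : A.demand i (q, 1) = 0 := by
  -- `H` is the fully revealing signal, with mass `μ` at `1` and `1 - μ` at `0`. A deviation to it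
  -- would be profitable if posterior `1` ever sold.
  obtain ⟨H, hH⟩ := Signal.exists_mix (μ := μ) (Measure.dirac (0 : ℝ)) measurable_id
    (by rw [ae_dirac_eq]; simp) (w := μ) (y := 1) ⟨hμ.1.le, hμ.2.le⟩ (by simp) (by simp)
  have h := deviation_le hA i q H
  rw [h0, hH _ (measurable_demand_mk i q)] at h
  have h1 := (mul_eq_zero.1 (le_antisymm h bot_le)).resolve_left (by simpa using hq.ne')
  exact (mul_eq_zero.1 (add_eq_zero.1 h1).2).resolve_left (by simpa using hμ.1)

/-- Without profits, firms with a low price are always faced with rivals that match their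
reservation value. -/
theorem ae_exists_rival (hA : A.IsEquilibrium c) (hμ : μ ∈ Ioo (0 : ℝ) 1) (hc : 0 < c)
    (hr : A.IsThreshold c r) {i : Fin n} (h0 : A.eqProfit i = 0) {q : ℝ≥0} (hq : 0 < q)
    (hqμ : (q : ℝ) < μ - c) :
    ∀ᵐ ω ∂(Measure.pi fun _ : Fin n => A.law),
      (∃ k, k ≠ i ∧ μ - c - q ≤ (ω k).2 - (ω k).1) ∧
        ∃ k, k ≠ i ∧ μ - c - q ≤ r k (ω k).1 - (ω k).1 := by
  have hd := demand_one_eq_zero hA hμ h0 hq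
  have hm : Measurable fun ω : Fin n → ℝ≥0 × ℝ => A.sale i (Function.update ω i (q, 1)) :=
    (measurable_sale i).comp ((measurable_update_prod i).comp measurable_prodMk_left)
  rw [Assessment.demand, lintegral_eq_zero_iff hm.ennreal_ofReal] at hd
  filter_upwards [hd, ae_mem_unit (A := A)] with ω hω hmem
  have hs : A.sale i (Function.update ω i (q, 1)) = 0 :=
    le_antisymm (ENNReal.ofReal_eq_zero.1 hω) (sale_nonneg i _)
  have hx := update_snd_mem hmem i (a := (q, 1)) ⟨zero_le_one, le_rfl⟩
  have hle := hr.le i q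
  have hlt := lt_one_of_excess (A.belief i q).ae_mem hc (hr i q)
  have h := hr.isIndex fun j => (Function.update ω i (q, 1) j).1
  have hπ := hA.consumer_optimal fun j => (Function.update ω i (q, 1) j).1
  constructor
  · obtain ⟨k, hk, hk'⟩ := exists_reward_ge h hc hπ hx (i := i)
      (by simp only [Function.update_self]; linarith)
      (by simp only [Function.update_self]; linarith) [] List.nodup_nil (by simp) hs
    simp only [Function.update_self, Function.update_of_ne hk] at hk'
    exact ⟨k, hk, by linarith⟩
  · obtain ⟨k, hk, hk'⟩ := exists_index_ge h hc hπ hx (i := i)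
      (by simp only [Function.update_self]; linarith)
      (by simp only [Function.update_self]; linarith) hs
    simp only [Function.update_self, Function.update_of_ne hk] at hk'
    exact ⟨k, hk, by linarith⟩

theorem threshold_eq_of_ae_le (hc : 0 < c) (hr : A.IsThreshold c r) {i : Fin n} {q : ℝ≥0}
    (h : ∀ᵐ x ∂(A.belief i q).1, μ - c ≤ x) : r i q = μ - c := by
  refine excess_inj (A.belief i q).ae_mem hc ?_ (hr i q)
  rw [excess_of_ae_le (A.belief i q).ae_mem h, (A.belief i q).2.2.2]
  ring

/-- In equilibrium prices are zero and posteriors are at least `μ - c`. -/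
theorem ae_law_eq_zero (hA : A.IsEquilibrium c) (hn : 2 ≤ n) (hμ : μ ∈ Ioo (0 : ℝ) 1)
    (hc : 0 < c) (hcμ : c < μ) : ∀ᵐ a ∂A.law, a.1 = 0 ∧ μ - c ≤ a.2 := by
  obtain ⟨r, hr⟩ := exists_isThreshold A hc.le
  let i : Fin n := ⟨0, by omega⟩
  set M : ℝ≥0 := ⟨μ - c, by linarith⟩ with hM
  have hMpos : 0 < M := NNReal.coe_lt_coe.1 (sub_pos.2 hcμ)
  obtain ⟨q, -, hqmem, hqlim⟩ := exists_seq_strictAnti_tendsto' hMpos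
  have hqr : Filter.Tendsto (fun m => (q m : ℝ)) Filter.atTop (nhds 0) := by
    simpa using NNReal.tendsto_coe.2 hqlim
  have hall := ae_all_iff.2 fun m => ae_exists_rival hA hμ hc hr
    (eqProfit_eq_zero hA hn hμ hc hcμ i) (hqmem m).1 (by exact_mod_cast (hqmem m).2)
  -- All firms have the same law of price and posterior, so the identity of the rival is irrelevant
  -- here. For the thresholds below it is kept, because conjectures may depend on the firm.
  obtain ⟨_, -, hval⟩ := exists_ae_of_ae_exists (fun _ : Fin n => A.law) i
    (P := fun _ a => μ - c ≤ a.2 - a.1) (by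
      filter_upwards [hall] with ω hω
      exact exists_ge_of_forall_sub hqr fun m => (hω m).1)
  obtain ⟨k, -, hres⟩ := exists_ae_of_ae_exists (fun _ : Fin n => A.law) i
    (P := fun k a => μ - c ≤ r k a.1 - a.1) (by
      filter_upwards [hall] with ω hω
      exact exists_ge_of_forall_sub hqr fun m => (hω m).2)
  have hthr : ∀ᵐ q ∂A.priceLaw, r k q = μ - c := by
    filter_upwards [ae_law hA k (P := fun a => μ - c ≤ a.2 - a.1)
      (measurableSet_le (by fun_prop) (by fun_prop)) hval] with q hq
    refine threshold_eq_of_ae_le hc hr ?_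
    filter_upwards [hq] with x hx
    have := q.coe_nonneg
    linarith
  -- With the threshold equal to `μ - c`, the reservation value is `μ - c` minus the price; being at
  -- least `μ - c`, it forces the price to be zero.
  filter_upwards [hval, hres, ae_law_of_ae_price hthr] with a h1 h2 h3
  rw [h3] at h2
  have h0 := a.1.coe_nonneg
  exact ⟨NNReal.coe_eq_zero.1 (by linarith), by linarith⟩

theorem ae_firm_of_equilibrium (hA : A.IsEquilibrium c) (hn : 2 ≤ n) (hμ : μ ∈ Ioo (0 : ℝ) 1)
    (hc : 0 < c) (hcμ : c < μ) : ∀ᵐ a ∂A.firm, a.1 = 0 ∧ Useless μ c a.2.1 := by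
  have h := (ae_outcomeLaw_iff A.firm (P := fun a => a.1 = 0 ∧ μ - c ≤ a.2)
    ((measurable_fst (measurableSet_singleton 0)).inter (measurable_snd measurableSet_Ici))).1
    (ae_law_eq_zero hA hn hμ hc hcμ)
  filter_upwards [h] with a ha
  have := Signal.isProbabilityMeasure a.2
  exact ⟨ha.exists.choose_spec.1, (useless_iff _).2 (ha.mono fun _ h => h.2)⟩

theorem measurableSet_useless : MeasurableSet {F : Signal μ | Useless μ c F.1} := by
  simp only [useless_iff, ae_iff]
  exact ((Measure.measurable_coe (measurableSet_Ici (a := μ - c)).compl).comp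
    measurable_subtype_coe) (measurableSet_singleton 0)

/-- A useless signal has the reservation value `μ - c`. -/
theorem excess_of_useless {F : Signal μ} (hF : Useless μ c F.1) : excess F.1 (μ - c) = c := by
  rw [excess_of_ae_le F.ae_mem ((useless_iff F).1 hF), F.2.2.2]
  ring

theorem isReservationValue_of_useless (hc : 0 < c) {F : Signal μ} (hF : Useless μ c F.1) (U : ℝ) :
    IsReservationValue c F.1 0 U ↔ U = μ - c := by
  rw [isReservationValue_iff F.ae_mem, add_zero]
  exact ⟨fun h => excess_inj F.ae_mem hc (excess_of_useless hF) h,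
    fun h => h ▸ excess_of_useless hF⟩

/-- If all reservation values agree with the smallest reward, the first visit ends the search. -/
theorem stops_after_first_visit (hc : 0 < c) {p : Fin n → ℝ≥0} {B : Fin n → Measure ℝ}
    {U : Fin n → ℝ} {π : SearchPolicy n} (h : IsIndex c p B U)
    (hπ : SequentiallyRational c p B π) {x : Fin n → ℝ} (hx : ∀ i, x i ∈ Icc (0 : ℝ) 1) {u : ℝ}
    (hu : 0 < u) (hU : ∀ k, U k = u) {j : Fin n} (hxj : u ≤ x j - p j) :
    (∀ τ : SearchPolicy n, searchPayoff c p B τ [j] x ≤ x j - p j) ∧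
      (u < x j - p j → π.buy [j] x j = 1) ∧
      (StopsWhenIndifferent c p B π → π.buy [j] x j = 1) := by
  have hnd : [j].Nodup := List.nodup_singleton j
  have hst : stopPayoff p [j] x = x j - p j := by
    simp [stopPayoff]
    linarith
  have hΦ : indexValue p B U [j] x = x j - p j := by
    rw [indexValue_eq_stopPayoff h fun k _ => by rw [hU, hst]; exact hxj, hst]
  have hopt : ∀ τ : SearchPolicy n, searchPayoff c p B τ [j] x ≤ x j - p j := fun τ =>
    hΦ ▸ searchPayoff_le_indexValue h hc.le τ [j] hnd x
  refine ⟨hopt, fun hlt => ?_, fun htie => ?_⟩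
  · exact buy_eq_one h hc hπ hnd hx (by simp) (by linarith)
      (fun k hk hne => absurd (List.mem_singleton.1 hk) hne) fun k _ => by rw [hU]; exact hlt
  · have hv := htie [j] hnd x hx (by rwa [hst])
    have hb : ∀ k, k ≠ j → π.buy [j] x k = 0 := fun k hk => π.buy_visited _ _ _ (by simpa using hk)
    have hq : π.quit [j] x = 0 := by
      by_contra hne
      have := (optimal_actions h hc.le hπ hnd hx).2.2
        (lt_of_le_of_ne (π.quit_nonneg _ _) (Ne.symm hne))
      linarith
    have ht := π.total [j] x
    rw [Finset.sum_eq_zero fun k _ => hv k, hq,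
      Finset.sum_eq_single j (fun k _ hk => hb k hk) (by simp)] at ht
    linarith

end Uniqueness

end HiddenInfo

end

/-! ### The proposition. -/

open HiddenInfo in
theorem proposition1 {n : ℕ} (hn : 2 ≤ n) {μ c : ℝ} (hμ : μ ∈ Set.Ioo (0 : ℝ) 1)
    (hc : 0 ≤ c) (hcμ : c < μ) :
    -- existence of a symmetric equilibrium
    (∃ A : Assessment n μ, A.IsEquilibrium c) ∧
    -- every mixture over useless signals, at price zero, is played in a symmetric equilibrium
    (∀ σ : Measure (ℝ≥0 × Signal μ), IsProbabilityMeasure σ →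
      (∀ᵐ a ∂σ, a.1 = 0 ∧ Useless μ c a.2.1) →
      ∃ A : Assessment n μ, A.IsEquilibrium c ∧ A.firm = σ ∧
        (∀ i j, A.belief i = A.belief j) ∧
        ∀ p, StopsWhenIndifferent c p (A.conjecture p) (A.policy p)) ∧
    -- essential uniqueness
    (0 < c → ∀ A : Assessment n μ, A.IsEquilibrium c →
      -- prices are zero and information is useless
      (∀ᵐ a ∂A.firm, a.1 = 0 ∧ Useless μ c a.2.1) ∧
      -- the effective value is degenerate at `μ - c`
      (∀ᵐ a ∂A.firm, (∃! U, IsReservationValue c a.2.1 a.1 U) ∧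
        ∀ U, IsReservationValue c a.2.1 a.1 U → ∀ᵐ x ∂a.2.1, min (x - (a.1 : ℝ)) U = μ - c) ∧
      -- the consumer visits some firm, and it is optimal to buy from the first visited firm at once;
      -- she does so for sure if the posterior exceeds `μ - c`, and in any case if ties are broken
      -- in favour of stopping
      (∀ᵐ ω ∂(Measure.pi fun _ : Fin n => outcomeLaw A.firm),
        let p : Fin n → ℝ≥0 := fun j => (ω j).1
        let x : Fin n → ℝ := fun j => (ω j).2
        ∑ j, (A.policy p).visit [] x j = 1 ∧
        ∀ j, 0 < (A.policy p).visit [] x j →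
          (∀ τ : SearchPolicy n, searchPayoff c p (A.conjecture p) τ [j] x ≤ x j - p j) ∧
          (μ - c < x j → (A.policy p).buy [j] x j = 1) ∧
          (StopsWhenIndifferent c p (A.conjecture p) (A.policy p) →
            (A.policy p).buy [j] x j = 1))) := by
  have hpart : ∀ σ : Measure (ℝ≥0 × Signal μ), IsProbabilityMeasure σ →
      (∀ᵐ a ∂σ, a.1 = 0 ∧ Useless μ c a.2.1) →
      ∃ A : Assessment n μ, A.IsEquilibrium c ∧ A.firm = σ ∧
        (∀ i j, A.belief i = A.belief j) ∧
        ∀ p, StopsWhenIndifferent c p (A.conjecture p) (A.policy p) :=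
    fun σ hσ hσ0 => exists_equilibrium hn hμ.1.le hc σ hσ hσ0
  refine ⟨?_, hpart, fun hc0 A hA => ?_⟩
  -- The uninformative signal is useless because `μ - c ≤ μ`, so charging `0` with it is an
  -- admissible strategy.
  · let F : Signal μ := Signal.point ⟨hμ.1.le, hμ.2.le⟩
    have hu : Useless μ c F.1 := (useless_iff F).2 <| by
      change ∀ᵐ x ∂Measure.dirac μ, μ - c ≤ x
      rw [ae_dirac_eq]
      exact sub_le_self μ hc
    obtain ⟨A, hA, -⟩ := hpart (Measure.dirac (0, F)) inferInstance
      ((ae_dirac_iff ((measurable_fst (measurableSet_singleton 0)).inter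
        (measurable_snd measurableSet_useless))).2 ⟨rfl, hu⟩)
    exact ⟨A, hA⟩
  have hfirm := ae_firm_of_equilibrium hA hn hμ hc0 hcμ
  refine ⟨hfirm, ?_, ?_⟩
  · filter_upwards [hfirm] with a ha
    rw [ha.1]
    refine ⟨⟨μ - c, (isReservationValue_of_useless hc0 ha.2 _).2 rfl, fun U hU =>
      (isReservationValue_of_useless hc0 ha.2 U).1 hU⟩, fun U hU => ?_⟩
    filter_upwards [(useless_iff _).1 ha.2] with x hx
    rw [(isReservationValue_of_useless hc0 ha.2 U).1 hU]
    simpa using hx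
  · obtain ⟨r, hr⟩ := exists_isThreshold A hc
    have hlaw := ae_law_eq_zero hA hn hμ hc0 hcμ
    have hthr : ∀ k, ∀ᵐ q ∂A.priceLaw, r k q = μ - c := fun k => by
      filter_upwards [ae_law hA k (P := fun a => a.1 = 0 ∧ μ - c ≤ a.2)
        ((measurable_fst (measurableSet_singleton 0)).inter (measurable_snd measurableSet_Ici))
        hlaw] with q hq
      exact threshold_eq_of_ae_le hc0 hr (hq.mono fun _ h => h.2)
    have hall := ae_pi_of_ae (fun _ : Fin n => A.law) fun k =>
      hlaw.and (ae_law_of_ae_price (hthr k))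
    filter_upwards [hall, ae_mem_unit (A := A)] with ω hω hx
    have h := hr.isIndex fun j => (ω j).1
    have hπ := hA.consumer_optimal fun j => (ω j).1
    have hU : ∀ k, r k (ω k).1 - ((ω k).1 : ℝ) = μ - c := fun k => by
      rw [(hω k).2, (hω k).1.1]; simp
    have hu : 0 < μ - c := sub_pos.2 hcμ
    refine ⟨visit_nil_sum h hc0 hπ hx (i := ⟨0, by omega⟩) (by rw [hU]; exact hu), fun j _ => ?_⟩
    have hpj : ((ω j).1 : ℝ) = 0 := by simp [(hω j).1.1]
    have := stops_after_first_visit hc0 h hπ hx hu hU (j := j) (by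
      rw [hpj]; linarith [(hω j).1.2])
    refine ⟨this.1, fun hlt => this.2.1 ?_, this.2.2⟩
    rw [hpj]; simpa using hlt
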